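/- Let $\lambda$ be a (real or complex) Banach space with a 1-unconditional basis $(e_n)_{n\in\mathbb N}$. For $1\le r<\infty$ let $\lambda_r$ be its $r$-convexification, i.e. the space of scalar sequences $(t_n)$ for which $\sum_n|t_n|^re_n$ converges in $\lambda$, with norm $\|(t_n)\|_{\lambda_r}=\big\|\sum_n|t_n|^re_n\big\|_\lambda^{1/r}$; for a Banach space $X$ let $\lambda_r(X)$ be the space of sequences $(x_n)$ in $X$ with $(\|x_n\|)_n\in\lambda_r$, normed by $\|(x_n)\|=\big\|(\|x_n\|_X)_n\big\|_{\lambda_r}$. Let $(X_0,X_1)$ be an interpolation couple of complex Banach spaces, that is, both are linearly and continuously embedded in a Hausdorff topological vector space $W$, and let $\Sigma=X_0+X_1$ with $\|x\|_\Sigma=\inf\{\|x_0\|_0+\|x_1\|_1: x=x_0+x_1\}$. Let $\mathcal F(X_0,X_1)$ be the space of functions $g:\{0\le \operatorname{Re} z\le 1\}\to\Sigma$ that are $\Sigma$-bounded and $\Sigma$-continuous on the closed strip, $\Sigma$-analytic on the open strip, and such that $t\mapsto g(j+it)$ is a bounded continuous map $\mathbb R\to X_j$ for $j=0,1$; put $\|g\|_{\mathcal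 F}=\sup\{\|g(j+it)\|_j: j=0,1,\ t\in\mathbb R\}$. For $0<\theta<1$ let $X_\theta=(X_0,X_1)_\theta=\{g(\theta): g\in\mathcal F(X_0,X_1)\}$ with $\|x\|_\theta=\inf\{\|g\|_{\mathcal F}: g(\theta)=x\}$. A derivation associated with $(X_0,X_1)$ at $\theta$ is a map of the form $\Omega(x)=(B(x))'(\theta)$, $x\in X_\theta$, where $B:X_\theta\to\mathcal F(X_0,X_1)$ is homogeneous ($B(cx)=cB(x)$ for $c\in\mathbb C$), bounded ($\|B(x)\|_{\mathcal F}\le C\|x\|_\theta$ for some constant $C$) and satisfies $B(x)(\theta)=x$. The same notions are used for the couple $(\lambda_{p_0}(X_0),\lambda_{p_1}(X_1))$, whose spaces are embedded in $W^{\mathbb N}$. **Theorem.** Let $0<\theta<1$, $1\le p_0,p_1<\infty$ and $\frac1p=\frac{1-\theta}{p_0}+\frac{\theta}{p_1}$. Then $$(\lambda_{p_0}(X_0),\lambda_{p_1}(X_1))_\theta=\lambda_p(X_\theta)$$ with equality of norms. Moreover, if $\Omega_\theta$ is a derivation associated with $(X_0,X_1)$ at $\theta$, then there is a derivation $\Phi_\theta$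 associated with $(\lambda_{p_0}(X_0),\lambda_{p_1}(X_1))$ at $\theta$ such that for every finitely supported $a=\sum_{n=1}^Na_ne_n\in\lambda_p(X_\theta)$ $$\Phi_\theta(a)=\Big(\frac p{p_1}-\frac p{p_0}\Big)\sum_{n=1}^N a_n\log\frac{\|a_n\|_{X_\theta}}{\|a\|_{\lambda_p(X_\theta)}}\,e_n+\sum_{n=1}^N\Omega_\theta(a_n)\,e_n ,$$ where a term with $a_n=0$ in the first sum is read as $0$. -/

import Mathlib

open Filter Topology Complex
open scoped ENNReal NNReal

noncomputable section

namespace VectorInterp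

/-!
A Banach space sitting inside an ambient vector space `W` is recorded by its norm functional
`N : W → ℝ≥0∞`, with `N w = ⊤` exactly when `w` is not in the space.  Equality of two such
functionals means: the two spaces have the same elements and the same norm.
-/

/-- The norm functional on `W` of a Banach space `X` that is linearly and continuously embedded in
`W` by `j`: it is `‖x‖` at `j x`, and `⊤` (an infimum over the empty set) off the range of `j`. -/
def embNorm {X W : Type*} [NormedAddCommGroup X] [NormedSpace ℂ X] [AddCommGroup W] [Module ℂ W]
    [TopologicalSpace W] (j : X →L[ℂ] W) (w : W) : ℝ≥0∞ :=
  ⨅ (x : X) (_ : j x = w), ‖x‖ₑ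

section Interpolation

variable {W : Type*} [AddCommGroup W] [Module ℂ W]

/-- The norm of the sum space `Σ = X₀ + X₁`:
`‖w‖_Σ = inf {‖x₀‖₀ + ‖x₁‖₁ : w = x₀ + x₁}`, and `⊤` for `w ∉ X₀ + X₁`. -/
def sumNorm (N₀ N₁ : W → ℝ≥0∞) (w : W) : ℝ≥0∞ :=
  ⨅ (x₀ : W) (x₁ : W) (_ : x₀ + x₁ = w), N₀ x₀ + N₁ x₁

/-- `g` has the complex derivative `d` at `z`, the difference quotients converging in the norm
of `Σ = X₀ + X₁`. -/
def HasSumDerivAt (N₀ N₁ : W → ℝ≥0∞) (g : ℂ → W) (d : W) (z : ℂ) : Prop :=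
  Tendsto (fun w : ℂ => sumNorm N₀ N₁ ((w - z)⁻¹ • (g w - g z) - d)) (𝓝[≠] z) (𝓝 0)

/-- Membership in the space `𝓕(X₀, X₁)`.  Elements are functions on the closed strip
`{z : 0 ≤ Re z ≤ 1}`; the values of `g : ℂ → W` outside this strip play no role. -/
structure MemF (N₀ N₁ : W → ℝ≥0∞) (g : ℂ → W) : Prop where
  /-- `g` is bounded into `Σ` on the closed strip -/
  bounded : ∃ C : ℝ≥0, ∀ z ∈ HadamardThreeLines.verticalClosedStrip 0 1,
    sumNorm N₀ N₁ (g z) ≤ C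
  /-- `g` is continuous into `Σ` on the closed strip -/
  continuous : ∀ z ∈ HadamardThreeLines.verticalClosedStrip 0 1,
    Tendsto (fun w => sumNorm N₀ N₁ (g w - g z))
      (𝓝[HadamardThreeLines.verticalClosedStrip 0 1] z) (𝓝 0)
  /-- `g` is analytic into `Σ` on the open strip -/
  analytic : ∀ z ∈ HadamardThreeLines.verticalStrip 0 1, ∃ d : W, HasSumDerivAt N₀ N₁ g d z
  /-- `t ↦ g (i t)` takes values in `X₀` and is bounded there -/
  bounded_left : ∃ C : ℝ≥0, ∀ t : ℝ, N₀ (g (t * I)) ≤ C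
  /-- `t ↦ g (i t)` is continuous into `X₀` -/
  continuous_left : ∀ t : ℝ,
    Tendsto (fun s : ℝ => N₀ (g (s * I) - g (t * I))) (𝓝 t) (𝓝 0)
  /-- `t ↦ g (1 + i t)` takes values in `X₁` and is bounded there -/
  bounded_right : ∃ C : ℝ≥0, ∀ t : ℝ, N₁ (g (1 + t * I)) ≤ C
  /-- `t ↦ g (1 + i t)` is continuous into `X₁` -/
  continuous_right : ∀ t : ℝ,
    Tendsto (fun s : ℝ => N₁ (g (1 + s * I) - g (1 + t * I))) (𝓝 t) (𝓝 0)

/-- The norm `‖g‖_𝓕 = sup {‖g (j + i t)‖_j : j = 0, 1; t ∈ ℝ}`. -/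
def normF (N₀ N₁ : W → ℝ≥0∞) (g : ℂ → W) : ℝ≥0∞ :=
  max (⨆ t : ℝ, N₀ (g (t * I))) (⨆ t : ℝ, N₁ (g (1 + t * I)))

/-- The norm functional of the complex interpolation space `X_θ = (X₀, X₁)_θ`:
`‖x‖_θ = inf {‖g‖_𝓕 : g ∈ 𝓕, g θ = x}`.  It is finite exactly when `x = g θ` for some `g ∈ 𝓕`. -/
def interpNorm (N₀ N₁ : W → ℝ≥0∞) (θ : ℝ) (x : W) : ℝ≥0∞ :=
  ⨅ (g : ℂ → W) (_ : MemF N₀ N₁ g) (_ : g θ = x), normF N₀ N₁ g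

/-- `B : X_θ → 𝓕` is a bounded homogeneous selection for the evaluation `δ_θ : g ↦ g θ`. -/
structure IsBoundedHomogeneousSelection (N₀ N₁ : W → ℝ≥0∞) (θ : ℝ) (B : W → ℂ → W) : Prop where
  mem : ∀ x, interpNorm N₀ N₁ θ x ≠ ⊤ → MemF N₀ N₁ (B x)
  eval : ∀ x, interpNorm N₀ N₁ θ x ≠ ⊤ → B x θ = x
  homogeneous : ∀ (c : ℂ) (x : W), interpNorm N₀ N₁ θ x ≠ ⊤ →
    ∀ z ∈ HadamardThreeLines.verticalClosedStrip 0 1, B (c • x) z = c • B x z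
  bounded : ∃ C : ℝ≥0, ∀ x, interpNorm N₀ N₁ θ x ≠ ⊤ →
    normF N₀ N₁ (B x) ≤ C * interpNorm N₀ N₁ θ x

/-- `Ω` is an associated derivation of `(X₀, X₁)` at `θ`: `Ω x = (B x)'(θ)` for all `x ∈ X_θ`,
where `B` is a bounded homogeneous selection.  Values of `Ω` outside `X_θ` play no role. -/
def IsDerivation (N₀ N₁ : W → ℝ≥0∞) (θ : ℝ) (Ω : W → W) : Prop :=
  ∃ B : W → ℂ → W, IsBoundedHomogeneousSelection N₀ N₁ θ B ∧
    ∀ x, interpNorm N₀ N₁ θ x ≠ ⊤ → HasSumDerivAt N₀ N₁ (B x) (Ω x) θ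

end Interpolation

section SequenceSpaces

variable {𝕜 E : Type*} [RCLike 𝕜] [NormedAddCommGroup E] [NormedSpace 𝕜 E]

/-- The basis `e` is 1-unconditional: changing signs of coefficients does not increase the norm
of a finite linear combination. -/
def IsOneUnconditional (e : UnconditionalSchauderBasis ℕ 𝕜 E) : Prop :=
  ∀ (s : Finset ℕ) (a ε : ℕ → 𝕜), (∀ n, ε n = 1 ∨ ε n = -1) →
    ‖∑ n ∈ s, (ε n * a n) • e n‖ ≤ ‖∑ n ∈ s, a n • e n‖

/-- The norm functional of the `p`-convexification `λ_p` of a space `λ` with basis `e`, on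
sequences of (moduli of) scalars: `‖∑ |tₙ|^p eₙ‖^(1/p)` if the series `∑ |tₙ|^p eₙ` converges
in `λ`, and `⊤` otherwise. -/
def convexNorm (e : UnconditionalSchauderBasis ℕ 𝕜 E) (p : ℝ) (t : ℕ → ℝ) : ℝ≥0∞ :=
  open scoped Classical in
  if Summable (fun n => ((|t n| ^ p : ℝ) : 𝕜) • e n) then
    ‖∑' n, ((|t n| ^ p : ℝ) : 𝕜) • e n‖ₑ ^ (1 / p)
  else ⊤

/-- The norm functional of the vector-valued space `λ_p(X)` inside `W^ℕ`, where `N` is the norm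
functional of `X ⊆ W`: a sequence `x` belongs to `λ_p(X)` if all `xₙ ∈ X` and
`(‖xₙ‖)ₙ ∈ λ_p`, and its norm is then the norm of `(‖xₙ‖)ₙ` in `λ_p`. -/
def vecNorm {W : Type*} (e : UnconditionalSchauderBasis ℕ 𝕜 E) (p : ℝ) (N : W → ℝ≥0∞)
    (x : ℕ → W) : ℝ≥0∞ :=
  open scoped Classical in
  if ∀ n, N (x n) ≠ ⊤ then convexNorm e p (fun n => (N (x n)).toReal) else ⊤

end SequenceSpaces

end VectorInterp

end

/-! The norm equality is two inequalities.

The upper bound for the interpolation norm comes from Calderón's extremal functions. Choose almost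
optimal `H n` with `H n θ = a n`, and multiply the `n`-th one by `r ^ (p / p₀ * (1 - z) + p / p₁ * z
- 1)`, where `r` is the size of the `n`-th coordinate relative to the whole norm. The exponent
vanishes at `θ`, and on the line `Re z = j` the product has norm at most a constant times `r ^ (p /
p_j)`, so both boundary norms are controlled at once (`memF_interpFactor`). The same functions built
on a homogeneous selection `B` give a homogeneous selection for sequences. By the product rule its
derivative at `θ` is `(p / p₁ - p / p₀) * log r` times `a n`, plus `Ω (a n)`, which is the stated
derivation (`isDerivation_vecNorm`).

For the lower bound, let `g` have norm at most `1` in the sequence couple. The harmonic measure of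
the strip at `θ`, carried over to the unit circle, gives `‖g θ‖_θ ≤ exp ∫ log ‖g‖` over the boundary
(`interpNorm_le_exp_integral`). Jensen's inequality turns this into a bound of `‖g θ‖_θ ^ p` by a
weighted mean of `‖g‖_j ^ p_j` (`rpow_interpNorm_le_integral`). Used in each coordinate, it
dominates the sequence of `p`-th powers by a Bochner average in `E` of vectors `∑ ‖g_n‖_j ^ p_j e_n`
from the unit ball, and 1-unconditionality concludes (`vecNorm_interpNorm_le_of_normF_le`).

The analytic difficulty is to assemble coordinates into a function that is continuous and analytic
for the sum norm of the sequence couple. This is dominated convergence in `E`, applied after the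
`n`-th couple is dilated so that all coordinates obey a common bound (`memF_vecNorm`). -/

open HadamardThreeLines Set MeasureTheory

set_option linter.unusedSectionVars false

namespace VectorInterp

/-! ### Norm functionals that come from normed spaces. -/

section Represents

variable {W V : Type*} [AddCommGroup W] [Module ℂ W] [NormedAddCommGroup V] [NormedSpace ℂ V]

/-- The norm functional `N` is the norm of the normed space `V`, embedded in `W` by `ι`. -/
structure Represents (N : W → ℝ≥0∞) (ι : V →ₗ[ℂ] W) : Prop where
  norm_eq : ∀ v, N (ι v) = ‖v‖ₑ
  mem_range : ∀ w, N w ≠ ⊤ → ∃ v, ι v = w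

namespace Represents

variable {N : W → ℝ≥0∞} {ι : V →ₗ[ℂ] W}

theorem map_zero (h : Represents N ι) : N 0 = 0 := by
  simpa using h.norm_eq 0

theorem map_smul (h : Represents N ι) {c : ℂ} (hc : c ≠ 0) (w : W) : N (c • w) = ‖c‖ₑ * N w := by
  by_cases hw : N w = ⊤
  · by_cases hcw : N (c • w) = ⊤
    · rw [hw, hcw, ENNReal.mul_top (by simpa using hc)]
    · obtain ⟨v, hv⟩ := h.mem_range _ hcw
      exfalso
      have : w = ι (c⁻¹ • v) := by rw [_root_.map_smul, hv, smul_smul, inv_mul_cancel₀ hc, one_smul]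
      rw [this, h.norm_eq] at hw
      exact enorm_ne_top hw
  · obtain ⟨v, rfl⟩ := h.mem_range _ hw
    rw [← _root_.map_smul, h.norm_eq, h.norm_eq, enorm_smul]

theorem exists_lift (h : Represents N ι) {α : Type*} {s : Set α} {g : α → W}
    (hg : ∀ a ∈ s, N (g a) ≠ ⊤) : ∃ G : α → V, ∀ a ∈ s, ι (G a) = g a := by
  classical
  refine ⟨fun a => if ha : a ∈ s then (h.mem_range _ (hg a ha)).choose else 0, fun a ha => ?_⟩
  simp only [ha, dif_pos]
  exact (h.mem_range _ (hg a ha)).choose_spec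

theorem tendsto_iff (h : Represents N ι) {α : Type*} {l : Filter α} {f : α → V} {v : V} :
    Tendsto (fun a => N (ι (f a) - ι v)) l (𝓝 0) ↔ Tendsto f l (𝓝 v) := by
  rw [tendsto_iff_edist_tendsto_0]
  simp only [← _root_.map_sub, h.norm_eq, edist_eq_enorm_sub]

end Represents

theorem represents_embNorm {X : Type*} [NormedAddCommGroup X] [NormedSpace ℂ X]
    [TopologicalSpace W] (j : X →L[ℂ] W) (hj : Function.Injective j) :
    Represents (embNorm j) (j : X →ₗ[ℂ] W) where
  norm_eq v := by
    refine le_antisymm (iInf₂_le (f := fun x (_ : j x = j v) => ‖x‖ₑ) v rfl)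
      (le_iInf₂ fun x hx => ?_)
    rw [hj hx]
  mem_range w hw := by
    by_contra! H
    refine hw (iInf₂_eq_top.2 fun x hx => (H x hx).elim)

universe u v

/-- The sum space is the quotient of the `ℓ¹`-sum `X₀ ⊕ X₁` by the kernel of `(x₀, x₁) ↦ j₀ x₀ + j₁
x₁`. The kernel is closed because `W` is Hausdorff, so the quotient seminorm is a norm. -/
theorem exists_represents_sumNorm [TopologicalSpace W] [IsTopologicalAddGroup W]
    [ContinuousSMul ℂ W] [T2Space W] {X₀ : Type u} {X₁ : Type v}
    [NormedAddCommGroup X₀] [NormedSpace ℂ X₀] [NormedAddCommGroup X₁] [NormedSpace ℂ X₁]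
    (j₀ : X₀ →L[ℂ] W) (j₁ : X₁ →L[ℂ] W)
    (hj₀ : Function.Injective j₀) (hj₁ : Function.Injective j₁) :
    ∃ (V : Type (max u v)) (_ : NormedAddCommGroup V) (_ : NormedSpace ℂ V) (ι : V →ₗ[ℂ] W),
      Represents (sumNorm (embNorm j₀) (embNorm j₁)) ι := by
  let J : WithLp 1 (X₀ × X₁) →L[ℂ] W :=
    (j₀.comp (ContinuousLinearMap.fst ℂ X₀ X₁) + j₁.comp (ContinuousLinearMap.snd ℂ X₀ X₁)).comp
      (WithLp.prodContinuousLinearEquiv 1 ℂ X₀ X₁ : WithLp 1 (X₀ × X₁) →L[ℂ] X₀ × X₁)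
  have hJ : ∀ q, J q = j₀ q.fst + j₁ q.snd := fun q => rfl
  let S : Submodule ℂ (WithLp 1 (X₀ × X₁)) := LinearMap.ker (J : WithLp 1 (X₀ × X₁) →ₗ[ℂ] W)
  have : IsClosed (S : Set (WithLp 1 (X₀ × X₁))) := J.isClosed_ker
  have hr₀ := represents_embNorm j₀ hj₀
  have hr₁ := represents_embNorm j₁ hj₁
  have hnorm : ∀ q : WithLp 1 (X₀ × X₁), ‖q‖ₑ = ‖q.fst‖ₑ + ‖q.snd‖ₑ := by
    intro q
    have : ‖q‖ = ‖q.fst‖ + ‖q.snd‖ := by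
      simpa using WithLp.prod_norm_eq_add (p := 1) (by simp) q
    rw [← ofReal_norm, this, ENNReal.ofReal_add (norm_nonneg _) (norm_nonneg _), ofReal_norm,
      ofReal_norm]
  refine ⟨WithLp 1 (X₀ × X₁) ⧸ S, inferInstance, inferInstance,
    S.liftQ (J : WithLp 1 (X₀ × X₁) →ₗ[ℂ] W) le_rfl, ?_, ?_⟩
  · intro v
    apply le_antisymm
    · refine ENNReal.le_of_forall_pos_le_add fun ε hε _ => ?_
      obtain ⟨q, rfl, hq⟩ := Submodule.Quotient.norm_mk_lt v (ε := ε) hε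
      have h1 : sumNorm (embNorm j₀) (embNorm j₁) (J q) ≤ ‖q‖ₑ := by
        refine (iInf₂_le (j₀ q.fst) (j₁ q.snd)).trans ((iInf_le _ (hJ q).symm).trans ?_)
        rw [hnorm]
        exact add_le_add (hr₀.norm_eq _).le (hr₁.norm_eq _).le
      refine h1.trans ?_
      rw [← ofReal_norm, ← ofReal_norm, ← ENNReal.ofReal_coe_nnreal]
      exact (ENNReal.ofReal_le_ofReal hq.le).trans ENNReal.ofReal_add_le
    · refine le_iInf₂ fun x₀ x₁ => le_iInf fun hx => ?_
      by_cases h0 : embNorm j₀ x₀ = ⊤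
      · simp [h0]
      by_cases h1 : embNorm j₁ x₁ = ⊤
      · simp [h1]
      obtain ⟨y₀, rfl⟩ := hr₀.mem_range _ h0
      obtain ⟨y₁, rfl⟩ := hr₁.mem_range _ h1
      rw [hr₀.norm_eq, hr₁.norm_eq]
      let q : WithLp 1 (X₀ × X₁) := WithLp.toLp 1 (y₀, y₁)
      have hv : v = Submodule.Quotient.mk q := by
        induction v using Submodule.Quotient.induction_on with
        | _ q' =>
          rw [Submodule.Quotient.eq]
          change J (q' - q) = 0
          rw [_root_.map_sub, sub_eq_zero]
          exact hx.symm
      rw [hv]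
      have := Submodule.Quotient.norm_mk_le S q
      calc _ ≤ ‖q‖ₑ := by
            rw [← ofReal_norm, ← ofReal_norm]; exact ENNReal.ofReal_le_ofReal this
        _ = _ := hnorm q
  · intro w hw
    by_contra! H
    refine hw (iInf₂_eq_top.2 fun x₀ x₁ => iInf_eq_top.2 fun hx => ?_)
    by_contra hne
    rw [ENNReal.add_eq_top, not_or] at hne
    obtain ⟨y₀, rfl⟩ := hr₀.mem_range _ hne.1
    obtain ⟨y₁, rfl⟩ := hr₁.mem_range _ hne.2
    exact H (Submodule.Quotient.mk (WithLp.toLp 1 (y₀, y₁))) hx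

theorem injective_smul [TopologicalSpace W] [ContinuousSMul ℂ W] {X : Type*} [NormedAddCommGroup X]
    [NormedSpace ℂ X] {j : X →L[ℂ] W} (hj : Function.Injective j) {c : ℂ} (hc : c ≠ 0) :
    Function.Injective (c • j) :=
  fun _ _ hxy => hj (smul_right_injective W hc hxy)

theorem embNorm_smul [TopologicalSpace W] [ContinuousSMul ℂ W] {X : Type*} [NormedAddCommGroup X]
    [NormedSpace ℂ X] (j : X →L[ℂ] W) (hj : Function.Injective j) {c : ℂ} (hc : c ≠ 0) (w : W) :
    ‖c‖ₑ * embNorm (c • j) w = embNorm j w := by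
  have h := represents_embNorm j hj
  have h' := represents_embNorm (c • j) (injective_smul hj hc)
  have key : ∀ x : X, ‖c‖ₑ * embNorm (c • j) (j x) = embNorm j (j x) := by
    intro x
    have e1 : embNorm (c • j) (j x) = ‖c⁻¹ • x‖ₑ := by
      rw [← h'.norm_eq]
      simp [smul_smul, hc]
    have e2 : embNorm j (j x) = ‖x‖ₑ := h.norm_eq x
    rw [e1, e2, ← enorm_smul, smul_smul, mul_inv_cancel₀ hc, one_smul]
  by_cases hw : embNorm j w = ⊤
  · by_cases hw' : embNorm (c • j) w = ⊤
    · rw [hw, hw', ENNReal.mul_top (by simpa using hc)]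
    · obtain ⟨x, rfl⟩ := h'.mem_range _ hw'
      have : (c • j) x = j (c • x) := by simp
      exact this ▸ key (c • x)
  · obtain ⟨x, rfl⟩ := h.mem_range _ hw
    exact key x

end Represents

/-! ### The maximum principle and Cauchy estimates on the strip. -/

section Strip

theorem isOpen_verticalStrip : IsOpen (verticalStrip 0 1) :=
  isOpen_Ioo.preimage continuous_re

theorem verticalStrip_subset : verticalStrip 0 1 ⊆ verticalClosedStrip 0 1 :=
  preimage_mono Ioo_subset_Icc_self

theorem closure_verticalStrip : closure (verticalStrip 0 1) = verticalClosedStrip 0 1 := by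
  rw [verticalStrip, verticalClosedStrip, closure_preimage_re, closure_Ioo zero_ne_one]

theorem ofReal_mul_I_mem (t : ℝ) : (t * I : ℂ) ∈ verticalClosedStrip 0 1 := by
  simp [verticalClosedStrip]

theorem one_add_ofReal_mul_I_mem (t : ℝ) : (1 + t * I : ℂ) ∈ verticalClosedStrip 0 1 := by
  simp [verticalClosedStrip]

theorem ofReal_mem_verticalStrip {θ : ℝ} (h0 : 0 < θ) (h1 : θ < 1) :
    (θ : ℂ) ∈ verticalStrip 0 1 := by
  simp [verticalStrip, h0, h1]

variable {V : Type*} [NormedAddCommGroup V] [NormedSpace ℂ V]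

theorem norm_le_of_strip {G : ℂ → V} (hc : ContinuousOn G (verticalClosedStrip 0 1))
    (hd : DifferentiableOn ℂ G (verticalStrip 0 1))
    (hb : ∃ C : ℝ, ∀ z ∈ verticalClosedStrip 0 1, ‖G z‖ ≤ C) {K : ℝ}
    (h0 : ∀ t : ℝ, ‖G (t * I)‖ ≤ K) (h1 : ∀ t : ℝ, ‖G (1 + t * I)‖ ≤ K) {z : ℂ}
    (hz : z ∈ verticalClosedStrip 0 1) : ‖G z‖ ≤ K := by
  obtain ⟨C, hC⟩ := hb
  refine PhragmenLindelof.vertical_strip (a := 0) (b := 1) (f := G) ?_ ?_ ?_ ?_ hz.1 hz.2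
  · exact ⟨hd, by rw [← verticalStrip, closure_verticalStrip]; exact hc⟩
  -- With both constants `0` the Phragmén–Lindelöf growth condition is plain boundedness.
  · refine ⟨0, by positivity, 0, ?_⟩
    refine Asymptotics.IsBigO.of_bound C ?_
    refine Eventually.filter_mono inf_le_right ?_
    rw [eventually_principal]
    intro z hz
    simpa using hC z (verticalStrip_subset hz)
  · intro z hz
    have : z = (z.im : ℂ) * I := by apply Complex.ext <;> simp [hz]
    rw [this]; exact h0 _
  · intro z hz
    have : z = 1 + (z.im : ℂ) * I := by apply Complex.ext <;> simp [hz]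
    rw [this]; exact h1 _

/-- Cauchy's estimate on discs of radius `r / 4` bounds the derivative by `4 * K / r` on the half
ball, and the mean value inequality passes this to the slope. The bound depends on `G` only through
`K`; this is what dominates the difference quotients of all coordinates at once. -/
theorem norm_slope_sub_deriv_le {G : ℂ → V} {z w : ℂ} {r K : ℝ} (hr : 0 < r)
    (hd : DifferentiableOn ℂ G (Metric.ball z r)) (hK : ∀ x ∈ Metric.ball z r, ‖G x‖ ≤ K)
    (hw : w ∈ Metric.ball z (r / 2)) (hwz : w ≠ z) :
    ‖(w - z)⁻¹ • (G w - G z) - deriv G z‖ ≤ 8 * K / r := by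
  have hsub : ∀ x ∈ Metric.ball z (r / 2), Metric.closedBall x (r / 4) ⊆ Metric.ball z r := by
    intro x hx y hy
    rw [Metric.mem_ball] at *
    rw [Metric.mem_closedBall] at hy
    linarith [dist_triangle y x z]
  have hder : ∀ x ∈ Metric.ball z (r / 2), ‖deriv G x‖ ≤ K / (r / 4) := by
    intro x hx
    refine Complex.norm_deriv_le_of_forall_mem_sphere_norm_le (by linarith) ?_ ?_
    · exact (hd.mono (hsub x hx)).diffContOnCl_ball subset_rfl
    · exact fun y hy => hK y (hsub x hx (Metric.sphere_subset_closedBall hy))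
  have hdiff : ∀ x ∈ Metric.ball z (r / 2), DifferentiableAt ℂ G x := fun x hx =>
    hd.differentiableAt (Metric.isOpen_ball.mem_nhds
      (hsub x hx (Metric.mem_closedBall_self (by linarith))))
  have hz : z ∈ Metric.ball z (r / 2) := Metric.mem_ball_self (by linarith)
  have hmv := (convex_ball z (r / 2)).norm_image_sub_le_of_norm_deriv_le hdiff hder hz hw
  have hpos : 0 < ‖w - z‖ := norm_pos_iff.2 (sub_ne_zero.2 hwz)
  calc _ ≤ ‖(w - z)⁻¹ • (G w - G z)‖ + ‖deriv G z‖ := norm_sub_le _ _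
    _ ≤ K / (r / 4) + K / (r / 4) := by
        refine add_le_add ?_ (hder z hz)
        rw [norm_smul, norm_inv, inv_mul_le_iff₀ hpos, mul_comm]
        exact hmv
    _ = 8 * K / r := by field_simp; ring

end Strip

/-! ### The space `𝓕` in terms of functions with values in normed spaces. -/

section Lift

variable {W V V₀ V₁ : Type*} [AddCommGroup W] [Module ℂ W]
  [NormedAddCommGroup V] [NormedSpace ℂ V] [NormedAddCommGroup V₀] [NormedSpace ℂ V₀]
  [NormedAddCommGroup V₁] [NormedSpace ℂ V₁]
  {N N₀ N₁ : W → ℝ≥0∞} {ι : V →ₗ[ℂ] W} {ι₀ : V₀ →ₗ[ℂ] W} {ι₁ : V₁ →ₗ[ℂ] W} {g : ℂ → W}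

theorem exists_nnreal_bound_iff {α : Type*} {s : Set α} {f : α → V} :
    (∃ C : ℝ≥0, ∀ a ∈ s, ‖f a‖ₑ ≤ C) ↔ ∃ C : ℝ, ∀ a ∈ s, ‖f a‖ ≤ C := by
  constructor
  · rintro ⟨C, hC⟩
    refine ⟨C, fun a ha => ?_⟩
    have := hC a ha
    rw [enorm_le_coe] at this
    exact this
  · rintro ⟨C, hC⟩
    refine ⟨C.toNNReal, fun a ha => ?_⟩
    rw [enorm_le_coe, ← NNReal.coe_le_coe, coe_nnnorm]
    exact (hC a ha).trans (Real.le_coe_toNNReal C)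

/-- The map `G` into the normed space `V` is the lift along `ι` of the restriction of `g` to `s`;
it is bounded and continuous on `s`. -/
structure IsLift {α : Type*} [TopologicalSpace α] (ι : V →ₗ[ℂ] W) (s : Set α) (g : α → W)
    (G : α → V) : Prop where
  eq : ∀ a ∈ s, ι (G a) = g a
  cont : ContinuousOn G s
  bdd : ∃ C : ℝ, ∀ a ∈ s, ‖G a‖ ≤ C

theorem Represents.exists_isLift_iff (h : Represents N ι) {α : Type*} [TopologicalSpace α]
    {s : Set α} {g : α → W} :
    (∃ G, IsLift ι s g G) ↔ (∃ C : ℝ≥0, ∀ a ∈ s, N (g a) ≤ C) ∧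
      ∀ a ∈ s, Tendsto (fun b => N (g b - g a)) (𝓝[s] a) (𝓝 0) := by
  have key : ∀ G : α → V, (∀ a ∈ s, ι (G a) = g a) → ((∀ a ∈ s, Tendsto (fun b => N (g b - g a))
      (𝓝[s] a) (𝓝 0)) ↔ ContinuousOn G s) := by
    intro G hG
    refine forall₂_congr fun a ha => ?_
    rw [ContinuousWithinAt, ← h.tendsto_iff]
    refine tendsto_congr' ?_
    filter_upwards [self_mem_nhdsWithin] with b hb
    rw [hG a ha, hG b hb]
  have key' : ∀ G : α → V, (∀ a ∈ s, ι (G a) = g a) → ((∃ C : ℝ≥0, ∀ a ∈ s, N (g a) ≤ C) ↔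
      ∃ C : ℝ, ∀ a ∈ s, ‖G a‖ ≤ C) := by
    intro G hG
    rw [← exists_nnreal_bound_iff]
    refine exists_congr fun C => forall₂_congr fun a ha => ?_
    rw [← hG a ha, h.norm_eq]
  constructor
  · rintro ⟨G, hG⟩
    exact ⟨(key' G hG.eq).2 hG.bdd, (key G hG.eq).2 hG.cont⟩
  · rintro ⟨⟨C, hC⟩, h2⟩
    obtain ⟨G, hG⟩ := h.exists_lift (g := g) (s := s)
      (fun a ha => ne_top_of_le_ne_top ENNReal.coe_ne_top (hC a ha))
    exact ⟨G, hG, (key G hG).1 h2, (key' G hG).1 ⟨C, hC⟩⟩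

theorem Represents.exists_isLift_univ_iff (h : Represents N ι) {γ : ℝ → W} :
    (∃ G, IsLift ι univ γ G) ↔ (∃ C : ℝ≥0, ∀ t, N (γ t) ≤ C) ∧
      ∀ t, Tendsto (fun s => N (γ s - γ t)) (𝓝 t) (𝓝 0) := by
  rw [h.exists_isLift_iff]
  simp

theorem Represents.hasSumDerivAt_iff (h : Represents (sumNorm N₀ N₁) ι) {G : ℂ → V}
    (hG : ∀ z ∈ verticalClosedStrip 0 1, ι (G z) = g z) {z : ℂ} (hz : z ∈ verticalStrip 0 1)
    {d : V} : HasSumDerivAt N₀ N₁ g (ι d) z ↔ HasDerivAt G d z := by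
  rw [hasDerivAt_iff_tendsto_slope, ← h.tendsto_iff, HasSumDerivAt]
  refine tendsto_congr' ?_
  filter_upwards [mem_nhdsWithin_of_mem_nhds (isOpen_verticalStrip.mem_nhds hz)] with w hw
  rw [slope_def_module, _root_.map_smul, _root_.map_sub, hG w (verticalStrip_subset hw),
    hG z (verticalStrip_subset hz)]

/-- A derivative taken in `W` automatically lies in the sum space: near `z` it differs from a
difference quotient, which lies there, by an element of finite sum norm. -/
theorem Represents.exists_of_hasSumDerivAt (h : Represents (sumNorm N₀ N₁) ι) {G : ℂ → V}
    (hG : ∀ z ∈ verticalClosedStrip 0 1, ι (G z) = g z) {z : ℂ} (hz : z ∈ verticalStrip 0 1)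
    {d : W} (hd : HasSumDerivAt N₀ N₁ g d z) : ∃ d', ι d' = d ∧ HasDerivAt G d' z := by
  have h1 := hd.eventually_lt_const (u := 1) zero_lt_one
  have h2 : ∀ᶠ w in 𝓝[≠] z, w ∈ verticalStrip 0 1 :=
    mem_nhdsWithin_of_mem_nhds (isOpen_verticalStrip.mem_nhds hz)
  obtain ⟨w, hw1, hw2⟩ := (h1.and h2).exists
  obtain ⟨v, hv⟩ := h.mem_range _ (hw1.trans ENNReal.one_lt_top).ne
  have : ι ((w - z)⁻¹ • (G w - G z) - v) = d := by
    rw [_root_.map_sub, hv, _root_.map_smul, _root_.map_sub, hG w (verticalStrip_subset hw2),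
      hG z (verticalStrip_subset hz)]
    abel
  refine ⟨_, this, (h.hasSumDerivAt_iff hG hz).1 (this ▸ hd)⟩

/-- This replaces the functional-valued conditions by ordinary continuity and differentiability, so
that normed-space calculus applies. -/
theorem memF_iff (h : Represents (sumNorm N₀ N₁) ι) (h₀ : Represents N₀ ι₀)
    (h₁ : Represents N₁ ι₁) :
    MemF N₀ N₁ g ↔ (∃ G, IsLift ι (verticalClosedStrip 0 1) g G ∧
      DifferentiableOn ℂ G (verticalStrip 0 1)) ∧
      (∃ G₀, IsLift ι₀ univ (fun t : ℝ => g (t * I)) G₀) ∧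
      (∃ G₁, IsLift ι₁ univ (fun t : ℝ => g (1 + t * I)) G₁) := by
  rw [h₀.exists_isLift_univ_iff, h₁.exists_isLift_univ_iff]
  constructor
  · intro hg
    refine ⟨?_, ⟨hg.bounded_left, hg.continuous_left⟩, ⟨hg.bounded_right, hg.continuous_right⟩⟩
    obtain ⟨G, hG⟩ := h.exists_isLift_iff.2 ⟨hg.bounded, hg.continuous⟩
    refine ⟨G, hG, fun z hz => ?_⟩
    obtain ⟨d, hd⟩ := hg.analytic z hz
    obtain ⟨d', -, hd'⟩ := h.exists_of_hasSumDerivAt hG.eq hz hd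
    exact hd'.differentiableAt.differentiableWithinAt
  · rintro ⟨⟨G, hG, hGd⟩, ⟨hb0, hc0⟩, ⟨hb1, hc1⟩⟩
    obtain ⟨hb, hc⟩ := h.exists_isLift_iff.1 ⟨G, hG⟩
    exact ⟨hb, hc, fun z hz => ⟨ι (deriv G z), (h.hasSumDerivAt_iff hG.eq hz).2
      (hGd.differentiableAt (isOpen_verticalStrip.mem_nhds hz)).hasDerivAt⟩, hb0, hc0, hb1, hc1⟩

theorem IsLift.smul {α : Type*} [TopologicalSpace α] {s : Set α} {g : α → W} {G : α → V}
    (hG : IsLift ι s g G) {f : α → ℂ} (hf : ContinuousOn f s) (hb : ∃ C : ℝ, ∀ a ∈ s, ‖f a‖ ≤ C) :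
    IsLift ι s (fun a => f a • g a) (fun a => f a • G a) where
  eq a ha := by rw [_root_.map_smul, hG.eq a ha]
  cont := hf.smul hG.cont
  bdd := by
    obtain ⟨C, hC⟩ := hb
    obtain ⟨D, hD⟩ := hG.bdd
    refine ⟨C * D, fun a ha => ?_⟩
    rw [norm_smul]
    exact mul_le_mul (hC a ha) (hD a ha) (norm_nonneg _) ((norm_nonneg _).trans (hC a ha))

theorem MemF.smul (h : Represents (sumNorm N₀ N₁) ι) (h₀ : Represents N₀ ι₀)
    (h₁ : Represents N₁ ι₁) (hg : MemF N₀ N₁ g) {f : ℂ → ℂ}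
    (hc : ContinuousOn f (verticalClosedStrip 0 1)) (hd : DifferentiableOn ℂ f (verticalStrip 0 1))
    (hb : ∃ C : ℝ, ∀ z ∈ verticalClosedStrip 0 1, ‖f z‖ ≤ C) :
    MemF N₀ N₁ (fun z => f z • g z) := by
  rw [memF_iff h h₀ h₁] at hg ⊢
  obtain ⟨⟨G, hG, hGd⟩, ⟨G₀, hG₀⟩, ⟨G₁, hG₁⟩⟩ := hg
  obtain ⟨C, hC⟩ := hb
  refine ⟨⟨_, hG.smul hc ⟨C, hC⟩, hd.smul hGd⟩,
    ⟨_, hG₀.smul (f := fun t : ℝ => f (t * I)) ?_ ⟨C, fun t _ => hC _ (ofReal_mul_I_mem t)⟩⟩,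
    ⟨_, hG₁.smul (f := fun t : ℝ => f (1 + t * I)) ?_
      ⟨C, fun t _ => hC _ (one_add_ofReal_mul_I_mem t)⟩⟩⟩
  · exact hc.comp (by fun_prop) (fun t _ => ofReal_mul_I_mem t)
  · exact hc.comp (by fun_prop) (fun t _ => one_add_ofReal_mul_I_mem t)

theorem HasSumDerivAt.smul (h : Represents (sumNorm N₀ N₁) ι) (h₀ : Represents N₀ ι₀)
    (h₁ : Represents N₁ ι₁) (hg : MemF N₀ N₁ g) {d : W} {z : ℂ} (hz : z ∈ verticalStrip 0 1)
    (hgd : HasSumDerivAt N₀ N₁ g d z) {f : ℂ → ℂ} {f' : ℂ} (hf : HasDerivAt f f' z) :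
    HasSumDerivAt N₀ N₁ (fun z => f z • g z) (f' • g z + f z • d) z := by
  obtain ⟨⟨G, hG, hGd⟩, -, -⟩ := (memF_iff h h₀ h₁).1 hg
  obtain ⟨d', rfl, hd'⟩ := h.exists_of_hasSumDerivAt hG.eq hz hgd
  have := hf.smul hd'
  rw [← h.hasSumDerivAt_iff (g := fun z => f z • g z) (fun w hw => by
    rw [Pi.smul_apply', _root_.map_smul, hG.eq w hw]) hz] at this
  rwa [add_comm, _root_.map_add, _root_.map_smul, _root_.map_smul,
    hG.eq z (verticalStrip_subset hz)] at this

theorem sumNorm_le_left (h₁ : N₁ 0 = 0) (w : W) : sumNorm N₀ N₁ w ≤ N₀ w := by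
  refine (iInf₂_le w 0).trans ((iInf_le _ (add_zero w)).trans ?_)
  rw [h₁, add_zero]

theorem sumNorm_le_right (h₀ : N₀ 0 = 0) (w : W) : sumNorm N₀ N₁ w ≤ N₁ w := by
  refine (iInf₂_le 0 w).trans ((iInf_le _ (zero_add w)).trans ?_)
  rw [h₀, zero_add]

theorem le_normF_left (t : ℝ) : N₀ (g (t * I)) ≤ normF N₀ N₁ g :=
  (le_iSup (fun t : ℝ => N₀ (g (t * I))) t).trans (le_max_left _ _)

theorem le_normF_right (t : ℝ) : N₁ (g (1 + t * I)) ≤ normF N₀ N₁ g :=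
  (le_iSup (fun t : ℝ => N₁ (g (1 + t * I))) t).trans (le_max_right _ _)

theorem normF_le {K : ℝ≥0∞} (h0 : ∀ t : ℝ, N₀ (g (t * I)) ≤ K)
    (h1 : ∀ t : ℝ, N₁ (g (1 + t * I)) ≤ K) : normF N₀ N₁ g ≤ K :=
  max_le (iSup_le h0) (iSup_le h1)

theorem MemF.normF_ne_top (hg : MemF N₀ N₁ g) : normF N₀ N₁ g ≠ ⊤ := by
  obtain ⟨C, hC⟩ := hg.bounded_left
  obtain ⟨D, hD⟩ := hg.bounded_right
  refine ne_top_of_le_ne_top (ENNReal.coe_ne_top (r := max C D))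
    (normF_le (fun t => ?_) fun t => ?_)
  · exact (hC t).trans (by simp)
  · exact (hD t).trans (by simp)

theorem interpNorm_le_normF {θ : ℝ} (hg : MemF N₀ N₁ g) :
    interpNorm N₀ N₁ θ (g θ) ≤ normF N₀ N₁ g :=
  (iInf₂_le g hg).trans (iInf_le _ rfl)

theorem exists_of_interpNorm_lt {θ : ℝ} {x : W} {K : ℝ≥0∞} (h : interpNorm N₀ N₁ θ x < K) :
    ∃ g, g θ = x ∧ MemF N₀ N₁ g ∧ normF N₀ N₁ g < K := by
  simpa [interpNorm, iInf_lt_iff] using h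

theorem tendsto_zero_of_le_mul {α : Type*} {l : Filter α} {f f' : α → ℝ≥0∞} (C : ℝ≥0)
    (hff : ∀ a, f' a ≤ C * f a) (hf : Tendsto f l (𝓝 0)) : Tendsto f' l (𝓝 0) := by
  have := ENNReal.Tendsto.const_mul (a := (C : ℝ≥0∞)) hf (Or.inr ENNReal.coe_ne_top)
  rw [mul_zero] at this
  exact tendsto_of_tendsto_of_tendsto_of_le_of_le tendsto_const_nhds this (fun _ => zero_le) hff

section Map

variable {W' : Type*} [AddCommGroup W'] [Module ℂ W'] {M₀ M₁ : W' → ℝ≥0∞}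

theorem sumNorm_map_le (T : W →ₗ[ℂ] W') {C : ℝ≥0}
    (hC : C ≠ 0) (h₀ : ∀ w, M₀ (T w) ≤ C * N₀ w) (h₁ : ∀ w, M₁ (T w) ≤ C * N₁ w) (w : W) :
    sumNorm M₀ M₁ (T w) ≤ C * sumNorm N₀ N₁ w := by
  have hC' : (C : ℝ≥0∞) ≠ 0 := by simpa using hC
  simp only [sumNorm, ENNReal.mul_iInf_of_ne hC' ENNReal.coe_ne_top, mul_add]
  refine le_iInf₂ fun x₀ x₁ => le_iInf fun hx => ?_
  refine (iInf₂_le (T x₀) (T x₁)).trans ((iInf_le _ ?_).trans (add_le_add (h₀ _) (h₁ _)))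
  rw [← _root_.map_add, hx]

theorem HasSumDerivAt.map (T : W →ₗ[ℂ] W') {C : ℝ≥0}
    (hC : C ≠ 0) (h₀ : ∀ w, M₀ (T w) ≤ C * N₀ w) (h₁ : ∀ w, M₁ (T w) ≤ C * N₁ w) {d : W} {z : ℂ}
    (hd : HasSumDerivAt N₀ N₁ g d z) :
    HasSumDerivAt M₀ M₁ (fun z => T (g z)) (T d) z := by
  refine tendsto_zero_of_le_mul C (fun w => ?_) hd
  rw [← _root_.map_sub, ← _root_.map_smul, ← _root_.map_sub]
  exact sumNorm_map_le T hC h₀ h₁ _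

/-- A bounded linear map of couples acts on the spaces `𝓕`. -/
theorem MemF.map (T : W →ₗ[ℂ] W') {C : ℝ≥0}
    (hC : C ≠ 0) (h₀ : ∀ w, M₀ (T w) ≤ C * N₀ w) (h₁ : ∀ w, M₁ (T w) ≤ C * N₁ w) (hg : MemF N₀ N₁ g) :
    MemF M₀ M₁ (fun z => T (g z)) := by
  have hs := sumNorm_map_le T hC h₀ h₁
  refine ⟨?_, ?_, ?_, ?_, ?_, ?_, ?_⟩
  · obtain ⟨D, hD⟩ := hg.bounded
    refine ⟨C * D, fun z hz => (hs _).trans ?_⟩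
    rw [ENNReal.coe_mul]
    exact mul_le_mul_right (hD z hz) _
  · exact fun z hz => tendsto_zero_of_le_mul C (fun w => by rw [← _root_.map_sub]; exact hs _)
      (hg.continuous z hz)
  · intro z hz
    obtain ⟨d, hd⟩ := hg.analytic z hz
    exact ⟨T d, hd.map T hC h₀ h₁⟩
  · obtain ⟨D, hD⟩ := hg.bounded_left
    refine ⟨C * D, fun t => (h₀ _).trans ?_⟩
    rw [ENNReal.coe_mul]
    exact mul_le_mul_right (hD t) _
  · exact fun t => tendsto_zero_of_le_mul C (fun w => by rw [← _root_.map_sub]; exact h₀ _)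
      (hg.continuous_left t)
  · obtain ⟨D, hD⟩ := hg.bounded_right
    refine ⟨C * D, fun t => (h₁ _).trans ?_⟩
    rw [ENNReal.coe_mul]
    exact mul_le_mul_right (hD t) _
  · exact fun t => tendsto_zero_of_le_mul C (fun w => by rw [← _root_.map_sub]; exact h₁ _)
      (hg.continuous_right t)

end Map

/-- The factor `2` leaves room to choose a decomposition when the sum norm is finite and nonzero. If
it is zero then `w = 0`, because the sum norm is a genuine norm. A multiplicative bound, unlike an
additive error, lets both pieces tend to zero together with `w`. -/
theorem exists_add_eq_le_sumNorm (h : Represents (sumNorm N₀ N₁) ι) (h₀ : N₀ 0 = 0)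
    (h₁ : N₁ 0 = 0) (w : W) :
    ∃ u v, u + v = w ∧ N₀ u ≤ 2 * sumNorm N₀ N₁ w ∧ N₁ v ≤ 2 * sumNorm N₀ N₁ w := by
  by_cases hw : sumNorm N₀ N₁ w = ⊤
  · refine ⟨w, 0, add_zero w, ?_, ?_⟩ <;> simp [hw, h₁, ENNReal.mul_top]
  obtain ⟨v, rfl⟩ := h.mem_range w hw
  by_cases hv : v = 0
  · exact ⟨0, 0, by simp [hv], by simp [h₀], by simp [h₁]⟩
  have hlt : sumNorm N₀ N₁ (ι v) < 2 * sumNorm N₀ N₁ (ι v) := by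
    rw [two_mul]
    refine ENNReal.lt_add_right hw ?_
    rw [h.norm_eq]
    exact enorm_ne_zero.2 hv
  obtain ⟨x₀, x₁, hx, hlt'⟩ : ∃ x₀ x₁, x₀ + x₁ = ι v ∧ N₀ x₀ + N₁ x₁ <
      2 * sumNorm N₀ N₁ (ι v) := by
    nth_rewrite 1 [sumNorm] at hlt
    simpa only [iInf_lt_iff, exists_prop] using hlt
  exact ⟨x₀, x₁, hx, le_self_add.trans hlt'.le, le_add_self.trans hlt'.le⟩

end Lift

/-! ### Interior estimates in the sum norm by the norm of `𝓕`. -/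

section Estimates

variable {W V V₀ V₁ : Type*} [AddCommGroup W] [Module ℂ W]
  [NormedAddCommGroup V] [NormedSpace ℂ V] [NormedAddCommGroup V₀] [NormedSpace ℂ V₀]
  [NormedAddCommGroup V₁] [NormedSpace ℂ V₁]
  {N₀ N₁ : W → ℝ≥0∞} {ι : V →ₗ[ℂ] W} {ι₀ : V₀ →ₗ[ℂ] W} {ι₁ : V₁ →ₗ[ℂ] W} {g : ℂ → W}
  {K : ℝ≥0}

theorem norm_lift_le (h : Represents (sumNorm N₀ N₁) ι) (h₀ : Represents N₀ ι₀)
    (h₁ : Represents N₁ ι₁) {G : ℂ → V} (hG : IsLift ι (verticalClosedStrip 0 1) g G)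
    (hGd : DifferentiableOn ℂ G (verticalStrip 0 1)) (hK : normF N₀ N₁ g ≤ K) {z : ℂ}
    (hz : z ∈ verticalClosedStrip 0 1) : ‖G z‖ ≤ K := by
  refine norm_le_of_strip hG.cont hGd hG.bdd (fun t => ?_) (fun t => ?_) hz
  · have := (sumNorm_le_left h₁.map_zero _).trans ((le_normF_left t).trans hK)
    rw [← hG.eq _ (ofReal_mul_I_mem t), h.norm_eq, enorm_le_coe] at this
    exact this
  · have := (sumNorm_le_right h₀.map_zero _).trans ((le_normF_right t).trans hK)
    rw [← hG.eq _ (one_add_ofReal_mul_I_mem t), h.norm_eq, enorm_le_coe] at this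
    exact this

theorem MemF.sumNorm_le (h : Represents (sumNorm N₀ N₁) ι) (h₀ : Represents N₀ ι₀)
    (h₁ : Represents N₁ ι₁) (hg : MemF N₀ N₁ g) (hK : normF N₀ N₁ g ≤ K) {z : ℂ}
    (hz : z ∈ verticalClosedStrip 0 1) : sumNorm N₀ N₁ (g z) ≤ K := by
  obtain ⟨⟨G, hG, hGd⟩, -, -⟩ := (memF_iff h h₀ h₁).1 hg
  rw [← hG.eq z hz, h.norm_eq, enorm_le_coe]
  exact norm_lift_le h h₀ h₁ hG hGd hK hz

theorem MemF.sumNorm_sub_le (h : Represents (sumNorm N₀ N₁) ι) (h₀ : Represents N₀ ι₀)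
    (h₁ : Represents N₁ ι₁) (hg : MemF N₀ N₁ g) (hK : normF N₀ N₁ g ≤ K) {z w : ℂ}
    (hz : z ∈ verticalClosedStrip 0 1) (hw : w ∈ verticalClosedStrip 0 1) :
    sumNorm N₀ N₁ (g w - g z) ≤ (2 * K : ℝ≥0) := by
  obtain ⟨⟨G, hG, hGd⟩, -, -⟩ := (memF_iff h h₀ h₁).1 hg
  rw [← hG.eq z hz, ← hG.eq w hw, ← _root_.map_sub, h.norm_eq, enorm_le_coe, two_mul]
  exact (nnnorm_sub_le _ _).trans (add_le_add (norm_lift_le h h₀ h₁ hG hGd hK hw)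
    (norm_lift_le h h₀ h₁ hG hGd hK hz))

theorem MemF.sumNorm_slope_sub_le (h : Represents (sumNorm N₀ N₁) ι) (h₀ : Represents N₀ ι₀)
    (h₁ : Represents N₁ ι₁) (hg : MemF N₀ N₁ g) (hK : normF N₀ N₁ g ≤ K) {z w : ℂ} {r : ℝ≥0}
    (hr : 0 < r) (hz : Metric.ball z r ⊆ verticalStrip 0 1) (hw : w ∈ Metric.ball z (r / 2))
    (hwz : w ≠ z) {d : W} (hd : HasSumDerivAt N₀ N₁ g d z) :
    sumNorm N₀ N₁ ((w - z)⁻¹ • (g w - g z) - d) ≤ (8 * K / r : ℝ≥0) := by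
  obtain ⟨⟨G, hG, hGd⟩, -, -⟩ := (memF_iff h h₀ h₁).1 hg
  have hr' : (0 : ℝ) < r := hr
  have hz' : z ∈ verticalStrip 0 1 := hz (Metric.mem_ball_self hr')
  obtain ⟨d', rfl, hd'⟩ := h.exists_of_hasSumDerivAt hG.eq hz' hd
  have hw' : w ∈ verticalStrip 0 1 := hz (Metric.ball_subset_ball (by linarith) hw)
  rw [← hG.eq z (verticalStrip_subset hz'), ← hG.eq w (verticalStrip_subset hw'),
    ← _root_.map_sub, ← _root_.map_smul, ← _root_.map_sub, h.norm_eq, enorm_le_coe, ← hd'.deriv]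
  exact norm_slope_sub_deriv_le hr' (hGd.mono hz) (fun x hx =>
    norm_lift_le h h₀ h₁ hG hGd hK (verticalStrip_subset (hz hx))) hw hwz

end Estimates

/-! ### The lattice structure given by a 1-unconditional basis. -/

section Lattice

variable {𝕜 E : Type*} [RCLike 𝕜] [NormedAddCommGroup E] [NormedSpace 𝕜 E]
  {e : UnconditionalSchauderBasis ℕ 𝕜 E}

/-- Coordinates are lowered one at a time. If `a m = c * b m` with `0 ≤ c ≤ 1`, the new vector is a
convex combination, with weights `(1 + c) / 2` and `(1 - c) / 2`, of the old one and of the old one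
with its `m`-th sign flipped. -/
theorem norm_sum_le_norm_sum (he : IsOneUnconditional e) (s : Finset ℕ) {a b : ℕ → ℝ}
    (ha : ∀ n, 0 ≤ a n) (hab : ∀ n, a n ≤ b n) :
    ‖∑ n ∈ s, (a n : 𝕜) • e n‖ ≤ ‖∑ n ∈ s, (b n : 𝕜) • e n‖ := by
  classical
  have key : ∀ t : Finset ℕ,
      ‖∑ n ∈ s, ((if n ∈ t then a n else b n : ℝ) : 𝕜) • e n‖ ≤ ‖∑ n ∈ s, (b n : 𝕜) • e n‖ := by
    intro t
    induction t using Finset.induction_on with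
    | empty => simp
    | insert m t hm ih =>
      set c : ℝ := a m / b m with hc
      have hc0 : 0 ≤ c := div_nonneg (ha m) ((ha m).trans (hab m))
      have hc1 : c ≤ 1 := div_le_one_of_le₀ (hab m) ((ha m).trans (hab m))
      have hcb : a m = c * b m := by
        by_cases hb : b m = 0
        · have := hab m; rw [hb] at this ⊢; linarith [ha m]
        · rw [hc]; field_simp
      let ε : ℕ → 𝕜 := fun n => if n = m then -1 else 1
      have hε : ∀ n, ε n = 1 ∨ ε n = -1 := fun n => by by_cases h : n = m <;> simp [ε, h]
      have heq : ∑ n ∈ s, ((if n ∈ insert m t then a n else b n : ℝ) : 𝕜) • e n =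
          (((1 + c) / 2 : ℝ) : 𝕜) • (∑ n ∈ s, ((if n ∈ t then a n else b n : ℝ) : 𝕜) • e n) +
          (((1 - c) / 2 : ℝ) : 𝕜) •
            (∑ n ∈ s, (ε n * ((if n ∈ t then a n else b n : ℝ) : 𝕜)) • e n) := by
        rw [Finset.smul_sum, Finset.smul_sum, ← Finset.sum_add_distrib]
        refine Finset.sum_congr rfl fun n _ => ?_
        rw [smul_smul, smul_smul, ← add_smul]
        congr 1
        by_cases hn : n = m
        · subst hn
          simp only [Finset.mem_insert, true_or, if_true, hm, if_false, hcb, ε]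
          push_cast; ring
        · simp only [Finset.mem_insert, hn, false_or, ε, if_false]
          push_cast; ring
      rw [heq]
      refine (norm_add_le _ _).trans ?_
      rw [norm_smul, norm_smul, RCLike.norm_ofReal, RCLike.norm_ofReal,
        abs_of_nonneg (by linarith), abs_of_nonneg (by linarith)]
      have h2 := (he s (fun n => ((if n ∈ t then a n else b n : ℝ) : 𝕜)) ε hε).trans ih
      nlinarith [mul_le_mul_of_nonneg_left ih (by linarith : 0 ≤ (1 + c) / 2),
        mul_le_mul_of_nonneg_left h2 (by linarith : 0 ≤ (1 - c) / 2)]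
  have := key s
  rwa [Finset.sum_congr rfl (fun n hn => by rw [if_pos hn])] at this

theorem summable_of_le [CompleteSpace E] (he : IsOneUnconditional e) {a b : ℕ → ℝ}
    (ha : ∀ n, 0 ≤ a n) (hab : ∀ n, a n ≤ b n) (hb : Summable fun n => (b n : 𝕜) • e n) :
    Summable fun n => (a n : 𝕜) • e n := by
  rw [summable_iff_vanishing_norm] at hb ⊢
  intro ε hε
  obtain ⟨s, hs⟩ := hb ε hε
  exact ⟨s, fun t ht => (norm_sum_le_norm_sum he t ha hab).trans_lt (hs t ht)⟩

theorem norm_tsum_le_norm_tsum [CompleteSpace E] (he : IsOneUnconditional e) {a b : ℕ → ℝ}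
    (ha : ∀ n, 0 ≤ a n) (hab : ∀ n, a n ≤ b n) (hb : Summable fun n => (b n : 𝕜) • e n) :
    ‖∑' n, (a n : 𝕜) • e n‖ ≤ ‖∑' n, (b n : 𝕜) • e n‖ :=
  le_of_tendsto_of_tendsto' (summable_of_le he ha hab hb).hasSum.norm hb.hasSum.norm
    fun s => norm_sum_le_norm_sum he s ha hab

/-- Dominated convergence in `E`: the tails are small uniformly in `a`, being dominated by those of
`b`, and the finite head converges coordinatewise. -/
theorem tendsto_norm_tsum_zero [CompleteSpace E] (he : IsOneUnconditional e) {α : Type*}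
    {l : Filter α} {σ : α → ℕ → ℝ} {b : ℕ → ℝ} (hb : Summable fun n => (b n : 𝕜) • e n)
    (hσ0 : ∀ᶠ a in l, ∀ n, 0 ≤ σ a n) (hσb : ∀ᶠ a in l, ∀ n, σ a n ≤ b n)
    (hlim : ∀ n, Tendsto (fun a => σ a n) l (𝓝 0)) :
    Tendsto (fun a => ‖∑' n, (σ a n : 𝕜) • e n‖) l (𝓝 0) := by
  classical
  refine tendsto_order.2 ⟨fun x hx => Eventually.of_forall fun a => hx.trans_le (norm_nonneg _),
    fun ε hε => ?_⟩
  obtain ⟨s, hs⟩ := summable_iff_vanishing_norm.1 hb (ε / 2) (by linarith)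
  have hfin : Tendsto (fun a => ‖∑ n ∈ s, (σ a n : 𝕜) • e n‖) l (𝓝 0) := by
    have : Tendsto (fun a => ∑ n ∈ s, (σ a n : 𝕜) • e n) l (𝓝 (∑ n ∈ s, ((0 : ℝ) : 𝕜) • e n)) :=
      tendsto_finsetSum _ fun n _ =>
        (((RCLike.continuous_ofReal (K := 𝕜)).tendsto 0).comp (hlim n)).smul_const _
    simpa using this.norm
  filter_upwards [hσ0, hσb, hfin.eventually_lt_const (u := ε / 4) (by linarith)] with a h0 h1 h2
  have : ‖∑' n, (σ a n : 𝕜) • e n‖ ≤ ε / 4 + ε / 2 := by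
    refine le_of_tendsto (summable_of_le he h0 h1 hb).hasSum.norm ?_
    filter_upwards [eventually_ge_atTop s] with t ht
    rw [← Finset.sum_sdiff ht, add_comm]
    refine (norm_add_le _ _).trans (add_le_add h2.le ?_)
    exact (norm_sum_le_norm_sum he _ h0 h1).trans (hs _ Finset.sdiff_disjoint).le
  linarith

theorem convexNorm_of_summable {p : ℝ} {t : ℕ → ℝ}
    (h : Summable fun n => ((|t n| ^ p : ℝ) : 𝕜) • e n) :
    convexNorm e p t = ‖∑' n, ((|t n| ^ p : ℝ) : 𝕜) • e n‖ₑ ^ (1 / p) := if_pos h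

theorem convexNorm_ne_top_iff {p : ℝ} (hp : 0 < p) {t : ℕ → ℝ} :
    convexNorm e p t ≠ ⊤ ↔ Summable fun n => ((|t n| ^ p : ℝ) : 𝕜) • e n := by
  unfold convexNorm
  split_ifs with h
  · simp only [h, iff_true]
    exact ENNReal.rpow_ne_top_of_nonneg (by positivity) enorm_ne_top
  · simp [h]

theorem convexNorm_mono [CompleteSpace E] (he : IsOneUnconditional e) {p : ℝ} (hp : 0 < p)
    {s t : ℕ → ℝ} (hst : ∀ n, |s n| ≤ |t n|) : convexNorm e p s ≤ convexNorm e p t := by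
  by_cases ht : convexNorm e p t = ⊤
  · simp [ht]
  have h := (convexNorm_ne_top_iff hp).1 ht
  have h0 : ∀ n, 0 ≤ |s n| ^ p := fun n => by positivity
  have h1 : ∀ n, |s n| ^ p ≤ |t n| ^ p := fun n =>
    Real.rpow_le_rpow (abs_nonneg _) (hst n) hp.le
  rw [convexNorm_of_summable h, convexNorm_of_summable (summable_of_le he h0 h1 h)]
  refine ENNReal.rpow_le_rpow ?_ (by positivity)
  rw [← ofReal_norm, ← ofReal_norm]
  exact ENNReal.ofReal_le_ofReal (norm_tsum_le_norm_tsum he h0 h1 h)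

theorem convexNorm_const_mul {p : ℝ} (hp : 0 < p) {c : ℝ} (hc : 0 < c) (t : ℕ → ℝ) :
    convexNorm e p (fun n => c * t n) = ENNReal.ofReal c * convexNorm e p t := by
  have hcp : (0 : ℝ) < c ^ p := by positivity
  have heq : (fun n => ((|c * t n| ^ p : ℝ) : 𝕜) • e n) =
      fun n => ((c ^ p : ℝ) : 𝕜) • (((|t n| ^ p : ℝ) : 𝕜) • e n) := by
    funext n
    rw [smul_smul, abs_mul, Real.mul_rpow (abs_nonneg _) (abs_nonneg _), abs_of_pos hc,
      RCLike.ofReal_mul]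
  have hne : ((c ^ p : ℝ) : 𝕜) ≠ 0 := by exact_mod_cast hcp.ne'
  by_cases h : Summable fun n => ((|t n| ^ p : ℝ) : 𝕜) • e n
  · have h' : Summable fun n => ((|c * t n| ^ p : ℝ) : 𝕜) • e n := by
      rw [heq]; exact h.const_smul _
    rw [convexNorm_of_summable h, convexNorm_of_summable h', heq, tsum_const_smul'', enorm_smul,
      ENNReal.mul_rpow_of_nonneg _ _ (by positivity)]
    congr 1
    rw [← ofReal_norm, RCLike.norm_ofReal, abs_of_pos hcp, ENNReal.ofReal_rpow_of_pos hcp,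
      ← Real.rpow_mul hc.le, mul_one_div_cancel hp.ne', Real.rpow_one]
  · have h' : ¬ Summable fun n => ((|c * t n| ^ p : ℝ) : 𝕜) • e n := by
      rw [heq]
      intro h''
      refine h ?_
      have := h''.const_smul (((c ^ p : ℝ) : 𝕜)⁻¹)
      simpa only [smul_smul _ ((c ^ p : ℝ) : 𝕜), inv_mul_cancel₀ hne, one_smul] using this
    rw [convexNorm, if_neg h', convexNorm, if_neg h, ENNReal.mul_top]
    simpa using hc

theorem coord_tsum {a : ℕ → 𝕜} (h : Summable fun n => a n • e n) (n : ℕ) :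
    e.coord n (∑' k, a k • e k) = a n := by
  rw [ContinuousLinearMap.map_tsum _ h, tsum_eq_single n]
  · simp [e.ortho]
  · intro k hk
    simp [e.ortho, hk.symm]

theorem norm_smul_le_norm_tsum [CompleteSpace E] (he : IsOneUnconditional e) {b : ℕ → ℝ}
    (hb0 : ∀ n, 0 ≤ b n) (hb : Summable fun n => (b n : 𝕜) • e n) (n : ℕ) :
    ‖(b n : 𝕜) • e n‖ ≤ ‖∑' k, (b k : 𝕜) • e k‖ := by
  have h1 : ∀ k, 0 ≤ (Pi.single n (b n) : ℕ → ℝ) k := by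
    intro k; by_cases hk : k = n
    · subst hk; simpa using hb0 k
    · simp [hk]
  have h2 : ∀ k, (Pi.single n (b n) : ℕ → ℝ) k ≤ b k := by
    intro k; by_cases hk : k = n
    · subst hk; simp
    · simpa [hk] using hb0 k
  have := norm_tsum_le_norm_tsum he h1 h2 hb
  rwa [tsum_eq_single n (fun k hk => by simp [hk]), Pi.single_eq_same] at this

theorem mul_le_convexNorm [CompleteSpace E] (he : IsOneUnconditional e) {p : ℝ} (hp : 0 < p)
    (t : ℕ → ℝ) (n : ℕ) : ‖t n‖ₑ * ‖e n‖ₑ ^ (1 / p) ≤ convexNorm e p t := by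
  by_cases ht : convexNorm e p t = ⊤
  · simp [ht]
  have h := (convexNorm_ne_top_iff hp).1 ht
  rw [convexNorm_of_summable h]
  have h1 := norm_smul_le_norm_tsum he (fun n => by positivity) h n
  have h2 : ‖((|t n| ^ p : ℝ) : 𝕜) • e n‖ₑ ^ (1 / p) = ‖t n‖ₑ * ‖e n‖ₑ ^ (1 / p) := by
    rw [enorm_smul, ENNReal.mul_rpow_of_nonneg _ _ (by positivity)]
    congr 1
    rw [← ofReal_norm, RCLike.norm_ofReal, abs_of_nonneg (by positivity),
      ← ENNReal.ofReal_rpow_of_nonneg (abs_nonneg _) hp.le, ← ENNReal.rpow_mul,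
      mul_one_div_cancel hp.ne', ENNReal.rpow_one, ← ofReal_norm, Real.norm_eq_abs]
  rw [← h2]
  refine ENNReal.rpow_le_rpow ?_ (by positivity)
  rw [← ofReal_norm, ← ofReal_norm]
  exact ENNReal.ofReal_le_ofReal h1

variable {W : Type*} {N : W → ℝ≥0∞}

theorem vecNorm_ne_top {p : ℝ} {x : ℕ → W} (h : vecNorm e p N x ≠ ⊤) (n : ℕ) : N (x n) ≠ ⊤ := by
  unfold vecNorm at h
  split_ifs at h with hx
  · exact hx n
  · exact absurd rfl h

theorem vecNorm_eq {p : ℝ} {x : ℕ → W} (h : ∀ n, N (x n) ≠ ⊤) :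
    vecNorm e p N x = convexNorm e p (fun n => (N (x n)).toReal) := if_pos h

theorem vecNorm_le_convexNorm [CompleteSpace E] (he : IsOneUnconditional e) {p : ℝ} (hp : 0 < p)
    {x : ℕ → W} {t : ℕ → ℝ} (h : ∀ n, N (x n) ≤ ENNReal.ofReal (t n)) :
    vecNorm e p N x ≤ convexNorm e p t := by
  rw [vecNorm_eq fun n => ne_top_of_le_ne_top ENNReal.ofReal_ne_top (h n)]
  refine convexNorm_mono he hp fun n => ?_
  rw [abs_of_nonneg ENNReal.toReal_nonneg]
  refine ENNReal.toReal_le_of_le_ofReal (abs_nonneg _) ((h n).trans ?_)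
  exact ENNReal.ofReal_le_ofReal (le_abs_self _)

/-- Coordinate projections are bounded, so coordinates of a function in the sequence space `𝓕` lie
in `𝓕(X₀, X₁)`. -/
theorem exists_le_mul_vecNorm [CompleteSpace E] (he : IsOneUnconditional e) {p : ℝ} (hp : 0 < p)
    (N : W → ℝ≥0∞) (n : ℕ) :
    ∃ C : ℝ≥0, ∀ x : ℕ → W, N (x n) ≤ C * vecNorm e p N x := by
  have h0 : ‖e n‖ₑ ^ (1 / p) ≠ 0 := by
    rw [Ne, ENNReal.rpow_eq_zero_iff]
    simp [e.linearIndependent.ne_zero n, enorm_ne_top]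
  have ht : ‖e n‖ₑ ^ (1 / p) ≠ ⊤ := ENNReal.rpow_ne_top_of_nonneg (by positivity) enorm_ne_top
  -- The maximum with `1` makes the constant visibly nonzero, so that its product with `⊤` is `⊤`.
  refine ⟨max ((‖e n‖ₑ ^ (1 / p))⁻¹).toNNReal 1, fun x => ?_⟩
  by_cases hx : vecNorm e p N x = ⊤
  · rw [hx, ENNReal.mul_top]
    · exact le_top
    · rw [Ne, ENNReal.coe_eq_zero]
      exact (lt_of_lt_of_le zero_lt_one (le_max_right _ _)).ne'
  have hfin := vecNorm_ne_top hx
  have := mul_le_convexNorm he hp (fun n => (N (x n)).toReal) n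
  rw [← vecNorm_eq hfin, ← ofReal_norm, Real.norm_of_nonneg ENNReal.toReal_nonneg,
    ENNReal.ofReal_toReal (hfin n), ← ENNReal.le_div_iff_mul_le (Or.inl h0) (Or.inl ht),
    ENNReal.div_eq_inv_mul] at this
  refine this.trans (mul_le_mul_left ?_ _)
  rw [← ENNReal.coe_toNNReal (ENNReal.inv_ne_top.2 h0)]
  exact ENNReal.coe_le_coe.2 (le_max_left _ _)

end Lattice

/-! ### Assembling coordinate functions into sequence-valued ones. -/

section Assembly

variable {𝕜 E : Type*} [RCLike 𝕜] [NormedAddCommGroup E] [NormedSpace 𝕜 E] [CompleteSpace E]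
  {e : UnconditionalSchauderBasis ℕ 𝕜 E}

theorem abs_mul_rpow_one_div_rpow {p : ℝ} (hp : 0 < p) {s b : ℝ} (hs : 0 ≤ s) (hb : 0 ≤ b) :
    |s * b ^ (1 / p)| ^ p = s ^ p * b := by
  rw [abs_of_nonneg (by positivity), Real.mul_rpow hs (by positivity), ← Real.rpow_mul hb,
    one_div_mul_cancel hp.ne', Real.rpow_one]

theorem convexNorm_mul_rpow_one_div {p : ℝ} (hp : 0 < p) {b : ℕ → ℝ} (hb : ∀ n, 0 ≤ b n)
    (hbs : Summable fun n => (b n : 𝕜) • e n) {C : ℝ} (hC : 0 < C) :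
    convexNorm e p (fun n => C * b n ^ (1 / p)) =
      ENNReal.ofReal C * ‖∑' n, (b n : 𝕜) • e n‖ₑ ^ (1 / p) := by
  have heq : (fun n => ((|b n ^ (1 / p)| ^ p : ℝ) : 𝕜) • e n) = fun n => (b n : 𝕜) • e n := by
    funext n
    have := abs_mul_rpow_one_div_rpow hp zero_le_one (hb n)
    rw [one_mul, Real.one_rpow, one_mul] at this
    rw [this]
  rw [convexNorm_const_mul hp hC, convexNorm_of_summable (by rw [heq]; exact hbs), heq]

theorem tendsto_convexNorm_zero (he : IsOneUnconditional e) {p : ℝ} (hp : 0 < p) {b : ℕ → ℝ}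
    (hb : ∀ n, 0 ≤ b n) (hbs : Summable fun n => (b n : 𝕜) • e n) {α : Type*} {l : Filter α}
    {σ : α → ℕ → ℝ} {C : ℝ} (hσ : ∀ᶠ a in l, ∀ n, 0 ≤ σ a n) (hσC : ∀ᶠ a in l, ∀ n, σ a n ≤ C)
    (hlim : ∀ n, Tendsto (fun a => σ a n) l (𝓝 0)) :
    Tendsto (fun a => convexNorm e p (fun n => σ a n * b n ^ (1 / p))) l (𝓝 0) := by
  have hB : Summable fun n => ((C ^ p * b n : ℝ) : 𝕜) • e n := by
    simpa only [RCLike.ofReal_mul, ← smul_smul] using hbs.const_smul ((C ^ p : ℝ) : 𝕜)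
  have h0 : ∀ᶠ a in l, ∀ n, 0 ≤ |σ a n * b n ^ (1 / p)| ^ p :=
    Eventually.of_forall fun a n => by positivity
  have h1 : ∀ᶠ a in l, ∀ n, |σ a n * b n ^ (1 / p)| ^ p ≤ C ^ p * b n := by
    filter_upwards [hσ, hσC] with a ha haC n
    rw [abs_mul_rpow_one_div_rpow hp (ha n) (hb n)]
    exact mul_le_mul_of_nonneg_right (Real.rpow_le_rpow (ha n) (haC n) hp.le) (hb n)
  have h2 : ∀ n, Tendsto (fun a => |σ a n * b n ^ (1 / p)| ^ p) l (𝓝 0) := by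
    intro n
    have := ((hlim n).mul_const (b n ^ (1 / p))).abs
    rw [zero_mul, abs_zero] at this
    have h3 := this.rpow_const (p := p) (Or.inr hp.le)
    rwa [Real.zero_rpow hp.ne'] at h3
  have key := tendsto_norm_tsum_zero he hB h0 h1 h2
  have key' := (ENNReal.tendsto_ofReal key).ennrpow_const (1 / p)
  rw [ENNReal.ofReal_zero, ENNReal.zero_rpow_of_pos (by positivity)] at key'
  refine key'.congr' ?_
  filter_upwards [h0, h1] with a h0 h1
  rw [convexNorm_of_summable (summable_of_le he h0 h1 hB), ofReal_norm]

theorem tendsto_vecNorm_zero {W : Type*} {N : W → ℝ≥0∞} (he : IsOneUnconditional e) {p : ℝ}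
    (hp : 0 < p) {b : ℕ → ℝ} (hb : ∀ n, 0 < b n) (hbs : Summable fun n => (b n : 𝕜) • e n)
    {α : Type*} {l : Filter α} {x : α → ℕ → W} {C : ℝ≥0}
    (hC : ∀ᶠ a in l, ∀ n, N (x a n) ≤ C * ENNReal.ofReal (b n ^ (1 / p)))
    (hlim : ∀ n, Tendsto (fun a => N (x a n)) l (𝓝 0)) :
    Tendsto (fun a => vecNorm e p N (x a)) l (𝓝 0) := by
  have hb' : ∀ n, 0 < b n ^ (1 / p) := fun n => Real.rpow_pos_of_pos (hb n) _
  have key := tendsto_convexNorm_zero he hp (fun n => (hb n).le) hbs (l := l)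
    (σ := fun a n => (N (x a n)).toReal / b n ^ (1 / p)) (C := C)
    (Eventually.of_forall fun a n => div_nonneg ENNReal.toReal_nonneg (hb' n).le) ?_ ?_
  · refine tendsto_of_tendsto_of_tendsto_of_le_of_le' tendsto_const_nhds key
      (Eventually.of_forall fun _ => zero_le) ?_
    filter_upwards [hC] with a ha
    refine vecNorm_le_convexNorm he hp fun n => ?_
    rw [div_mul_cancel₀ _ (hb' n).ne', ENNReal.ofReal_toReal]
    exact ne_top_of_le_ne_top (ENNReal.mul_ne_top ENNReal.coe_ne_top ENNReal.ofReal_ne_top) (ha n)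
  · filter_upwards [hC] with a ha n
    rw [div_le_iff₀ (hb' n)]
    refine ENNReal.toReal_le_of_le_ofReal (by have := (hb' n).le; positivity) ((ha n).trans ?_)
    rw [ENNReal.ofReal_mul C.coe_nonneg, ENNReal.ofReal_coe_nnreal]
  · intro n
    have := ((ENNReal.tendsto_toReal ENNReal.zero_ne_top).comp (hlim n)).div_const (b n ^ (1 / p))
    simpa using this

variable {W : Type*} [AddCommGroup W] [Module ℂ W] [TopologicalSpace W] [IsTopologicalAddGroup W]
  [ContinuousSMul ℂ W] [T2Space W]
  {X₀ X₁ : Type*} [NormedAddCommGroup X₀] [NormedSpace ℂ X₀]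
  [NormedAddCommGroup X₁] [NormedSpace ℂ X₁] {j₀ : X₀ →L[ℂ] W} {j₁ : X₁ →L[ℂ] W}

/-- The norm functional of the sum space of the couple with unit balls dilated by `c₀` and `c₁`. -/
noncomputable def dilatedSumNorm (j₀ : X₀ →L[ℂ] W) (j₁ : X₁ →L[ℂ] W) (c₀ c₁ : ℝ) : W → ℝ≥0∞ :=
  sumNorm (embNorm ((c₀ : ℂ) • j₀)) (embNorm ((c₁ : ℂ) • j₁))

theorem ofReal_mul_embNorm_smul (hj₀ : Function.Injective j₀) {c : ℝ} (hc : 0 < c) (w : W) :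
    ENNReal.ofReal c * embNorm ((c : ℂ) • j₀) w = embNorm j₀ w := by
  rw [← embNorm_smul j₀ hj₀ (c := (c : ℂ)) (by exact_mod_cast hc.ne'), ← ofReal_norm (c : ℂ),
    Complex.norm_real, Real.norm_of_nonneg hc.le]

theorem embNorm_smul_le_iff (hj₀ : Function.Injective j₀) {c : ℝ} (hc : 0 < c) {w : W}
    {K : ℝ≥0∞} : embNorm ((c : ℂ) • j₀) w ≤ K ↔ embNorm j₀ w ≤ K * ENNReal.ofReal c := by
  rw [← ofReal_mul_embNorm_smul hj₀ hc, mul_comm,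
    ENNReal.mul_le_mul_iff_left (by simpa using hc) ENNReal.ofReal_ne_top]

theorem embNorm_sub_le (hj₀ : Function.Injective j₀) {w w' : W} {D : ℝ≥0∞} (hw : embNorm j₀ w ≤ D)
    (hw' : embNorm j₀ w' ≤ D) (hD : D ≠ ⊤) : embNorm j₀ (w - w') ≤ 2 * D := by
  have h := represents_embNorm j₀ hj₀
  obtain ⟨y, rfl⟩ := h.mem_range w (ne_top_of_le_ne_top hD hw)
  obtain ⟨y', rfl⟩ := h.mem_range w' (ne_top_of_le_ne_top hD hw')
  rw [← _root_.map_sub, h.norm_eq, two_mul]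
  rw [h.norm_eq] at hw hw'
  exact enorm_sub_le.trans (add_le_add hw hw')

/-- The dilation encodes domination in both spaces: a piece of norm at most `2 * C` in the dilated
`X_j` has norm at most `2 * C * b n ^ (1 / p_j)` in `X_j`. Splitting every coordinate almost
optimally in its own dilated couple therefore gives two sequences, to each of which dominated
convergence in `λ_{p_j}(X_j)` applies. -/
theorem tendsto_sumNorm_vecNorm_zero (he : IsOneUnconditional e)
    (hj₀ : Function.Injective j₀) (hj₁ : Function.Injective j₁) {p₀ p₁ : ℝ}
    (hp₀ : 0 < p₀) (hp₁ : 0 < p₁) {b : ℕ → ℝ} (hb : ∀ n, 0 < b n)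
    (hbs : Summable fun n => (b n : 𝕜) • e n) {α : Type*} {l : Filter α} {x : α → ℕ → W} {C : ℝ≥0}
    (hC : ∀ᶠ a in l, ∀ n,
      dilatedSumNorm j₀ j₁ (b n ^ (1 / p₀)) (b n ^ (1 / p₁)) (x a n) ≤ C)
    (hlim : ∀ n, Tendsto (fun a =>
      dilatedSumNorm j₀ j₁ (b n ^ (1 / p₀)) (b n ^ (1 / p₁)) (x a n)) l (𝓝 0)) :
    Tendsto (fun a => sumNorm (vecNorm e p₀ (embNorm j₀)) (vecNorm e p₁ (embNorm j₁)) (x a)) l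
      (𝓝 0) := by
  have hb₀ : ∀ n, 0 < b n ^ (1 / p₀) := fun n => Real.rpow_pos_of_pos (hb n) _
  have hb₁ : ∀ n, 0 < b n ^ (1 / p₁) := fun n => Real.rpow_pos_of_pos (hb n) _
  have hdec : ∀ a n, ∃ u v, u + v = x a n ∧
      embNorm (((b n ^ (1 / p₀) : ℝ) : ℂ) • j₀) u ≤
        2 * dilatedSumNorm j₀ j₁ (b n ^ (1 / p₀)) (b n ^ (1 / p₁)) (x a n) ∧
      embNorm (((b n ^ (1 / p₁) : ℝ) : ℂ) • j₁) v ≤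
        2 * dilatedSumNorm j₀ j₁ (b n ^ (1 / p₀)) (b n ^ (1 / p₁)) (x a n) := by
    intro a n
    have hi₀ := injective_smul hj₀ (c := ((b n ^ (1 / p₀) : ℝ) : ℂ)) (by exact_mod_cast (hb₀ n).ne')
    have hi₁ := injective_smul hj₁ (c := ((b n ^ (1 / p₁) : ℝ) : ℂ)) (by exact_mod_cast (hb₁ n).ne')
    obtain ⟨V, _, _, ι, h⟩ := exists_represents_sumNorm _ _ hi₀ hi₁
    exact exists_add_eq_le_sumNorm h (represents_embNorm _ hi₀).map_zero
      (represents_embNorm _ hi₁).map_zero _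
  choose u v huv hu hv using hdec
  have h2 : Tendsto (fun a => vecNorm e p₀ (embNorm j₀) (u a) + vecNorm e p₁ (embNorm j₁) (v a)) l
      (𝓝 (0 + 0)) := by
    refine Tendsto.add (tendsto_vecNorm_zero he hp₀ hb hbs (C := 2 * C) ?_ ?_)
      (tendsto_vecNorm_zero he hp₁ hb hbs (C := 2 * C) ?_ ?_)
    · filter_upwards [hC] with a ha n
      rw [← embNorm_smul_le_iff hj₀ (hb₀ n), ENNReal.coe_mul]
      exact (hu a n).trans (mul_le_mul_right (ha n) _)
    · intro n
      refine tendsto_zero_of_le_mul (2 * (b n ^ (1 / p₀)).toNNReal) (fun a => ?_) (hlim n)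
      refine ((embNorm_smul_le_iff hj₀ (hb₀ n)).1 (hu a n)).trans (le_of_eq ?_)
      rw [ENNReal.coe_mul, ENNReal.ofReal, ENNReal.coe_ofNat]; ring
    · filter_upwards [hC] with a ha n
      rw [← embNorm_smul_le_iff hj₁ (hb₁ n), ENNReal.coe_mul]
      exact (hv a n).trans (mul_le_mul_right (ha n) _)
    · intro n
      refine tendsto_zero_of_le_mul (2 * (b n ^ (1 / p₁)).toNNReal) (fun a => ?_) (hlim n)
      refine ((embNorm_smul_le_iff hj₁ (hb₁ n)).1 (hv a n)).trans (le_of_eq ?_)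
      rw [ENNReal.coe_mul, ENNReal.ofReal, ENNReal.coe_ofNat]; ring
  rw [add_zero] at h2
  refine tendsto_of_tendsto_of_tendsto_of_le_of_le tendsto_const_nhds h2 (fun _ => zero_le)
    fun a => ?_
  exact (iInf₂_le (u a) (v a)).trans (iInf_le _ (funext (huv a)))

theorem sumNorm_vecNorm_le (he : IsOneUnconditional e)
    (hj₀ : Function.Injective j₀) (hj₁ : Function.Injective j₁) {p₀ p₁ : ℝ}
    (hp₀ : 0 < p₀) (hp₁ : 0 < p₁) {b : ℕ → ℝ} (hb : ∀ n, 0 < b n)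
    (hbs : Summable fun n => (b n : 𝕜) • e n) (C : ℝ≥0) : ∃ D : ℝ≥0, ∀ x : ℕ → W,
      (∀ n, dilatedSumNorm j₀ j₁ (b n ^ (1 / p₀)) (b n ^ (1 / p₁)) (x n) ≤ C) →
      sumNorm (vecNorm e p₀ (embNorm j₀)) (vecNorm e p₁ (embNorm j₁)) x ≤ D := by
  have hb₀ : ∀ n, 0 < b n ^ (1 / p₀) := fun n => Real.rpow_pos_of_pos (hb n) _
  have hb₁ : ∀ n, 0 < b n ^ (1 / p₁) := fun n => Real.rpow_pos_of_pos (hb n) _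
  have hfin : ∀ p : ℝ, 0 < p →
      convexNorm e p (fun n => ((C : ℝ) + 1) * b n ^ (1 / p)) ≠ ⊤ := by
    intro p hp
    rw [convexNorm_mul_rpow_one_div hp (fun n => (hb n).le) hbs (by positivity)]
    exact ENNReal.mul_ne_top ENNReal.ofReal_ne_top
      (ENNReal.rpow_ne_top_of_nonneg (by positivity) enorm_ne_top)
  refine ⟨(convexNorm e p₀ (fun n => ((C : ℝ) + 1) * b n ^ (1 / p₀))).toNNReal +
    (convexNorm e p₁ (fun n => ((C : ℝ) + 1) * b n ^ (1 / p₁))).toNNReal, fun x hx => ?_⟩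
  -- Replacing `C` by `C + 1` gives strict room in the infimum and a positive constant even if `C =
  -- 0`.
  have hdec : ∀ n, ∃ u v, u + v = x n ∧ embNorm (((b n ^ (1 / p₀) : ℝ) : ℂ) • j₀) u +
      embNorm (((b n ^ (1 / p₁) : ℝ) : ℂ) • j₁) v < C + 1 := by
    intro n
    have : dilatedSumNorm j₀ j₁ (b n ^ (1 / p₀)) (b n ^ (1 / p₁)) (x n) < C + 1 :=
      (hx n).trans_lt (ENNReal.lt_add_right ENNReal.coe_ne_top one_ne_zero)
    simpa only [dilatedSumNorm, sumNorm, iInf_lt_iff, exists_prop] using this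
  choose u v huv hlt using hdec
  refine (iInf₂_le u v).trans ((iInf_le _ (funext huv)).trans ?_)
  rw [ENNReal.coe_add, ENNReal.coe_toNNReal (hfin p₀ hp₀), ENNReal.coe_toNNReal (hfin p₁ hp₁)]
  have hcast : ENNReal.ofReal ((C : ℝ) + 1) = C + 1 := by
    rw [ENNReal.ofReal_add C.coe_nonneg zero_le_one, ENNReal.ofReal_coe_nnreal, ENNReal.ofReal_one]
  refine add_le_add (vecNorm_le_convexNorm he hp₀ fun n => ?_)
    (vecNorm_le_convexNorm he hp₁ fun n => ?_)
  · rw [ENNReal.ofReal_mul (by positivity), hcast, ← embNorm_smul_le_iff hj₀ (hb₀ n)]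
    exact le_self_add.trans (hlt n).le
  · rw [ENNReal.ofReal_mul (by positivity), hcast, ← embNorm_smul_le_iff hj₁ (hb₁ n)]
    exact le_add_self.trans (hlt n).le

/-- Functions `H n` in `𝓕(X₀, X₁)` whose boundary values are dominated by `K (b n) ^ (1 / p_j)`,
where `∑ b n • e n` converges, are the coordinates of a function in
`𝓕(λ_{p₀}(X₀), λ_{p₁}(X₁))`, which is differentiated coordinatewise. -/
theorem memF_vecNorm (he : IsOneUnconditional e)
    (hj₀ : Function.Injective j₀) (hj₁ : Function.Injective j₁) {p₀ p₁ : ℝ}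
    (hp₀ : 0 < p₀) (hp₁ : 0 < p₁) {b : ℕ → ℝ} (hb : ∀ n, 0 < b n)
    (hbs : Summable fun n => (b n : 𝕜) • e n) {H : ℕ → ℂ → W}
    (hH : ∀ n, MemF (embNorm j₀) (embNorm j₁) (H n)) {K : ℝ≥0}
    (hK₀ : ∀ n, ∀ t : ℝ, embNorm j₀ (H n (t * I)) ≤ K * ENNReal.ofReal (b n ^ (1 / p₀)))
    (hK₁ : ∀ n, ∀ t : ℝ, embNorm j₁ (H n (1 + t * I)) ≤ K * ENNReal.ofReal (b n ^ (1 / p₁))) :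
    MemF (vecNorm e p₀ (embNorm j₀)) (vecNorm e p₁ (embNorm j₁)) (fun z n => H n z) ∧
    ∀ z ∈ verticalStrip 0 1, ∀ d : ℕ → W,
      (∀ n, HasSumDerivAt (embNorm j₀) (embNorm j₁) (H n) (d n) z) →
      HasSumDerivAt (vecNorm e p₀ (embNorm j₀)) (vecNorm e p₁ (embNorm j₁))
        (fun z n => H n z) d z := by
  have hb₀ : ∀ n, 0 < b n ^ (1 / p₀) := fun n => Real.rpow_pos_of_pos (hb n) _
  have hb₁ : ∀ n, 0 < b n ^ (1 / p₁) := fun n => Real.rpow_pos_of_pos (hb n) _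
  have hi₀ := fun n => injective_smul hj₀ (c := ((b n ^ (1 / p₀) : ℝ) : ℂ))
    (by exact_mod_cast (hb₀ n).ne')
  have hi₁ := fun n => injective_smul hj₁ (c := ((b n ^ (1 / p₁) : ℝ) : ℂ))
    (by exact_mod_cast (hb₁ n).ne')
  have hr₀ := fun n => represents_embNorm _ (hi₀ n)
  have hr₁ := fun n => represents_embNorm _ (hi₁ n)
  -- For fixed `n` the dilation is an equivalent renorming, so membership in `𝓕` is preserved. The
  -- constants depend on `n`, but they serve only for this qualitative fact.
  have hdil : ∀ n, ∃ C : ℝ≥0, C ≠ 0 ∧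
      (∀ w, embNorm (((b n ^ (1 / p₀) : ℝ) : ℂ) • j₀) w ≤ C * embNorm j₀ w) ∧
      (∀ w, embNorm (((b n ^ (1 / p₁) : ℝ) : ℂ) • j₁) w ≤ C * embNorm j₁ w) := by
    intro n
    have aux : ∀ c : ℝ, 0 < c → ∀ D : ℝ, c⁻¹ ≤ D → ∀ y : ℝ≥0∞,
        y ≤ (D.toNNReal : ℝ≥0∞) * y * ENNReal.ofReal c := by
      intro c hc D hD y
      change y ≤ ENNReal.ofReal D * y * ENNReal.ofReal c
      rw [mul_right_comm, ← ENNReal.ofReal_mul ((inv_pos.2 hc).le.trans hD)]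
      refine le_mul_of_one_le_left zero_le ?_
      rw [ENNReal.one_le_ofReal]
      exact (inv_le_iff_one_le_mul₀ hc).1 hD
    refine ⟨(max (b n ^ (1 / p₀))⁻¹ (b n ^ (1 / p₁))⁻¹).toNNReal, ?_, fun w => ?_, fun w => ?_⟩
    · rw [Ne, Real.toNNReal_eq_zero, not_le]
      exact (inv_pos.2 (hb₀ n)).trans_le (le_max_left _ _)
    · rw [embNorm_smul_le_iff hj₀ (hb₀ n)]
      exact aux _ (hb₀ n) _ (le_max_left _ _) _
    · rw [embNorm_smul_le_iff hj₁ (hb₁ n)]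
      exact aux _ (hb₁ n) _ (le_max_right _ _) _
  choose C hC hC₀ hC₁ using hdil
  have hM : ∀ n, MemF (embNorm (((b n ^ (1 / p₀) : ℝ) : ℂ) • j₀))
      (embNorm (((b n ^ (1 / p₁) : ℝ) : ℂ) • j₁)) (H n) := fun n =>
    (hH n).map LinearMap.id (hC n) (hC₀ n) (hC₁ n)
  -- In the dilated couples the bound on the `𝓕`-norm is uniform in `n`. Combined with the interior
  -- estimates it provides every domination below.
  have hMK : ∀ n, normF (embNorm (((b n ^ (1 / p₀) : ℝ) : ℂ) • j₀))
      (embNorm (((b n ^ (1 / p₁) : ℝ) : ℂ) • j₁)) (H n) ≤ K := fun n =>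
    normF_le (fun t => (embNorm_smul_le_iff hj₀ (hb₀ n)).2 (hK₀ n t))
      (fun t => (embNorm_smul_le_iff hj₁ (hb₁ n)).2 (hK₁ n t))
  have hderiv : ∀ z ∈ verticalStrip 0 1, ∀ d : ℕ → W,
      (∀ n, HasSumDerivAt (embNorm j₀) (embNorm j₁) (H n) (d n) z) →
      HasSumDerivAt (vecNorm e p₀ (embNorm j₀)) (vecNorm e p₁ (embNorm j₁))
        (fun z n => H n z) d z := by
    intro z hz d hd
    have hd' := fun n => (hd n).map LinearMap.id (hC n) (hC₀ n) (hC₁ n)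
    obtain ⟨r, hr, hball⟩ := Metric.isOpen_iff.1 isOpen_verticalStrip z hz
    refine tendsto_sumNorm_vecNorm_zero he hj₀ hj₁ hp₀ hp₁ hb hbs (C := 8 * K / r.toNNReal) ?_
      fun n => hd' n
    have hev : ∀ᶠ w in 𝓝[≠] z, w ∈ Metric.ball z (r / 2) :=
      mem_nhdsWithin_of_mem_nhds (Metric.ball_mem_nhds z (by linarith))
    filter_upwards [hev, self_mem_nhdsWithin] with w hw hwz n
    obtain ⟨V, _, _, ι, h⟩ := exists_represents_sumNorm _ _ (hi₀ n) (hi₁ n)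
    have hrr : ((r.toNNReal : ℝ≥0) : ℝ) = r := Real.coe_toNNReal r (le_of_lt hr)
    exact (hM n).sumNorm_slope_sub_le h (hr₀ n) (hr₁ n) (hMK n) (r := r.toNNReal)
      (Real.toNNReal_pos.2 hr) (by rw [hrr]; exact hball) (by rw [hrr]; exact hw) hwz (hd' n)
  refine ⟨?_, hderiv⟩
  have hfin : ∀ p : ℝ, 0 < p → convexNorm e p (fun n => ((K : ℝ) + 1) * b n ^ (1 / p)) ≠ ⊤ := by
    intro p hp
    rw [convexNorm_mul_rpow_one_div hp (fun n => (hb n).le) hbs (by positivity)]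
    exact ENNReal.mul_ne_top ENNReal.ofReal_ne_top
      (ENNReal.rpow_ne_top_of_nonneg (by positivity) enorm_ne_top)
  have hcast : (K : ℝ≥0∞) ≤ ENNReal.ofReal ((K : ℝ) + 1) := by
    rw [← ENNReal.ofReal_coe_nnreal]; exact ENNReal.ofReal_le_ofReal (by linarith)
  refine ⟨?_, ?_, ?_, ?_, ?_, ?_, ?_⟩
  · obtain ⟨D, hD⟩ := sumNorm_vecNorm_le he hj₀ hj₁ hp₀ hp₁ hb hbs K
    refine ⟨D, fun z hz => hD _ fun n => ?_⟩
    obtain ⟨V, _, _, ι, h⟩ := exists_represents_sumNorm _ _ (hi₀ n) (hi₁ n)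
    exact (hM n).sumNorm_le h (hr₀ n) (hr₁ n) (hMK n) hz
  · intro z hz
    refine tendsto_sumNorm_vecNorm_zero he hj₀ hj₁ hp₀ hp₁ hb hbs (C := 2 * K) ?_
      fun n => (hM n).continuous z hz
    filter_upwards [self_mem_nhdsWithin] with w hw n
    obtain ⟨V, _, _, ι, h⟩ := exists_represents_sumNorm _ _ (hi₀ n) (hi₁ n)
    exact (hM n).sumNorm_sub_le h (hr₀ n) (hr₁ n) (hMK n) hz hw
  · intro z hz
    choose d hd using fun n => (hH n).analytic z hz
    exact ⟨d, hderiv z hz d hd⟩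
  · refine ⟨(convexNorm e p₀ (fun n => ((K : ℝ) + 1) * b n ^ (1 / p₀))).toNNReal, fun t => ?_⟩
    rw [ENNReal.coe_toNNReal (hfin p₀ hp₀)]
    refine vecNorm_le_convexNorm he hp₀ fun n => (hK₀ n t).trans ?_
    rw [ENNReal.ofReal_mul (by positivity)]
    exact mul_le_mul_left hcast _
  · intro t
    refine tendsto_vecNorm_zero he hp₀ hb hbs (C := 2 * K)
      (Eventually.of_forall fun s n => ?_) fun n => (hH n).continuous_left t
    rw [ENNReal.coe_mul, mul_assoc]
    exact embNorm_sub_le hj₀ (hK₀ n s) (hK₀ n t)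
      (ENNReal.mul_ne_top ENNReal.coe_ne_top ENNReal.ofReal_ne_top)
  · refine ⟨(convexNorm e p₁ (fun n => ((K : ℝ) + 1) * b n ^ (1 / p₁))).toNNReal, fun t => ?_⟩
    rw [ENNReal.coe_toNNReal (hfin p₁ hp₁)]
    refine vecNorm_le_convexNorm he hp₁ fun n => (hK₁ n t).trans ?_
    rw [ENNReal.ofReal_mul (by positivity)]
    exact mul_le_mul_left hcast _
  · intro t
    refine tendsto_vecNorm_zero he hp₁ hb hbs (C := 2 * K)
      (Eventually.of_forall fun s n => ?_) fun n => (hH n).continuous_right t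
    rw [ENNReal.coe_mul, mul_assoc]
    exact embNorm_sub_le hj₁ (hK₁ n s) (hK₁ n t)
      (ENNReal.mul_ne_top ENNReal.coe_ne_top ENNReal.ofReal_ne_top)

end Assembly

/-! ### The conformal map onto the disc and the boundary parametrization. -/

section Disc

/-- Continuous functions on the circle are uniform limits of real parts of polynomials. -/
theorem exists_polynomial_re_near {κ : ℝ → ℝ} (hκ : ContinuousOn κ (Icc 0 1)) (h01 : κ 0 = κ 1)
    {ε : ℝ} (hε : 0 < ε) :
    ∃ P : Polynomial ℂ, ∀ s ∈ Ico (0 : ℝ) 1,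
      |(P.eval (exp (2 * Real.pi * s * I))).re - κ s| ≤ ε := by
  have : Fact ((0 : ℝ) < 1) := ⟨zero_lt_one⟩
  let f : C(AddCircle (1 : ℝ), ℂ) :=
    ⟨AddCircle.liftIco 1 0 (fun s => (κ s : ℂ)), AddCircle.liftIco_continuous (by simp [h01])
      (by rw [zero_add]; exact continuous_ofReal.comp_continuousOn hκ)⟩
  have hf : ∀ s ∈ Ico (0 : ℝ) 1, f (s : AddCircle (1 : ℝ)) = κ s := fun s hs =>
    AddCircle.liftIco_zero_coe_apply (f := fun s => (κ s : ℂ)) hs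
  have hspan : ∀ q ∈ Submodule.span ℂ (range (@fourier (1 : ℝ))), ∃ P Q : Polynomial ℂ, ∀ s : ℝ,
      q (s : AddCircle (1 : ℝ)) = P.eval (exp (2 * Real.pi * s * I)) +
        (starRingEnd ℂ) (Q.eval (exp (2 * Real.pi * s * I))) := by
    intro q hq
    induction hq using Submodule.span_induction with
    | mem q hq =>
      obtain ⟨n, rfl⟩ := hq
      obtain ⟨m, rfl | rfl⟩ := n.eq_nat_or_neg
      · refine ⟨Polynomial.X ^ m, 0, fun s => ?_⟩
        simp only [fourier_coe_apply, Polynomial.eval_pow, Polynomial.eval_X, Polynomial.eval_zero,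
          map_zero, add_zero, ← Complex.exp_nat_mul]
        congr 1; push_cast; ring
      · refine ⟨0, Polynomial.X ^ m, fun s => ?_⟩
        simp only [fourier_coe_apply, Polynomial.eval_pow, Polynomial.eval_X, Polynomial.eval_zero,
          zero_add, ← Complex.exp_nat_mul, ← Complex.exp_conj]
        congr 1
        simp only [map_mul, conj_I, conj_ofReal, map_natCast, Complex.conj_ofNat]
        push_cast; ring
    | zero => exact ⟨0, 0, fun s => by simp⟩
    | add q r _ _ hq hr =>
      obtain ⟨P, Q, h⟩ := hq
      obtain ⟨P', Q', h'⟩ := hr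
      refine ⟨P + P', Q + Q', fun s => ?_⟩
      rw [ContinuousMap.add_apply, h, h', Polynomial.eval_add, Polynomial.eval_add, map_add]
      ring
    | smul c q _ hq =>
      obtain ⟨P, Q, h⟩ := hq
      refine ⟨Polynomial.C c * P, Polynomial.C ((starRingEnd ℂ) c) * Q, fun s => ?_⟩
      rw [ContinuousMap.smul_apply, h, Polynomial.eval_mul, Polynomial.eval_mul, Polynomial.eval_C,
        Polynomial.eval_C, map_mul, conj_conj, smul_eq_mul]
      ring
  have hmem : f ∈ (Submodule.span ℂ (range (@fourier (1 : ℝ)))).topologicalClosure := by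
    rw [span_fourier_closure_eq_top]; trivial
  obtain ⟨q, hq, hqf⟩ := Metric.mem_closure_iff.1 hmem ε hε
  obtain ⟨P, Q, hPQ⟩ := hspan q hq
  -- Conjugating `Q` does not change its real part, so `P + Q` has the real part of the
  -- trigonometric polynomial.
  refine ⟨P + Q, fun s hs => ?_⟩
  have h1 := (f - q).norm_coe_le_norm (s : AddCircle (1 : ℝ))
  rw [dist_eq_norm] at hqf
  have h2 : ‖(f - q) (s : AddCircle (1 : ℝ))‖ ≤ ε := h1.trans hqf.le
  have h3 := (abs_re_le_norm _).trans h2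
  rw [ContinuousMap.sub_apply, hf s hs, hPQ, sub_re, add_re, conj_re, ofReal_re] at h3
  rwa [Polynomial.eval_add, add_re, abs_sub_comm]

theorem integral_exp_two_pi_mul_pow {n : ℕ} (hn : n ≠ 0) :
    ∫ s in (0 : ℝ)..1, exp (2 * Real.pi * s * I) ^ n = 0 := by
  have hc : (n : ℂ) * (2 * Real.pi * I) ≠ 0 := by
    simp [hn, Real.pi_ne_zero]
  have : ∀ s : ℝ, exp (2 * Real.pi * s * I) ^ n = exp ((n : ℂ) * (2 * Real.pi * I) * s) := by
    intro s; rw [← Complex.exp_nat_mul]; congr 1; ring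
  simp only [this]
  rw [integral_exp_mul_complex hc]
  simp only [ofReal_one, mul_one, ofReal_zero, mul_zero, Complex.exp_zero]
  rw [Complex.exp_nat_mul_two_pi_mul_I, sub_self, zero_div]

/-- The mean value property on the unit circle: every nonconstant monomial integrates to zero. -/
theorem integral_eval_exp (P : Polynomial ℂ) :
    ∫ s in (0 : ℝ)..1, P.eval (exp (2 * Real.pi * s * I)) = P.eval 0 := by
  have hi : ∀ Q : Polynomial ℂ,
      IntervalIntegrable (fun s : ℝ => Q.eval (exp (2 * Real.pi * s * I))) volume 0 1 := by
    intro Q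
    refine Continuous.intervalIntegrable ?_ _ _
    exact Q.continuous.comp (by fun_prop)
  induction P using Polynomial.induction_on' with
  | add P Q hP hQ =>
    simp only [Polynomial.eval_add]
    rw [intervalIntegral.integral_add (hi P) (hi Q), hP, hQ]
  | monomial n c =>
    simp only [Polynomial.eval_monomial]
    rw [intervalIntegral.integral_const_mul]
    by_cases hn : n = 0
    · simp [hn]
    · rw [integral_exp_two_pi_mul_pow hn, zero_pow hn]

variable {θ : ℝ}

/-- The conformal map of the strip onto the unit disc that sends `θ` to `0`. -/
noncomputable def stripToDisc (θ : ℝ) (z : ℂ) : ℂ :=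
  (exp (Real.pi * z * I) - exp (Real.pi * θ * I)) /
    (exp (Real.pi * z * I) - exp (-(Real.pi * θ * I)))

theorem stripToDisc_self (θ : ℝ) : stripToDisc θ θ = 0 := by simp [stripToDisc]

theorem im_exp_pi_nonneg {z : ℂ} (hz : z ∈ verticalClosedStrip 0 1) :
    0 ≤ (exp (Real.pi * z * I)).im := by
  rw [Complex.exp_im]
  refine mul_nonneg (Real.exp_pos _).le ?_
  have h0 : 0 ≤ z.re := hz.1
  have h1 : z.re ≤ 1 := hz.2
  have : ((Real.pi : ℂ) * z * I).im = Real.pi * z.re := by simp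
  rw [this]
  exact Real.sin_nonneg_of_nonneg_of_le_pi (by positivity)
    (by nlinarith [Real.pi_pos])

theorem sin_pi_mul_pos (h0 : 0 < θ) (h1 : θ < 1) : 0 < Real.sin (Real.pi * θ) :=
  Real.sin_pos_of_pos_of_lt_pi (by positivity) (by nlinarith [Real.pi_pos])

theorem exp_pi_im (θ : ℝ) : (exp (Real.pi * θ * I)).im = Real.sin (Real.pi * θ) := by
  rw [← ofReal_mul, exp_ofReal_mul_I_im]

theorem exp_neg_pi_eq_conj (θ : ℝ) :
    exp (-(Real.pi * θ * I)) = (starRingEnd ℂ) (exp (Real.pi * θ * I)) := by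
  rw [← Complex.exp_conj]; simp

theorem stripToDisc_denom_ne_zero (h0 : 0 < θ) (h1 : θ < 1) {z : ℂ}
    (hz : z ∈ verticalClosedStrip 0 1) :
    exp (Real.pi * z * I) - exp (-(Real.pi * θ * I)) ≠ 0 := by
  intro h
  have := congrArg Complex.im h
  rw [sub_im, exp_neg_pi_eq_conj, conj_im, exp_pi_im, zero_im] at this
  linarith [im_exp_pi_nonneg hz, sin_pi_mul_pos h0 h1]

/-- The exponential `exp (π i z)` carries the strip into the closed upper half-plane, and a point
there is no farther from `exp (π i θ)` than from its conjugate. -/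
theorem norm_stripToDisc_le (h0 : 0 < θ) (h1 : θ < 1) {z : ℂ}
    (hz : z ∈ verticalClosedStrip 0 1) : ‖stripToDisc θ z‖ ≤ 1 := by
  rw [stripToDisc, norm_div]
  refine div_le_one_of_le₀ ?_ (norm_nonneg _)
  rw [← sq_le_sq₀ (norm_nonneg _) (norm_nonneg _), Complex.sq_norm, Complex.sq_norm, Complex.normSq_apply,
    Complex.normSq_apply,
    exp_neg_pi_eq_conj]
  simp only [sub_re, sub_im, conj_re, conj_im, exp_pi_im]
  nlinarith [mul_nonneg (im_exp_pi_nonneg hz) (sin_pi_mul_pos h0 h1).le]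

theorem differentiableAt_stripToDisc (h0 : 0 < θ) (h1 : θ < 1) {z : ℂ}
    (hz : z ∈ verticalClosedStrip 0 1) : DifferentiableAt ℂ (stripToDisc θ) z := by
  unfold stripToDisc
  refine DifferentiableAt.div (by fun_prop) (by fun_prop) (stripToDisc_denom_ne_zero h0 h1 hz)

/-- After multiplication by `sin (π s)` the numerator is `-sin (π θ) * exp (π i s)` and the
denominator is its conjugate, so the quotient is the square of `exp (π i s)`. -/
theorem stripToDisc_eq_exp (h0 : 0 < θ) (h1 : θ < 1) {z : ℂ} {s x : ℝ}
    (hz : exp (Real.pi * z * I) = x)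
    (hx : x * Real.sin (Real.pi * s) = Real.sin (Real.pi * (s - θ)))
    (hs : Real.sin (Real.pi * s) ≠ 0) : stripToDisc θ z = exp (2 * Real.pi * s * I) := by
  have hθ := (sin_pi_mul_pos h0 h1).ne'
  have e1 : ∀ t : ℝ, exp (Real.pi * t * I) =
      Real.cos (Real.pi * t) + Real.sin (Real.pi * t) * I := by
    intro t; rw [Complex.exp_mul_I]; push_cast; rfl
  have e2 : exp (2 * Real.pi * s * I) = exp (Real.pi * s * I) * exp (Real.pi * s * I) := by
    rw [← Complex.exp_add]; congr 1; ring
  have hs' : (Real.sin (Real.pi * s) : ℂ) ≠ 0 := by exact_mod_cast hs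
  have hθ' : (Real.sin (Real.pi * θ) : ℂ) ≠ 0 := by exact_mod_cast hθ
  have hx' : (x : ℂ) * Real.sin (Real.pi * s) = Real.sin (Real.pi * s) * Real.cos (Real.pi * θ) -
      Real.cos (Real.pi * s) * Real.sin (Real.pi * θ) := by
    rw [mul_sub, Real.sin_sub] at hx
    exact_mod_cast hx
  have hcs : (Real.sin (Real.pi * s) : ℂ) ^ 2 + (Real.cos (Real.pi * s) : ℂ) ^ 2 = 1 := by
    exact_mod_cast Real.sin_sq_add_cos_sq (Real.pi * s)
  have e3 : (starRingEnd ℂ) (exp (Real.pi * θ * I)) =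
      Real.cos (Real.pi * θ) - Real.sin (Real.pi * θ) * I := by
    rw [e1]; simp only [map_add, map_mul, conj_ofReal, conj_I]; ring
  have hnum : Real.sin (Real.pi * s) * ((x : ℂ) - exp (Real.pi * θ * I)) =
      - Real.sin (Real.pi * θ) * exp (Real.pi * s * I) := by
    rw [e1, e1]; linear_combination hx'
  have hden : Real.sin (Real.pi * s) * ((x : ℂ) - (starRingEnd ℂ) (exp (Real.pi * θ * I))) =
      - Real.sin (Real.pi * θ) * (Real.cos (Real.pi * s) - Real.sin (Real.pi * s) * I) := by
    rw [e3]; linear_combination hx'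
  have hunit :
      exp (Real.pi * s * I) * (Real.cos (Real.pi * s) - Real.sin (Real.pi * s) * I) = 1 := by
    rw [e1]
    linear_combination hcs - (Real.sin (Real.pi * s) : ℂ) ^ 2 * I_sq
  rw [stripToDisc, hz, exp_neg_pi_eq_conj, e2, div_eq_iff]
  · refine mul_left_cancel₀ hs' ?_
    rw [hnum]
    linear_combination (- (Real.sin (Real.pi * θ) : ℂ) * exp (Real.pi * s * I)) * (-hunit) -
      exp (Real.pi * s * I) ^ 2 * hden
  · intro h
    rw [h, mul_zero] at hden
    have h5 := (mul_eq_zero.1 hden.symm).resolve_left (neg_ne_zero.2 hθ')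
    rw [h5, mul_zero] at hunit
    exact zero_ne_one hunit

/-- The height of the boundary point of the strip which `stripToDisc θ` sends to
`exp (2 π i s)`: it lies on the left line for `θ < s < 1`, and on the right line for
`0 < s < θ`. -/
noncomputable def boundaryHeight (θ s : ℝ) : ℝ :=
  -(Real.log (Real.sin (Real.pi * (s - θ)) / Real.sin (Real.pi * s)) / Real.pi)

/-- The unit interval without the parameters of the two points at infinity of the strip. -/
def boundaryParam (θ : ℝ) : Set ℝ := Ioo 0 θ ∪ Ioo θ 1

theorem boundaryParam_subset (h0 : 0 < θ) (h1 : θ < 1) : boundaryParam θ ⊆ Ioo 0 1 :=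
  union_subset (Ioo_subset_Ioo_right h1.le) (Ioo_subset_Ioo_left h0.le)

theorem continuousOn_boundaryHeight (h0 : 0 < θ) (h1 : θ < 1) :
    ContinuousOn (boundaryHeight θ) (boundaryParam θ) := by
  have hs : ∀ s ∈ boundaryParam θ, Real.sin (Real.pi * s) ≠ 0 := fun s hs =>
    (sin_pi_mul_pos (boundaryParam_subset h0 h1 hs).1 (boundaryParam_subset h0 h1 hs).2).ne'
  unfold boundaryHeight
  refine ContinuousOn.neg (ContinuousOn.div_const (ContinuousOn.log (ContinuousOn.div (by fun_prop)
    (by fun_prop) hs) fun s hs' => div_ne_zero ?_ (hs s hs')) _)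
  rcases hs' with h | h
  · have := sin_pi_mul_pos (θ := θ - s) (by linarith [h.2]) (by linarith [h.1])
    rw [show Real.pi * (s - θ) = -(Real.pi * (θ - s)) by ring, Real.sin_neg]
    exact neg_ne_zero.2 this.ne'
  · exact (sin_pi_mul_pos (by linarith [h.1]) (by linarith [h.2])).ne'

theorem exists_boundaryParam (h0 : 0 < θ) (h1 : θ < 1) {x : ℝ} (hx : x ≠ 0) :
    ∃ s ∈ boundaryParam θ, (θ < s ↔ 0 < x) ∧
      x * Real.sin (Real.pi * s) = Real.sin (Real.pi * (s - θ)) ∧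
      boundaryHeight θ s = -(Real.log x / Real.pi) := by
  have hπ := Real.pi_pos
  have hθ := sin_pi_mul_pos h0 h1
  -- Dividing `x * sin (π s) = sin (π (s - θ))` by `sin (π s)` gives `cot (π s) = y`, which the
  -- arctangent solves with `0 < s < 1`.
  set y : ℝ := (Real.cos (Real.pi * θ) - x) / Real.sin (Real.pi * θ) with hy
  set s : ℝ := 1 / 2 - Real.arctan y / Real.pi with hs
  have hβ : Real.arctan y = Real.pi / 2 - Real.pi * s := by rw [hs]; field_simp; ring
  clear_value s
  have hs0 : 0 < s := by
    have := Real.arctan_lt_pi_div_two y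
    by_contra! h
    nlinarith
  have hs1 : s < 1 := by
    have := Real.neg_pi_div_two_lt_arctan y
    by_contra! h
    nlinarith
  have hsin := sin_pi_mul_pos hs0 hs1
  have hcos : Real.cos (Real.pi * s) = y * Real.sin (Real.pi * s) := by
    have h2 := Real.tan_arctan y
    rw [hβ, Real.tan_eq_sin_div_cos, Real.sin_pi_div_two_sub, Real.cos_pi_div_two_sub,
      div_eq_iff hsin.ne'] at h2
    exact h2
  have key : x * Real.sin (Real.pi * s) = Real.sin (Real.pi * (s - θ)) := by
    rw [mul_sub, Real.sin_sub, hcos, hy]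
    field_simp
    ring
  have hlt : 0 < x → θ < s := by
    intro hx0
    by_contra! h
    have h2 : Real.sin (Real.pi * (s - θ)) ≤ 0 := by
      refine Real.sin_nonpos_of_nonpos_of_neg_pi_le ?_ ?_ <;> nlinarith
    rw [← key] at h2
    nlinarith [mul_pos hx0 hsin]
  have hgt : x < 0 → s < θ := by
    intro hx0
    by_contra! h
    have h2 : 0 ≤ Real.sin (Real.pi * (s - θ)) := by
      refine Real.sin_nonneg_of_nonneg_of_le_pi ?_ ?_ <;> nlinarith
    rw [← key] at h2
    nlinarith [mul_pos (neg_pos.2 hx0) hsin]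
  refine ⟨s, ?_, ?_, key, ?_⟩
  · rcases lt_or_gt_of_ne hx with h | h
    · exact Or.inl ⟨hs0, hgt h⟩
    · exact Or.inr ⟨hlt h, hs1⟩
  · refine ⟨fun h => ?_, hlt⟩
    by_contra! h2
    exact absurd (hgt (lt_of_le_of_ne h2 hx)) (by linarith)
  · rw [boundaryHeight, ← key, mul_div_cancel_right₀ _ hsin.ne']

theorem exists_boundaryParam_left (h0 : 0 < θ) (h1 : θ < 1) (t : ℝ) :
    ∃ s ∈ Ioo θ 1, boundaryHeight θ s = t ∧
      stripToDisc θ (t * I) = exp (2 * Real.pi * s * I) := by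
  have hx : 0 < Real.exp (-(Real.pi * t)) := Real.exp_pos _
  obtain ⟨s, hs, hsx, hkey, hh⟩ := exists_boundaryParam h0 h1 hx.ne'
  have hs' := boundaryParam_subset h0 h1 hs
  refine ⟨s, ⟨hsx.2 hx, hs'.2⟩, ?_, stripToDisc_eq_exp h0 h1 ?_ hkey
    (sin_pi_mul_pos hs'.1 hs'.2).ne'⟩
  · rw [hh, Real.log_exp]; field_simp
  · rw [ofReal_exp]
    congr 1
    push_cast
    linear_combination (Real.pi : ℂ) * t * I_sq

theorem exists_boundaryParam_right (h0 : 0 < θ) (h1 : θ < 1) (t : ℝ) :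
    ∃ s ∈ Ioo 0 θ, boundaryHeight θ s = t ∧
      stripToDisc θ (1 + t * I) = exp (2 * Real.pi * s * I) := by
  have hx : -Real.exp (-(Real.pi * t)) < 0 := neg_neg_of_pos (Real.exp_pos _)
  obtain ⟨s, hs, hsx, hkey, hh⟩ := exists_boundaryParam h0 h1 hx.ne
  have hs' := boundaryParam_subset h0 h1 hs
  have hsθ : s < θ := by
    rcases hs with h | h
    · exact h.2
    · exact absurd (hsx.1 h.1) (by linarith)
  refine ⟨s, ⟨hs'.1, hsθ⟩, ?_, stripToDisc_eq_exp h0 h1 ?_ hkey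
    (sin_pi_mul_pos hs'.1 hs'.2).ne'⟩
  -- On the right line `exp (π i z)` is negative. The convention `log (-x) = log x` makes one
  -- formula for the height serve both lines.
  · rw [hh, Real.log_neg_eq_log, Real.log_exp]; field_simp
  · rw [ofReal_neg, ofReal_exp, ← neg_one_mul, ← Complex.exp_pi_mul_I, ← Complex.exp_add]
    congr 1
    push_cast
    linear_combination (Real.pi : ℂ) * t * I_sq

theorem boundaryParam_ae_eq (h0 : 0 < θ) (h1 : θ < 1) :
    boundaryParam θ =ᵐ[volume] Ioc (0 : ℝ) 1 := by
  rw [← Ioc_union_Ioc_eq_Ioc h0.le h1.le]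
  exact Ioo_ae_eq_Ioc.union Ioo_ae_eq_Ioc

theorem measurableSet_boundaryParam : MeasurableSet (boundaryParam θ) :=
  measurableSet_Ioo.union measurableSet_Ioo

theorem volume_boundaryParam (h0 : 0 < θ) (h1 : θ < 1) : volume (boundaryParam θ) = 1 := by
  rw [measure_congr (boundaryParam_ae_eq h0 h1)]; simp

theorem setIntegral_boundaryParam (h0 : 0 < θ) (h1 : θ < 1) {F : Type*} [NormedAddCommGroup F]
    [NormedSpace ℝ F] (f : ℝ → F) : ∫ s in boundaryParam θ, f s = ∫ s in (0 : ℝ)..1, f s := by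
  rw [intervalIntegral.integral_of_le zero_le_one,
    setIntegral_congr_set (boundaryParam_ae_eq h0 h1)]

end Disc

/-! ### The logarithmic integral inequality and its power form. -/

section BoundaryNorm

variable {θ : ℝ}

theorem continuousOn_ite_boundaryParam {F : Type*} [TopologicalSpace F] {f g : ℝ → F}
    (hf : ContinuousOn f (Ioo θ 1)) (hg : ContinuousOn g (Ioo 0 θ)) :
    ContinuousOn (fun s => if θ < s then f s else g s) (boundaryParam θ) := by
  refine ContinuousOn.union_of_isOpen ?_ ?_ isOpen_Ioo isOpen_Ioo
  · exact hg.congr fun s hs => if_neg (not_lt.2 hs.2.le)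
  · exact hf.congr fun s hs => if_pos hs.1

theorem integrableOn_boundaryParam (h0 : 0 < θ) (h1 : θ < 1) {f : ℝ → ℝ}
    (hf : ContinuousOn f (boundaryParam θ)) {C : ℝ} (hC : ∀ s, |f s| ≤ C) :
    IntegrableOn f (boundaryParam θ) :=
  IntegrableOn.of_bound (by rw [volume_boundaryParam h0 h1]; exact ENNReal.one_lt_top)
    (hf.aestronglyMeasurable measurableSet_boundaryParam) C (Eventually.of_forall hC)

/-- The harmonic measure at `θ` becomes Lebesgue measure in the parameter; it gives mass `1 - θ` to
the left line and `θ` to the right one. -/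
theorem integral_ite_boundaryParam (h0 : 0 < θ) (h1 : θ < 1) (a b : ℝ) :
    ∫ s in boundaryParam θ, (if θ < s then a else b) = (1 - θ) * a + θ * b := by
  have hd : Disjoint (Ioo 0 θ) (Ioo θ 1) := by
    rw [Set.disjoint_left]; exact fun s hs hs' => lt_asymm hs.2 hs'.1
  have e0 : EqOn (fun s => if θ < s then a else b) (fun _ => b) (Ioo 0 θ) :=
    fun s hs => if_neg (not_lt.2 hs.2.le)
  have e1 : EqOn (fun s => if θ < s then a else b) (fun _ => a) (Ioo θ 1) :=
    fun s hs => if_pos hs.1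
  have i0 : IntegrableOn (fun s => if θ < s then a else b) (Ioo 0 θ) :=
    (integrableOn_congr_fun e0 measurableSet_Ioo).2 (integrableOn_const (by simp))
  have i1 : IntegrableOn (fun s => if θ < s then a else b) (Ioo θ 1) :=
    (integrableOn_congr_fun e1 measurableSet_Ioo).2 (integrableOn_const (by simp))
  rw [boundaryParam, setIntegral_union hd measurableSet_Ioo i0 i1,
    setIntegral_congr_fun measurableSet_Ioo e0, setIntegral_congr_fun measurableSet_Ioo e1]
  simp [h0.le, h1.le, add_comm]

variable {W V V₀ V₁ : Type*} [AddCommGroup W] [Module ℂ W]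
  [NormedAddCommGroup V] [NormedSpace ℂ V] [NormedAddCommGroup V₀] [NormedSpace ℂ V₀]
  [NormedAddCommGroup V₁] [NormedSpace ℂ V₁]
  {N₀ N₁ : W → ℝ≥0∞} {ι : V →ₗ[ℂ] W} {ι₀ : V₀ →ₗ[ℂ] W} {ι₁ : V₁ →ₗ[ℂ] W} {g : ℂ → W}

/-- The norm of the boundary value of `g` at the point with parameter `s`. -/
noncomputable def boundaryNorm (N₀ N₁ : W → ℝ≥0∞) (θ : ℝ) (g : ℂ → W) (s : ℝ) : ℝ≥0∞ :=
  if θ < s then N₀ (g (boundaryHeight θ s * I)) else N₁ (g (1 + boundaryHeight θ s * I))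

theorem boundaryNorm_le_normF (s : ℝ) : boundaryNorm N₀ N₁ θ g s ≤ normF N₀ N₁ g := by
  unfold boundaryNorm
  split_ifs
  · exact le_normF_left _
  · exact le_normF_right _

theorem boundaryNorm_ne_top (hg : MemF N₀ N₁ g) (s : ℝ) : boundaryNorm N₀ N₁ θ g s ≠ ⊤ :=
  ne_top_of_le_ne_top hg.normF_ne_top (boundaryNorm_le_normF s)

theorem continuousOn_boundaryNorm (h0 : 0 < θ) (h1 : θ < 1) (hr₀ : Represents N₀ ι₀)
    (hr₁ : Represents N₁ ι₁) (hg : MemF N₀ N₁ g) :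
    ContinuousOn (fun s => (boundaryNorm N₀ N₁ θ g s).toReal) (boundaryParam θ) := by
  obtain ⟨G₀, hG₀⟩ := hr₀.exists_isLift_univ_iff.2 ⟨hg.bounded_left, hg.continuous_left⟩
  obtain ⟨G₁, hG₁⟩ := hr₁.exists_isLift_univ_iff.2 ⟨hg.bounded_right, hg.continuous_right⟩
  have hτ := continuousOn_boundaryHeight h0 h1
  have hc₀ := (continuousOn_univ.1 hG₀.cont).norm.comp_continuousOn
    (hτ.mono subset_union_right)
  have hc₁ := (continuousOn_univ.1 hG₁.cont).norm.comp_continuousOn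
    (hτ.mono subset_union_left)
  refine (continuousOn_ite_boundaryParam hc₀ hc₁).congr fun s hs => ?_
  simp only [boundaryNorm]
  split_ifs
  · have := hG₀.eq (boundaryHeight θ s) trivial
    rw [← this, hr₀.norm_eq, toReal_enorm]; rfl
  · have := hG₁.eq (boundaryHeight θ s) trivial
    rw [← this, hr₁.norm_eq, toReal_enorm]; rfl

/-- Multiply `g` by an approximate outer function that equals `1` at `θ` and has boundary modulus
about `exp (∫ k - k)`: the value at `θ` is kept and the boundary norms are levelled. With a
polynomial `P` whose real part is uniformly near `k` on the circle, no harmonic conjugate is needed,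
and the multiplier is bounded and continuous up to the boundary. -/
theorem interpNorm_le_exp_integral_of_continuousOn (h0 : 0 < θ) (h1 : θ < 1)
    (h : Represents (sumNorm N₀ N₁) ι) (hr₀ : Represents N₀ ι₀) (hr₁ : Represents N₁ ι₁)
    (hg : MemF N₀ N₁ g) {k : ℝ → ℝ} (hk : ContinuousOn k (Icc 0 1)) (hk01 : k 0 = k 1)
    (hle : ∀ s ∈ boundaryParam θ, boundaryNorm N₀ N₁ θ g s ≤ ENNReal.ofReal (Real.exp (k s))) :
    interpNorm N₀ N₁ θ (g θ) ≤ ENNReal.ofReal (Real.exp (∫ s in (0 : ℝ)..1, k s)) := by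
  have main : ∀ ε : ℝ, 0 < ε → interpNorm N₀ N₁ θ (g θ) ≤
      ENNReal.ofReal (Real.exp ((∫ s in (0 : ℝ)..1, k s) + 2 * ε)) := by
    intro ε hε
    obtain ⟨P, hP⟩ := exists_polynomial_re_near hk hk01 hε
    let f : ℂ → ℂ := fun z => exp (P.eval 0 - P.eval (stripToDisc θ z))
    have hfd : ∀ z ∈ verticalClosedStrip 0 1, DifferentiableAt ℂ f z := fun z hz =>
      ((P.differentiable.differentiableAt.comp z
        (differentiableAt_stripToDisc h0 h1 hz)).const_sub _).cexp
    have hfb : ∃ C : ℝ, ∀ z ∈ verticalClosedStrip 0 1, ‖f z‖ ≤ C := by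
      obtain ⟨C, hC⟩ := (isCompact_closedBall (0 : ℂ) 1).exists_bound_of_continuousOn
        (f := fun u => exp (P.eval 0 - P.eval u))
        (continuous_exp.comp (continuous_const.sub P.continuous)).continuousOn
      exact ⟨C, fun z hz => hC _ (by simpa using norm_stripToDisc_le h0 h1 hz)⟩
    have hfg := hg.smul h hr₀ hr₁ (f := f) (fun z hz => (hfd z hz).continuousAt.continuousWithinAt)
      (fun z hz => (hfd z (verticalStrip_subset hz)).differentiableWithinAt) hfb
    have hval : f θ • g θ = g θ := by simp [f, stripToDisc_self]
    have hbd : ∀ (s : ℝ), s ∈ boundaryParam θ → ∀ z, stripToDisc θ z = exp (2 * Real.pi * s * I) →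
        ∀ y, y ≤ ENNReal.ofReal (Real.exp (k s)) →
        ‖f z‖ₑ * y ≤ ENNReal.ofReal (Real.exp ((P.eval 0).re + ε)) := by
      intro s hs z hz y hy
      have hs' := boundaryParam_subset h0 h1 hs
      refine (mul_le_mul_right hy _).trans ?_
      rw [← ofReal_norm, Complex.norm_exp, ← ENNReal.ofReal_mul (Real.exp_pos _).le, ← Real.exp_add,
        hz]
      refine ENNReal.ofReal_le_ofReal (Real.exp_le_exp.2 ?_)
      have := (abs_le.1 (hP s ⟨hs'.1.le, hs'.2⟩)).1
      rw [sub_re]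
      linarith
    have hnorm : normF N₀ N₁ (fun z => f z • g z) ≤
        ENNReal.ofReal (Real.exp ((P.eval 0).re + ε)) := by
      refine normF_le (fun t => ?_) (fun t => ?_)
      · obtain ⟨s, hs, hst, hsz⟩ := exists_boundaryParam_left h0 h1 t
        rw [hr₀.map_smul (Complex.exp_ne_zero _)]
        have hy := hle s (Or.inr hs)
        rw [boundaryNorm, if_pos hs.1, hst] at hy
        exact hbd s (Or.inr hs) _ hsz _ hy
      · obtain ⟨s, hs, hst, hsz⟩ := exists_boundaryParam_right h0 h1 t
        rw [hr₁.map_smul (Complex.exp_ne_zero _)]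
        have hy := hle s (Or.inl hs)
        rw [boundaryNorm, if_neg (not_lt.2 hs.2.le), hst] at hy
        exact hbd s (Or.inl hs) _ hsz _ hy
    -- The mean value property identifies the real part of `P` at `0` with the mean of its boundary
    -- values, which exceed `k` by at most `ε`.
    have hmean : (P.eval 0).re ≤ (∫ s in (0 : ℝ)..1, k s) + ε := by
      have hcont : Continuous fun s : ℝ => P.eval (exp (2 * Real.pi * s * I)) :=
        P.continuous.comp (by fun_prop)
      have hint : (P.eval 0).re = ∫ s in (0 : ℝ)..1, (P.eval (exp (2 * Real.pi * s * I))).re := by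
        rw [← integral_eval_exp P]
        exact (reCLM.intervalIntegral_comp_comm (hcont.intervalIntegrable 0 1)).symm
      have hki : IntervalIntegrable k volume 0 1 :=
        (by simpa using hk : ContinuousOn k (uIcc 0 1)).intervalIntegrable
      calc (P.eval 0).re ≤ ∫ s in (0 : ℝ)..1, (k s + ε) := by
            rw [hint]
            refine intervalIntegral.integral_mono_on_of_le_Ioo zero_le_one
              ((continuous_re.comp hcont).intervalIntegrable 0 1)
              (hki.add intervalIntegrable_const) fun s hs => ?_
            have := (abs_le.1 (hP s ⟨hs.1.le, hs.2⟩)).2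
            linarith
        _ = _ := by
            rw [intervalIntegral.integral_add hki intervalIntegrable_const]; simp
    have hi := interpNorm_le_normF (θ := θ) hfg
    rw [hval] at hi
    refine (hi.trans hnorm).trans (ENNReal.ofReal_le_ofReal (Real.exp_le_exp.2 ?_))
    linarith
  have hlim : Tendsto (fun ε : ℝ => ENNReal.ofReal (Real.exp ((∫ s in (0 : ℝ)..1, k s) + 2 * ε)))
      (𝓝[>] 0) (𝓝 (ENNReal.ofReal (Real.exp (∫ s in (0 : ℝ)..1, k s)))) := by
    have : Continuous fun ε : ℝ =>
        ENNReal.ofReal (Real.exp ((∫ s in (0 : ℝ)..1, k s) + 2 * ε)) :=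
      ENNReal.continuous_ofReal.comp (by fun_prop)
    have := (this.tendsto 0).mono_left (nhdsWithin_le_nhds (s := Ioi 0))
    simpa using this
  exact ge_of_tendsto hlim (by filter_upwards [self_mem_nhdsWithin] with ε hε using main ε hε)

/-- A continuous cutoff which vanishes at the points of `[0, 1]` outside `boundaryParam θ`. -/
noncomputable def boundaryCutoff (θ : ℝ) (m : ℕ) (s : ℝ) : ℝ :=
  min 1 (m * |Real.sin (Real.pi * s) * Real.sin (Real.pi * (s - θ))|)

theorem continuous_boundaryCutoff (m : ℕ) : Continuous (boundaryCutoff θ m) := by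
  unfold boundaryCutoff; fun_prop

theorem boundaryCutoff_nonneg (m : ℕ) (s : ℝ) : 0 ≤ boundaryCutoff θ m s :=
  le_min zero_le_one (by positivity)

theorem boundaryCutoff_le_one (m : ℕ) (s : ℝ) : boundaryCutoff θ m s ≤ 1 := min_le_left _ _

theorem boundaryCutoff_eq_zero {s : ℝ} (hs : s ∈ Icc (0 : ℝ) 1) (hs' : s ∉ boundaryParam θ)
    (m : ℕ) : boundaryCutoff θ m s = 0 := by
  have : Real.sin (Real.pi * s) * Real.sin (Real.pi * (s - θ)) = 0 := by
    rcases hs.1.eq_or_lt with h | h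
    · simp [← h]
    rcases hs.2.eq_or_lt with h' | h'
    · simp [h']
    have : s = θ := by
      by_contra hne
      rcases lt_or_gt_of_ne hne with h2 | h2
      · exact hs' (Or.inl ⟨h, h2⟩)
      · exact hs' (Or.inr ⟨h2, h'⟩)
    simp [this]
  simp [boundaryCutoff, this]

theorem eventually_boundaryCutoff_eq_one (h0 : 0 < θ) (h1 : θ < 1) {s : ℝ}
    (hs : s ∈ boundaryParam θ) : ∀ᶠ m in atTop, boundaryCutoff θ m s = 1 := by
  have hs' := boundaryParam_subset h0 h1 hs
  have h2 : Real.sin (Real.pi * (s - θ)) ≠ 0 := by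
    rcases hs with h | h
    · have := sin_pi_mul_pos (θ := θ - s) (by linarith [h.2]) (by linarith [h.1])
      rw [show Real.pi * (s - θ) = -(Real.pi * (θ - s)) by ring, Real.sin_neg]
      exact neg_ne_zero.2 this.ne'
    · exact (sin_pi_mul_pos (by linarith [h.1]) (by linarith [h.2])).ne'
  have hpos : 0 < |Real.sin (Real.pi * s) * Real.sin (Real.pi * (s - θ))| :=
    abs_pos.2 (mul_ne_zero (sin_pi_mul_pos hs'.1 hs'.2).ne' h2)
  have := (tendsto_natCast_atTop_atTop (R := ℝ)).atTop_mul_const hpos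
  filter_upwards [this.eventually_ge_atTop 1] with m hm
  exact min_eq_left hm

/-- The majorant `k` may fail to extend continuously to the parameters of the two ends of the strip.
Continuous majorants `κ m ≥ k`, equal to `L` at those parameters, converge to `k` elsewhere, and
dominated convergence passes to the limit in the integral. -/
theorem interpNorm_le_exp_integral (h0 : 0 < θ) (h1 : θ < 1)
    (h : Represents (sumNorm N₀ N₁) ι) (hr₀ : Represents N₀ ι₀) (hr₁ : Represents N₁ ι₁)
    (hg : MemF N₀ N₁ g) {k : ℝ → ℝ} (hk : ContinuousOn k (boundaryParam θ)) {L : ℝ}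
    (hL : ∀ s, |k s| ≤ L)
    (hle : ∀ s ∈ boundaryParam θ, boundaryNorm N₀ N₁ θ g s ≤ ENNReal.ofReal (Real.exp (k s))) :
    interpNorm N₀ N₁ θ (g θ) ≤ ENNReal.ofReal (Real.exp (∫ s in boundaryParam θ, k s)) := by
  have hkL : ∀ s, 0 ≤ L - k s ∧ L - k s ≤ 2 * L := fun s => by
    have := abs_le.1 (hL s); constructor <;> linarith
  have hL0 : 0 ≤ L := (abs_nonneg _).trans (hL 0)
  let κ : ℕ → ℝ → ℝ := fun m s => L - boundaryCutoff θ m s * (L - k s)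
  have hopen : IsOpen (boundaryParam θ) := isOpen_Ioo.union isOpen_Ioo
  have hκU : ∀ m, ContinuousOn (κ m) (boundaryParam θ) := fun m =>
    continuousOn_const.sub ((continuous_boundaryCutoff m).continuousOn.mul
      (continuousOn_const.sub hk))
  have hκ : ∀ m, ContinuousOn (κ m) (Icc 0 1) := by
    intro m s hs
    by_cases hsU : s ∈ boundaryParam θ
    · exact ((hκU m).continuousAt (hopen.mem_nhds hsU)).continuousWithinAt
    · refine ContinuousAt.continuousWithinAt ?_
      have hz := boundaryCutoff_eq_zero hs hsU m
      refine continuousAt_const.sub ?_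
      rw [ContinuousAt, hz, zero_mul]
      have hlim : Tendsto (fun x => boundaryCutoff θ m x * (2 * L)) (𝓝 s) (𝓝 0) := by
        have := ((continuous_boundaryCutoff (θ := θ) m).tendsto s).mul_const (2 * L)
        rwa [hz, zero_mul] at this
      exact tendsto_of_tendsto_of_tendsto_of_le_of_le tendsto_const_nhds hlim
        (fun x => mul_nonneg (boundaryCutoff_nonneg m x) (hkL x).1)
        (fun x => mul_le_mul_of_nonneg_left (hkL x).2 (boundaryCutoff_nonneg m x))
  have hkκ : ∀ m s, k s ≤ κ m s := by
    intro m s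
    have := mul_le_mul_of_nonneg_right (boundaryCutoff_le_one (θ := θ) m s) (hkL s).1
    simp only [κ]; linarith
  have hκ01 : ∀ m, κ m 0 = κ m 1 := by
    intro m
    have e0 := boundaryCutoff_eq_zero (θ := θ) (s := 0) (by simp)
      (fun hs => lt_irrefl _ (boundaryParam_subset h0 h1 hs).1) m
    have e1 := boundaryCutoff_eq_zero (θ := θ) (s := 1) (by simp)
      (fun hs => lt_irrefl _ (boundaryParam_subset h0 h1 hs).2) m
    simp [κ, e0, e1]
  have hκbd : ∀ m s, |κ m s| ≤ L := by
    intro m s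
    have h3 := mul_nonneg (boundaryCutoff_nonneg (θ := θ) m s) (hkL s).1
    have h4 := hkκ m s
    rw [abs_le]
    exact ⟨(abs_le.1 (hL s)).1.trans h4, by simp only [κ]; linarith⟩
  have hlim : Tendsto (fun m => ∫ s in boundaryParam θ, κ m s) atTop
      (𝓝 (∫ s in boundaryParam θ, k s)) := by
    refine tendsto_integral_of_dominated_convergence (fun _ => L)
      (fun m => (hκU m).aestronglyMeasurable measurableSet_boundaryParam) ?_
      (fun m => Eventually.of_forall fun s => hκbd m s) ?_
    · exact integrableOn_const (by rw [volume_boundaryParam h0 h1]; exact ENNReal.one_ne_top)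
    · refine (ae_restrict_iff' measurableSet_boundaryParam).2 (Eventually.of_forall fun s hs => ?_)
      refine tendsto_const_nhds.congr' ?_
      filter_upwards [eventually_boundaryCutoff_eq_one h0 h1 hs] with m hm
      simp [κ, hm]
  have hlim' := ENNReal.tendsto_ofReal ((Real.continuous_exp.tendsto _).comp hlim)
  refine ge_of_tendsto' hlim' fun m => ?_
  rw [Function.comp_apply, setIntegral_boundaryParam h0 h1]
  refine interpNorm_le_exp_integral_of_continuousOn h0 h1 h hr₀ hr₁ hg (hκ m) (hκ01 m)
    fun s hs => (hle s hs).trans ?_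
  exact ENNReal.ofReal_le_ofReal (Real.exp_le_exp.2 (hkκ m s))

/-- If `1 / p = (1 - θ) / p₀ + θ / p₁`, the `p`-th power of the norm of `g θ` in the
interpolation space is at most a weighted mean of the `p_j`-th powers of the boundary norms. -/
theorem rpow_interpNorm_le_integral (h0 : 0 < θ) (h1 : θ < 1)
    (h : Represents (sumNorm N₀ N₁) ι) (hr₀ : Represents N₀ ι₀) (hr₁ : Represents N₁ ι₁)
    (hg : MemF N₀ N₁ g) {p₀ p₁ p : ℝ} (hp₀ : 1 ≤ p₀) (hp₁ : 1 ≤ p₁) (hp : 0 < p)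
    (hpp : 1 / p = (1 - θ) / p₀ + θ / p₁) :
    (interpNorm N₀ N₁ θ (g θ)).toReal ^ p ≤ ∫ s in boundaryParam θ,
      (if θ < s then p / p₀ else p / p₁) *
        (boundaryNorm N₀ N₁ θ g s).toReal ^ (if θ < s then p₀ else p₁) := by
  set w : ℝ → ℝ := fun s => if θ < s then p / p₀ else p / p₁ with hw
  set q : ℝ → ℝ := fun s => if θ < s then p₀ else p₁ with hq
  set ν : ℝ → ℝ := fun s => (boundaryNorm N₀ N₁ θ g s).toReal with hν
  change _ ≤ ∫ s in boundaryParam θ, w s * ν s ^ q s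
  have hp₀' : 0 < p₀ := by linarith
  have hp₁' : 0 < p₁ := by linarith
  have hq1 : ∀ s, 1 ≤ q s := fun s => by simp only [hq]; split_ifs <;> assumption
  have hqm : ∀ s, q s ≤ max p₀ p₁ := fun s => by simp only [hq]; split_ifs <;> simp
  have hw0 : ∀ s, 0 < w s := fun s => by simp only [hw]; split_ifs <;> positivity
  have hwm : ∀ s, w s ≤ max (p / p₀) (p / p₁) := fun s => by simp only [hw]; split_ifs <;> simp
  have hwq : ∀ s, w s * q s = p := fun s => by simp only [hw, hq]; split_ifs <;> field_simp
  -- The relation between `p`, `p₀` and `p₁` says exactly that `w` is a probability density; with `w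
  -- * q = p` this sets up Jensen's inequality.
  have hwint : ∫ s in boundaryParam θ, w s = 1 := by
    rw [integral_ite_boundaryParam h0 h1]
    have : (1 - θ) * (p / p₀) + θ * (p / p₁) = p * ((1 - θ) / p₀ + θ / p₁) := by ring
    rw [this, ← hpp, mul_one_div_cancel hp.ne']
  have hwc : ContinuousOn w (boundaryParam θ) :=
    continuousOn_ite_boundaryParam continuousOn_const continuousOn_const
  have hqc : ContinuousOn q (boundaryParam θ) :=
    continuousOn_ite_boundaryParam continuousOn_const continuousOn_const
  have hνc : ContinuousOn ν (boundaryParam θ) := continuousOn_boundaryNorm h0 h1 hr₀ hr₁ hg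
  obtain ⟨D, hD1, hνD⟩ : ∃ D : ℝ, 1 ≤ D ∧ ∀ s, ν s ≤ D :=
    ⟨max 1 (normF N₀ N₁ g).toReal, le_max_left _ _, fun s => le_max_of_le_right
      (ENNReal.toReal_mono hg.normF_ne_top (boundaryNorm_le_normF s))⟩
  have hν0 : ∀ s, 0 ≤ ν s := fun s => ENNReal.toReal_nonneg
  have hwi : IntegrableOn w (boundaryParam θ) := integrableOn_boundaryParam h0 h1 hwc
    (C := max (p / p₀) (p / p₁)) fun s => by rw [abs_of_pos (hw0 s)]; exact hwm s
  have hrpow : ∀ f : ℝ → ℝ, ContinuousOn f (boundaryParam θ) → (∀ s, 0 ≤ f s) → (∀ s, f s ≤ D) →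
      IntegrableOn (fun s => w s * f s ^ q s) (boundaryParam θ) := by
    intro f hf hf0 hfD
    refine integrableOn_boundaryParam h0 h1 (C := max (p / p₀) (p / p₁) * D ^ max p₀ p₁)
      (hwc.mul (hf.rpow hqc fun s _ => Or.inr (by linarith [hq1 s]))) fun s => ?_
    rw [abs_of_nonneg (mul_nonneg (hw0 s).le (Real.rpow_nonneg (hf0 s) _))]
    refine mul_le_mul (hwm s) ?_ (Real.rpow_nonneg (hf0 s) _) ((hw0 s).le.trans (hwm s))
    exact (Real.rpow_le_rpow (hf0 s) (hfD s) (by linarith [hq1 s])).trans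
      (Real.rpow_le_rpow_of_exponent_le hD1 (hqm s))
  have main : ∀ δ : ℝ, 0 < δ → δ ≤ 1 → (interpNorm N₀ N₁ θ (g θ)).toReal ^ p ≤
      (∫ s in boundaryParam θ, w s * ν s ^ q s) + δ := by
    intro δ hδ hδ1
    -- The boundary norm may vanish; the truncation keeps its logarithm bounded.
    set μ : ℝ → ℝ := fun s => max (ν s) δ with hμ
    have hμ0 : ∀ s, 0 < μ s := fun s => hδ.trans_le (le_max_right _ _)
    have hμD : ∀ s, μ s ≤ D := fun s => max_le (hνD s) (hδ1.trans hD1)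
    have hμc : ContinuousOn μ (boundaryParam θ) := hνc.sup continuousOn_const
    have hkc : ContinuousOn (fun s => Real.log (μ s)) (boundaryParam θ) :=
      hμc.log fun s _ => (hμ0 s).ne'
    have hkb : ∀ s, |Real.log (μ s)| ≤ max |Real.log δ| |Real.log D| := fun s =>
      abs_le_max_abs_abs (Real.log_le_log hδ (le_max_right _ _)) (Real.log_le_log (hμ0 s) (hμD s))
    have hki : IntegrableOn (fun s => Real.log (μ s)) (boundaryParam θ) :=
      integrableOn_boundaryParam h0 h1 hkc hkb
    have hlog := interpNorm_le_exp_integral h0 h1 h hr₀ hr₁ hg hkc hkb (fun s _ => by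
      rw [Real.exp_log (hμ0 s), ← ENNReal.ofReal_toReal (boundaryNorm_ne_top hg s)]
      exact ENNReal.ofReal_le_ofReal (le_max_left _ _))
    have hlog' : (interpNorm N₀ N₁ θ (g θ)).toReal ^ p ≤
        Real.exp (p * ∫ s in boundaryParam θ, Real.log (μ s)) := by
      rw [mul_comm, Real.exp_mul]
      exact Real.rpow_le_rpow ENNReal.toReal_nonneg
        (ENNReal.toReal_le_of_le_ofReal (Real.exp_pos _).le hlog) hp.le
    set A : ℝ := p * ∫ s in boundaryParam θ, Real.log (μ s) with hA
    have hYi := hrpow μ hμc (fun s => (hμ0 s).le) hμD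
    -- Jensen by hand: integrate the tangent-line bound `log y ≤ y * exp (-A) - 1 + A` at `y = μ s ^
    -- q s` against `w`.
    have hjensen : A ≤ Real.exp (-A) * (∫ s in boundaryParam θ, w s * μ s ^ q s) + (A - 1) := by
      have hpt : ∀ s, p * Real.log (μ s) ≤
          Real.exp (-A) * (w s * μ s ^ q s) + (A - 1) * w s := by
        intro s
        have hY : 0 < μ s ^ q s := Real.rpow_pos_of_pos (hμ0 s) _
        have h2 := Real.log_le_sub_one_of_pos (mul_pos hY (Real.exp_pos (-A)))
        rw [Real.log_mul hY.ne' (Real.exp_pos _).ne', Real.log_exp, Real.log_rpow (hμ0 s)] at h2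
        calc p * Real.log (μ s) = w s * (q s * Real.log (μ s)) := by rw [← hwq s]; ring
          _ ≤ w s * (μ s ^ q s * Real.exp (-A) - 1 + A) :=
            mul_le_mul_of_nonneg_left (by linarith) (hw0 s).le
          _ = _ := by ring
      calc A = ∫ s in boundaryParam θ, p * Real.log (μ s) := by rw [integral_const_mul]
        _ ≤ ∫ s in boundaryParam θ, (Real.exp (-A) * (w s * μ s ^ q s) + (A - 1) * w s) :=
          integral_mono (hki.const_mul p) ((hYi.const_mul _).add (hwi.const_mul _)) hpt
        _ = _ := by
          rw [integral_add (hYi.const_mul _) (hwi.const_mul _), integral_const_mul,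
            integral_const_mul, hwint, mul_one]
    have hexp : Real.exp A ≤ ∫ s in boundaryParam θ, w s * μ s ^ q s := by
      have h2 : 1 ≤ Real.exp (-A) * (∫ s in boundaryParam θ, w s * μ s ^ q s) := by linarith
      rw [Real.exp_neg, ← div_eq_inv_mul, one_le_div (Real.exp_pos _)] at h2
      exact h2
    refine hlog'.trans (hexp.trans ?_)
    have hνi := hrpow ν hνc hν0 hνD
    calc _ ≤ ∫ s in boundaryParam θ, (w s * ν s ^ q s + δ * w s) := by
          refine integral_mono hYi (hνi.add (hwi.const_mul δ)) fun s => ?_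
          have h2 : μ s ^ q s ≤ ν s ^ q s + δ := by
            have hδq : δ ^ q s ≤ δ := by
              simpa using Real.rpow_le_rpow_of_exponent_ge hδ hδ1 (hq1 s)
            rcases le_total (ν s) δ with h3 | h3
            · rw [hμ]; simp only [max_eq_right h3]
              linarith [Real.rpow_nonneg (hν0 s) (q s)]
            · rw [hμ]; simp only [max_eq_left h3]
              linarith
          have h3 := mul_le_mul_of_nonneg_left h2 (hw0 s).le
          simp only
          linarith
      _ = _ := by
          rw [integral_add hνi (hwi.const_mul δ), integral_const_mul, hwint, mul_one]
  refine le_of_forall_pos_le_add fun ε hε => ?_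
  refine (main (min ε 1) (lt_min hε zero_lt_one) (min_le_right _ _)).trans ?_
  linarith [min_le_left ε 1]

end BoundaryNorm

/-! ### Homogeneity of the interpolation norm. -/

section InterpNorm

variable {W V₀ V₁ : Type*} [AddCommGroup W] [Module ℂ W]
  [NormedAddCommGroup V₀] [NormedSpace ℂ V₀] [NormedAddCommGroup V₁] [NormedSpace ℂ V₁]
  {N₀ N₁ : W → ℝ≥0∞} {ι₀ : V₀ →ₗ[ℂ] W} {ι₁ : V₁ →ₗ[ℂ] W} {θ : ℝ}

theorem interpNorm_smul_le (hr₀ : Represents N₀ ι₀) (hr₁ : Represents N₁ ι₁) {c : ℂ} (hc : c ≠ 0)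
    (x : W) : interpNorm N₀ N₁ θ (c • x) ≤ ‖c‖ₑ * interpNorm N₀ N₁ θ x := by
  have hc' : ‖c‖ₑ ≠ 0 := enorm_ne_zero.2 hc
  have h₀ : ∀ w, N₀ (c • w) ≤ ‖c‖₊ * N₀ w := fun w => (hr₀.map_smul hc w).le
  have h₁ : ∀ w, N₁ (c • w) ≤ ‖c‖₊ * N₁ w := fun w => (hr₁.map_smul hc w).le
  conv_rhs => rw [interpNorm]
  simp only [ENNReal.mul_iInf_of_ne hc' enorm_ne_top]
  refine le_iInf₂ fun g hg => le_iInf fun hgx => ?_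
  have hcg := hg.map (c • LinearMap.id) (nnnorm_ne_zero_iff.2 hc) h₀ h₁
  have := interpNorm_le_normF (θ := θ) hcg
  rw [LinearMap.smul_apply, LinearMap.id_apply, hgx] at this
  refine this.trans (normF_le (fun t => (h₀ _).trans ?_) fun t => (h₁ _).trans ?_)
  · exact mul_le_mul_right (le_normF_left t) _
  · exact mul_le_mul_right (le_normF_right t) _

theorem interpNorm_smul (hr₀ : Represents N₀ ι₀) (hr₁ : Represents N₁ ι₁) {c : ℂ} (hc : c ≠ 0)
    (x : W) : interpNorm N₀ N₁ θ (c • x) = ‖c‖ₑ * interpNorm N₀ N₁ θ x := by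
  refine le_antisymm (interpNorm_smul_le hr₀ hr₁ hc x) ?_
  have := interpNorm_smul_le (θ := θ) hr₀ hr₁ (inv_ne_zero hc) (c • x)
  rw [smul_smul, inv_mul_cancel₀ hc, one_smul] at this
  calc _ ≤ ‖c‖ₑ * (‖c⁻¹‖ₑ * interpNorm N₀ N₁ θ (c • x)) := mul_le_mul_right this _
    _ = _ := by rw [← mul_assoc, ← enorm_mul, mul_inv_cancel₀ hc, enorm_one, one_mul]

end InterpNorm

/-! ### Positive weights, normalization and averages in `E`. -/

section Lattice

variable {𝕜 E : Type*} [RCLike 𝕜] [NormedAddCommGroup E] [NormedSpace 𝕜 E] [CompleteSpace E]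
  {e : UnconditionalSchauderBasis ℕ 𝕜 E}

/-- Adding a multiple of such a sequence makes all weights strictly positive at small cost in `E`.
-/
theorem exists_pos_summable_smul (e : UnconditionalSchauderBasis ℕ 𝕜 E) :
    ∃ ω : ℕ → ℝ, (∀ n, 0 < ω n) ∧ (Summable fun n => (ω n : 𝕜) • e n) ∧
      ‖∑' n, (ω n : 𝕜) • e n‖ ≤ 1 := by
  have he : ∀ n, 0 < ‖e n‖ := fun n => norm_pos_iff.2 (e.linearIndependent.ne_zero n)
  have hn : ∀ n, ‖((1 / 2 / 2 ^ n / ‖e n‖ : ℝ) : 𝕜) • e n‖ = 1 / 2 / 2 ^ n := fun n => by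
    have := he n
    rw [norm_smul, RCLike.norm_ofReal, abs_of_pos (by positivity), div_mul_cancel₀ _ this.ne']
  refine ⟨fun n => 1 / 2 / 2 ^ n / ‖e n‖, fun n => by have := he n; positivity, ?_, ?_⟩
  · refine Summable.of_norm ?_
    simp only [hn]
    exact (hasSum_geometric_two' 1).summable
  · exact tsum_of_norm_bounded (hasSum_geometric_two' 1) fun n => (hn n).le

theorem vecNorm_le_ofReal {W : Type*} {N : W → ℝ≥0∞} (he : IsOneUnconditional e) {p : ℝ}
    (hp : 0 < p) {b : ℕ → ℝ} (hb : ∀ n, 0 ≤ b n) (hbs : Summable fun n => (b n : 𝕜) • e n)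
    (hb1 : ‖∑' n, (b n : 𝕜) • e n‖ ≤ 1) {κ : ℝ} (hκ : 0 ≤ κ) {x : ℕ → W}
    (hx : ∀ n, N (x n) ≤ ENNReal.ofReal (κ * b n ^ (1 / p))) :
    vecNorm e p N x ≤ ENNReal.ofReal κ := by
  refine ENNReal.le_of_forall_pos_le_add fun ε hε _ => ?_
  have hpos : 0 < κ + ε := add_pos_of_nonneg_of_pos hκ hε
  calc vecNorm e p N x ≤ convexNorm e p (fun n => (κ + ε) * b n ^ (1 / p)) := by
        refine vecNorm_le_convexNorm he hp fun n => (hx n).trans (ENNReal.ofReal_le_ofReal ?_)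
        exact mul_le_mul_of_nonneg_right (by simp) (Real.rpow_nonneg (hb n) _)
    _ = ENNReal.ofReal (κ + ε) * ‖∑' n, (b n : 𝕜) • e n‖ₑ ^ (1 / p) :=
        convexNorm_mul_rpow_one_div hp hb hbs hpos
    _ ≤ ENNReal.ofReal (κ + ε) * 1 := by
        refine mul_le_mul_right (ENNReal.rpow_le_one ?_ (by positivity)) _
        rw [← ofReal_norm]
        exact ENNReal.ofReal_le_one.2 hb1
    _ = _ := by
        rw [mul_one, ENNReal.ofReal_add hκ ε.coe_nonneg, ENNReal.ofReal_coe_nnreal]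

theorem summable_of_vecNorm_le {W : Type*} {N : W → ℝ≥0∞} {p : ℝ} (hp : 0 < p) {x : ℕ → W} {K : ℝ}
    (hK : 0 < K) (hx : vecNorm e p N x ≤ ENNReal.ofReal K) :
    (Summable fun n => (((K⁻¹ * (N (x n)).toReal) ^ p : ℝ) : 𝕜) • e n) ∧
      ‖∑' n, (((K⁻¹ * (N (x n)).toReal) ^ p : ℝ) : 𝕜) • e n‖ ≤ 1 := by
  have hne : vecNorm e p N x ≠ ⊤ := ne_top_of_le_ne_top ENNReal.ofReal_ne_top hx
  rw [vecNorm_eq (vecNorm_ne_top hne)] at hx hne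
  have hc := convexNorm_const_mul (e := e) hp (inv_pos.2 hK) (fun n => (N (x n)).toReal)
  have hle : convexNorm e p (fun n => K⁻¹ * (N (x n)).toReal) ≤ 1 := by
    rw [hc]
    calc _ ≤ ENNReal.ofReal K⁻¹ * ENNReal.ofReal K := mul_le_mul_right hx _
      _ = 1 := by
        rw [← ENNReal.ofReal_mul (inv_pos.2 hK).le, inv_mul_cancel₀ hK.ne', ENNReal.ofReal_one]
  have habs : (fun n => ((|K⁻¹ * (N (x n)).toReal| ^ p : ℝ) : 𝕜) • e n) =
      fun n => (((K⁻¹ * (N (x n)).toReal) ^ p : ℝ) : 𝕜) • e n := by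
    funext n
    rw [abs_of_nonneg (mul_nonneg (inv_pos.2 hK).le ENNReal.toReal_nonneg)]
  have hs := (convexNorm_ne_top_iff hp).1 (ne_top_of_le_ne_top ENNReal.one_ne_top hle)
  rw [convexNorm_of_summable hs, habs] at hle
  rw [habs] at hs
  refine ⟨hs, ?_⟩
  have := (ENNReal.rpow_le_rpow_iff (z := 1 / p) (by positivity)).1
    (hle.trans_eq (ENNReal.one_rpow _).symm)
  rw [← ofReal_norm] at this
  exact ENNReal.ofReal_le_one.1 this

/-- Integrals of coordinate functions are the coordinates of a Bochner integral in `E`. -/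
theorem summable_integral_smul {α : Type*} [MeasurableSpace α] {μ : Measure α} {f : α → ℕ → ℝ}
    {w : α → ℝ} (hf : ∀ n, AEStronglyMeasurable (fun a => f a n) μ) (hw : Integrable w μ)
    (hs : ∀ᵐ a ∂μ, (Summable fun n => (f a n : 𝕜) • e n) ∧
      ‖∑' n, (f a n : 𝕜) • e n‖ ≤ w a) :
    (Summable fun n => ((∫ a, f a n ∂μ : ℝ) : 𝕜) • e n) ∧
      ‖∑' n, ((∫ a, f a n ∂μ : ℝ) : 𝕜) • e n‖ ≤ ∫ a, w a ∂μ := by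
  let _ : NormedSpace ℝ E := NormedSpace.restrictScalars ℝ 𝕜 E
  let F : α → E := fun a => ∑' n, (f a n : 𝕜) • e n
  have hFm : AEStronglyMeasurable F μ := by
    refine aestronglyMeasurable_of_tendsto_ae atTop
      (f := fun N a => ∑ n ∈ Finset.range N, (f a n : 𝕜) • e n) (fun N => ?_) ?_
    · refine Finset.aestronglyMeasurable_fun_sum _ fun n _ => ?_
      exact (RCLike.continuous_ofReal.comp_aestronglyMeasurable (hf n)).smul_const _
    · filter_upwards [hs] with a ha
      exact ha.1.hasSum.tendsto_sum_nat
  have hFi : Integrable F μ := hw.mono' hFm (hs.mono fun a ha => ha.2)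
  have hcoord : ∀ n, e.coord n (∫ a, F a ∂μ) = ((∫ a, f a n ∂μ : ℝ) : 𝕜) := by
    intro n
    rw [← ContinuousLinearMap.integral_comp_comm _ hFi, ← integral_ofReal]
    refine integral_congr_ae ?_
    filter_upwards [hs] with a ha
    exact coord_tsum ha.1 n
  -- Summability is free: the series is the basis expansion of the Bochner integral.
  have hexp := e.expansion (∫ a, F a ∂μ)
  simp only [hcoord] at hexp
  refine ⟨hexp.summable, ?_⟩
  rw [hexp.tsum_eq]
  exact norm_integral_le_of_norm_le hw (hs.mono fun a ha => ha.2)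

end Lattice

/-! ### The two inequalities and the derivation. -/

section VectorValued

variable {𝕜 E : Type*} [RCLike 𝕜] [NormedAddCommGroup E] [NormedSpace 𝕜 E] [CompleteSpace E]
  {e : UnconditionalSchauderBasis ℕ 𝕜 E}
  {W : Type*} [AddCommGroup W] [Module ℂ W] [TopologicalSpace W] [IsTopologicalAddGroup W]
  [ContinuousSMul ℂ W] [T2Space W]
  {X₀ X₁ : Type*} [NormedAddCommGroup X₀] [NormedSpace ℂ X₀]
  [NormedAddCommGroup X₁] [NormedSpace ℂ X₁] {j₀ : X₀ →L[ℂ] W} {j₁ : X₁ →L[ℂ] W}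
  {θ p₀ p₁ p : ℝ}

theorem vecNorm_interpNorm_le_of_normF_le (he : IsOneUnconditional e)
    (hj₀ : Function.Injective j₀) (hj₁ : Function.Injective j₁) (h0 : 0 < θ) (h1 : θ < 1)
    (hp₀ : 1 ≤ p₀) (hp₁ : 1 ≤ p₁) (hp : 0 < p) (hpp : 1 / p = (1 - θ) / p₀ + θ / p₁)
    {g : ℂ → ℕ → W} (hg : MemF (vecNorm e p₀ (embNorm j₀)) (vecNorm e p₁ (embNorm j₁)) g) {K : ℝ}
    (hK : 0 < K)
    (hgK : normF (vecNorm e p₀ (embNorm j₀)) (vecNorm e p₁ (embNorm j₁)) g ≤ ENNReal.ofReal K) :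
    vecNorm e p (interpNorm (embNorm j₀) (embNorm j₁) θ) (g θ) ≤ ENNReal.ofReal K := by
  obtain ⟨V, _, _, ι, hr⟩ := exists_represents_sumNorm j₀ j₁ hj₀ hj₁
  have hr₀ := represents_embNorm j₀ hj₀
  have hr₁ := represents_embNorm j₁ hj₁
  have hp₀' : 0 < p₀ := by linarith
  have hp₁' : 0 < p₁ := by linarith
  have hKc : ((K⁻¹ : ℝ) : ℂ) ≠ 0 := by exact_mod_cast (inv_pos.2 hK).ne'
  have hKn : ‖((K⁻¹ : ℝ) : ℂ)‖ₑ = ENNReal.ofReal K⁻¹ := by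
    rw [← ofReal_norm, Complex.norm_real, Real.norm_of_nonneg (inv_pos.2 hK).le]
  -- The exponents on the two lines differ, so the averaged estimate is not homogeneous. After
  -- normalization every boundary vector of `p_j`-th powers lies in the unit ball of `E`.
  let h : ℕ → ℂ → W := fun n z => ((K⁻¹ : ℝ) : ℂ) • g z n
  have hh : ∀ n, MemF (embNorm j₀) (embNorm j₁) (h n) := by
    intro n
    obtain ⟨C₀, hC₀⟩ := exists_le_mul_vecNorm he hp₀' (embNorm j₀) n
    obtain ⟨C₁, hC₁⟩ := exists_le_mul_vecNorm he hp₁' (embNorm j₁) n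
    have haux : ∀ {C : ℝ≥0} {y y' : ℝ≥0∞}, y ≤ C * y' → C ≤ max (max C₀ C₁) 1 →
        ENNReal.ofReal K⁻¹ * y ≤ ((K⁻¹).toNNReal * max (max C₀ C₁) 1 : ℝ≥0) * y' := by
      intro C y y' hy hC
      rw [ENNReal.coe_mul, mul_assoc]
      refine mul_le_mul_right (hy.trans (mul_le_mul_left ?_ _)) _
      exact_mod_cast hC
    refine hg.map (((K⁻¹ : ℝ) : ℂ) • LinearMap.proj n)
      (C := (K⁻¹).toNNReal * max (max C₀ C₁) 1) ?_ (fun x => ?_) (fun x => ?_)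
    · refine mul_ne_zero ?_ (lt_of_lt_of_le zero_lt_one (le_max_right _ _)).ne'
      simpa using hK
    · change embNorm j₀ (((K⁻¹ : ℝ) : ℂ) • x n) ≤ _
      rw [hr₀.map_smul hKc, hKn]
      exact haux (hC₀ x) (by simp)
    · change embNorm j₁ (((K⁻¹ : ℝ) : ℂ) • x n) ≤ _
      rw [hr₁.map_smul hKc, hKn]
      exact haux (hC₁ x) (by simp)
  set w : ℝ → ℝ := fun s => if θ < s then p / p₀ else p / p₁ with hw
  set q : ℝ → ℝ := fun s => if θ < s then p₀ else p₁ with hq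
  have hw0 : ∀ s, 0 ≤ w s := fun s => by simp only [hw]; split_ifs <;> positivity
  have hq0 : ∀ s, 0 < q s := fun s => by simp only [hq]; split_ifs <;> assumption
  have hwc : ContinuousOn w (boundaryParam θ) :=
    continuousOn_ite_boundaryParam continuousOn_const continuousOn_const
  have hqc : ContinuousOn q (boundaryParam θ) :=
    continuousOn_ite_boundaryParam continuousOn_const continuousOn_const
  have hwi : IntegrableOn w (boundaryParam θ) := integrableOn_boundaryParam h0 h1 hwc
    (C := max (p / p₀) (p / p₁)) fun s => by
      rw [abs_of_nonneg (hw0 s)]; simp only [hw]; split_ifs <;> simp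
  have hwint : ∫ s in boundaryParam θ, w s = 1 := by
    rw [integral_ite_boundaryParam h0 h1]
    have : (1 - θ) * (p / p₀) + θ * (p / p₁) = p * ((1 - θ) / p₀ + θ / p₁) := by ring
    rw [this, ← hpp, mul_one_div_cancel hp.ne']
  let f : ℝ → ℕ → ℝ := fun s n =>
    w s * (boundaryNorm (embNorm j₀) (embNorm j₁) θ (h n) s).toReal ^ q s
  have hfc : ∀ n, ContinuousOn (fun s => f s n) (boundaryParam θ) := fun n =>
    hwc.mul ((continuousOn_boundaryNorm h0 h1 hr₀ hr₁ (hh n)).rpow hqc fun s _ => Or.inr (hq0 s))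
  have hpt : ∀ s, (Summable fun n => (f s n : 𝕜) • e n) ∧ ‖∑' n, (f s n : 𝕜) • e n‖ ≤ w s := by
    intro s
    have key : (Summable fun n => (((boundaryNorm (embNorm j₀) (embNorm j₁) θ (h n) s).toReal ^ q s
          : ℝ) : 𝕜) • e n) ∧
        ‖∑' n, (((boundaryNorm (embNorm j₀) (embNorm j₁) θ (h n) s).toReal ^ q s : ℝ) : 𝕜) • e n‖
          ≤ 1 := by
      simp only [boundaryNorm, hq, h]
      split_ifs
      · simp only [hr₀.map_smul hKc, hKn, ENNReal.toReal_mul,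
          ENNReal.toReal_ofReal (inv_pos.2 hK).le]
        exact summable_of_vecNorm_le hp₀' hK ((le_normF_left _).trans hgK)
      · simp only [hr₁.map_smul hKc, hKn, ENNReal.toReal_mul,
          ENNReal.toReal_ofReal (inv_pos.2 hK).le]
        exact summable_of_vecNorm_le hp₁' hK ((le_normF_right _).trans hgK)
    have heq : (fun n => (f s n : 𝕜) • e n) = fun n => (w s : 𝕜) •
        ((((boundaryNorm (embNorm j₀) (embNorm j₁) θ (h n) s).toReal ^ q s : ℝ) : 𝕜) • e n) := by
      funext n
      rw [smul_smul, ← RCLike.ofReal_mul]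
    rw [heq]
    refine ⟨key.1.const_smul _, ?_⟩
    rw [tsum_const_smul'', norm_smul, RCLike.norm_ofReal, abs_of_nonneg (hw0 s)]
    exact mul_le_of_le_one_right (hw0 s) key.2
  -- The average of these vectors has norm at most `∫ w = 1`, and it dominates the `p`-th powers of
  -- the interpolation norms coordinatewise.
  obtain ⟨hsum, hnorm⟩ := summable_integral_smul (𝕜 := 𝕜) (e := e)
    (μ := volume.restrict (boundaryParam θ))
    (fun n => (hfc n).aestronglyMeasurable measurableSet_boundaryParam) hwi
    (Eventually.of_forall hpt)
  rw [hwint] at hnorm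
  have hb0 : ∀ n, 0 ≤ (interpNorm (embNorm j₀) (embNorm j₁) θ (h n θ)).toReal ^ p :=
    fun n => Real.rpow_nonneg ENNReal.toReal_nonneg _
  have hb : ∀ n, (interpNorm (embNorm j₀) (embNorm j₁) θ (h n θ)).toReal ^ p ≤
      ∫ s in boundaryParam θ, f s n := fun n =>
    rpow_interpNorm_le_integral h0 h1 hr hr₀ hr₁ (hh n) hp₀ hp₁ hp hpp
  refine vecNorm_le_ofReal he hp hb0 (summable_of_le he hb0 hb hsum)
    ((norm_tsum_le_norm_tsum he hb0 hb hsum).trans hnorm) hK.le fun n => ?_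
  have hfin : interpNorm (embNorm j₀) (embNorm j₁) θ (h n θ) ≠ ⊤ :=
    ne_top_of_le_ne_top (hh n).normF_ne_top (interpNorm_le_normF (hh n))
  rw [← Real.rpow_mul ENNReal.toReal_nonneg, mul_one_div_cancel hp.ne', Real.rpow_one,
    ENNReal.ofReal_mul hK.le, ENNReal.ofReal_toReal hfin, interpNorm_smul hr₀ hr₁ hKc, hKn,
    ← mul_assoc, ← ENNReal.ofReal_mul hK.le, mul_inv_cancel₀ hK.ne', ENNReal.ofReal_one, one_mul]

theorem vecNorm_interpNorm_le (he : IsOneUnconditional e)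
    (hj₀ : Function.Injective j₀) (hj₁ : Function.Injective j₁) (h0 : 0 < θ) (h1 : θ < 1)
    (hp₀ : 1 ≤ p₀) (hp₁ : 1 ≤ p₁) (hp : 0 < p) (hpp : 1 / p = (1 - θ) / p₀ + θ / p₁)
    (a : ℕ → W) : vecNorm e p (interpNorm (embNorm j₀) (embNorm j₁) θ) a ≤
      interpNorm (vecNorm e p₀ (embNorm j₀)) (vecNorm e p₁ (embNorm j₁)) θ a := by
  refine le_iInf₂ fun g hg => le_iInf fun hga => ?_
  subst hga
  refine ENNReal.le_of_forall_pos_le_add fun ε hε _ => ?_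
  have hfin := hg.normF_ne_top
  have hK : normF (vecNorm e p₀ (embNorm j₀)) (vecNorm e p₁ (embNorm j₁)) g + ε =
      ENNReal.ofReal ((normF (vecNorm e p₀ (embNorm j₀)) (vecNorm e p₁ (embNorm j₁)) g).toReal + ε)
      := by
    rw [ENNReal.ofReal_add ENNReal.toReal_nonneg ε.coe_nonneg, ENNReal.ofReal_toReal hfin,
      ENNReal.ofReal_coe_nnreal]
  rw [hK]
  refine vecNorm_interpNorm_le_of_normF_le he hj₀ hj₁ h0 h1 hp₀ hp₁ hp hpp hg ?_ ?_
  · exact add_pos_of_nonneg_of_pos ENNReal.toReal_nonneg hε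
  · rw [← hK]; exact le_self_add

/-- The scalar factor by which the `n`-th coordinate of an extremal function is multiplied; `r` is
the relative size of this coordinate. -/
noncomputable def interpFactor (p₀ p₁ p r : ℝ) (z : ℂ) : ℂ :=
  exp ((Real.log r : ℂ) * (p / p₀ * (1 - z) + p / p₁ * z - 1))

theorem interpFactor_ne_zero (r : ℝ) (z : ℂ) : interpFactor p₀ p₁ p r z ≠ 0 :=
  Complex.exp_ne_zero _

theorem interpFactor_self (hp : 0 < p) (hpp : 1 / p = (1 - θ) / p₀ + θ / p₁) (r : ℝ) :
    interpFactor p₀ p₁ p r θ = 1 := by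
  have : p / p₀ * (1 - θ) + p / p₁ * θ - 1 = 0 := by
    have : p / p₀ * (1 - θ) + p / p₁ * θ = p * ((1 - θ) / p₀ + θ / p₁) := by ring
    rw [this, ← hpp, mul_one_div_cancel hp.ne', sub_self]
  have h' : (p / p₀ * (1 - θ) + p / p₁ * θ - 1 : ℂ) = 0 := by exact_mod_cast this
  rw [interpFactor, h', mul_zero, Complex.exp_zero]

theorem hasDerivAt_interpFactor (r : ℝ) (z : ℂ) : HasDerivAt (interpFactor p₀ p₁ p r)
    (interpFactor p₀ p₁ p r z * (Real.log r * (p / p₁ - p / p₀))) z := by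
  have h1 : HasDerivAt (fun z : ℂ => (Real.log r : ℂ) * (p / p₀ * (1 - z) + p / p₁ * z - 1))
      (Real.log r * (p / p₁ - p / p₀)) z := by
    have := (((((hasDerivAt_id z).const_sub 1).const_mul (p / p₀ : ℂ)).add
      ((hasDerivAt_id z).const_mul (p / p₁ : ℂ))).sub_const 1).const_mul (Real.log r : ℂ)
    convert! this using 1
    ring
  exact h1.cexp

theorem norm_interpFactor (r : ℝ) (z : ℂ) : ‖interpFactor p₀ p₁ p r z‖ =
    Real.exp (Real.log r * (p / p₀ * (1 - z.re) + p / p₁ * z.re - 1)) := by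
  rw [interpFactor, Complex.norm_exp, re_ofReal_mul]
  congr 2
  have e1 : (p / p₀ : ℂ) = ((p / p₀ : ℝ) : ℂ) := by push_cast; rfl
  have e2 : (p / p₁ : ℂ) = ((p / p₁ : ℝ) : ℂ) := by push_cast; rfl
  rw [sub_re, add_re, e1, e2, re_ofReal_mul, re_ofReal_mul, sub_re, one_re]

/-- With `r = c / M > 0` this is the identity `r ^ (p / q - 1) * c = M * r ^ (p / q)`. For `c = 0`
the left side is `0`, whatever value `log 0` has. -/
theorem exp_log_mul_mul_le {q c M : ℝ} (hc : 0 ≤ c) (hM : 0 ≤ M)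
    (hcM : M = 0 → c = 0) :
    Real.exp (Real.log (c / M) * (p / q - 1)) * c ≤ M * ((c / M) ^ p) ^ (1 / q) := by
  rcases hc.eq_or_lt with h | h
  · rw [← h, mul_zero]; positivity
  have hM' : 0 < M := lt_of_le_of_ne hM fun h' => h.ne' (hcM h'.symm)
  have hr : 0 < c / M := by positivity
  rw [← Real.rpow_def_of_pos hr, ← Real.rpow_mul hr.le, Real.rpow_sub hr, Real.rpow_one,
    mul_one_div]
  refine le_of_eq ?_
  field_simp

/-- On the line `Re z = j` the `n`-th coordinate is at most `K * M * b n ^ (1 / p_j)` with `b n = (c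
n / M) ^ p`, and `∑ b n • e n` lies in the unit ball. A vanishing `c n` does no harm: the factor is
then constantly `1`, and `H n` vanishes on the boundary. -/
theorem memF_interpFactor (he : IsOneUnconditional e)
    (hj₀ : Function.Injective j₀) (hj₁ : Function.Injective j₁) (h0 : 0 < θ) (h1 : θ < 1)
    (hp₀ : 1 ≤ p₀) (hp₁ : 1 ≤ p₁) (hp : 0 < p) (hpp : 1 / p = (1 - θ) / p₀ + θ / p₁)
    {c : ℕ → ℝ} (hc : ∀ n, 0 ≤ c n) (hcs : Summable fun n => ((c n ^ p : ℝ) : 𝕜) • e n) {M : ℝ}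
    (hM0 : 0 ≤ M) (hM : M ^ p = ‖∑' n, ((c n ^ p : ℝ) : 𝕜) • e n‖)
    {H : ℕ → ℂ → W} (hH : ∀ n, MemF (embNorm j₀) (embNorm j₁) (H n)) {K : ℝ≥0}
    (hHK : ∀ n, normF (embNorm j₀) (embNorm j₁) (H n) ≤ K * ENNReal.ofReal (c n)) :
    MemF (vecNorm e p₀ (embNorm j₀)) (vecNorm e p₁ (embNorm j₁))
      (fun z n => interpFactor p₀ p₁ p (c n / M) z • H n z) ∧
    normF (vecNorm e p₀ (embNorm j₀)) (vecNorm e p₁ (embNorm j₁))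
      (fun z n => interpFactor p₀ p₁ p (c n / M) z • H n z) ≤ K * ENNReal.ofReal M ∧
    ∀ d : ℕ → W, (∀ n, HasSumDerivAt (embNorm j₀) (embNorm j₁) (H n) (d n) θ) →
      HasSumDerivAt (vecNorm e p₀ (embNorm j₀)) (vecNorm e p₁ (embNorm j₁))
        (fun z n => interpFactor p₀ p₁ p (c n / M) z • H n z)
        (fun n => (((p / p₁ - p / p₀) * Real.log (c n / M) : ℝ) : ℂ) • H n θ + d n) θ := by
  obtain ⟨V, _, _, ι, hr⟩ := exists_represents_sumNorm j₀ j₁ hj₀ hj₁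
  have hr₀ := represents_embNorm j₀ hj₀
  have hr₁ := represents_embNorm j₁ hj₁
  have hp₀' : 0 < p₀ := by linarith
  have hp₁' : 0 < p₁ := by linarith
  have hθ := ofReal_mem_verticalStrip h0 h1
  have hcM : ∀ n, M = 0 → c n = 0 := by
    intro n hMz
    have := norm_smul_le_norm_tsum he (fun n => Real.rpow_nonneg (hc n) p) hcs n
    rw [← hM, hMz, Real.zero_rpow hp.ne', norm_le_zero_iff, smul_eq_zero] at this
    have h2 := this.resolve_right (e.linearIndependent.ne_zero n)
    exact (Real.rpow_eq_zero (hc n) hp.ne').1 (by exact_mod_cast h2)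
  set b : ℕ → ℝ := fun n => (c n / M) ^ p with hb
  have hb0 : ∀ n, 0 ≤ b n := fun n => Real.rpow_nonneg (div_nonneg (hc n) hM0) _
  have hbeq : (fun n => (b n : 𝕜) • e n) =
      fun n => (((M ^ p)⁻¹ : ℝ) : 𝕜) • (((c n ^ p : ℝ) : 𝕜) • e n) := by
    funext n
    rw [smul_smul, ← RCLike.ofReal_mul, hb]
    simp only [Real.div_rpow (hc n) hM0]
    rw [div_eq_inv_mul]
  have hbs : Summable fun n => (b n : 𝕜) • e n := by rw [hbeq]; exact hcs.const_smul _
  have hb1 : ‖∑' n, (b n : 𝕜) • e n‖ ≤ 1 := by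
    have hMp : 0 ≤ M ^ p := Real.rpow_nonneg hM0 _
    rw [hbeq, tsum_const_smul'', norm_smul, RCLike.norm_ofReal, abs_of_nonneg (inv_nonneg.2 hMp),
      ← hM]
    exact inv_mul_le_one
  have hbd₀ : ∀ n, ∀ t : ℝ,
      embNorm j₀ (interpFactor p₀ p₁ p (c n / M) (t * I) • H n (t * I)) ≤
        ENNReal.ofReal (K * M * b n ^ (1 / p₀)) := by
    intro n t
    rw [hr₀.map_smul (interpFactor_ne_zero _ _), ← ofReal_norm, norm_interpFactor]
    refine (mul_le_mul_right ((le_normF_left t).trans (hHK n)) _).trans ?_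
    rw [mul_left_comm, ← ENNReal.ofReal_mul (Real.exp_pos _).le, mul_assoc (K : ℝ),
      ENNReal.ofReal_mul K.coe_nonneg, ENNReal.ofReal_coe_nnreal]
    refine mul_le_mul_right (ENNReal.ofReal_le_ofReal ?_) _
    have := exp_log_mul_mul_le (p := p) (q := p₀) (hc n) hM0 (hcM n)
    simpa using this
  have hbd₁ : ∀ n, ∀ t : ℝ,
      embNorm j₁ (interpFactor p₀ p₁ p (c n / M) (1 + t * I) • H n (1 + t * I)) ≤
        ENNReal.ofReal (K * M * b n ^ (1 / p₁)) := by
    intro n t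
    rw [hr₁.map_smul (interpFactor_ne_zero _ _), ← ofReal_norm, norm_interpFactor]
    refine (mul_le_mul_right ((le_normF_right t).trans (hHK n)) _).trans ?_
    rw [mul_left_comm, ← ENNReal.ofReal_mul (Real.exp_pos _).le, mul_assoc (K : ℝ),
      ENNReal.ofReal_mul K.coe_nonneg, ENNReal.ofReal_coe_nnreal]
    refine mul_le_mul_right (ENNReal.ofReal_le_ofReal ?_) _
    have := exp_log_mul_mul_le (p := p) (q := p₁) (hc n) hM0 (hcM n)
    simpa using this
  have hKM : ((K : ℝ≥0∞) * ENNReal.ofReal M) = ENNReal.ofReal (K * M) := by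
    rw [ENNReal.ofReal_mul K.coe_nonneg, ENNReal.ofReal_coe_nnreal]
  have hKM0 : 0 ≤ (K : ℝ) * M := mul_nonneg K.coe_nonneg hM0
  have hmem : ∀ n, MemF (embNorm j₀) (embNorm j₁)
      (fun z => interpFactor p₀ p₁ p (c n / M) z • H n z) := by
    intro n
    have hd : Differentiable ℂ (interpFactor p₀ p₁ p (c n / M)) := fun z =>
      (hasDerivAt_interpFactor _ z).differentiableAt
    refine (hH n).smul hr hr₀ hr₁ hd.continuous.continuousOn hd.differentiableOn ?_
    obtain ⟨D, hD⟩ := (isCompact_Icc (a := (0 : ℝ)) (b := 1)).exists_bound_of_continuousOn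
      (f := fun x : ℝ => Real.exp (Real.log (c n / M) * (p / p₀ * (1 - x) + p / p₁ * x - 1)))
      (by fun_prop)
    refine ⟨D, fun z hz => ?_⟩
    rw [norm_interpFactor]
    exact (le_abs_self _).trans (hD z.re hz)
  obtain ⟨ω, hω0, hωs, -⟩ := exists_pos_summable_smul e
  -- The assembly lemma dilates by powers of its weights, so they must not vanish. The perturbed
  -- weights serve only for membership and the derivative; the sharp norm bound uses `b` itself.
  have hpos : ∀ n, 0 < b n + ω n := fun n => add_pos_of_nonneg_of_pos (hb0 n) (hω0 n)
  have hsum : Summable fun n => ((b n + ω n : ℝ) : 𝕜) • e n := by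
    simpa only [RCLike.ofReal_add, add_smul] using hbs.add hωs
  have haux : ∀ q : ℝ, 0 < q → ∀ n, ENNReal.ofReal (K * M * b n ^ (1 / q)) ≤
      ((K * M.toNNReal : ℝ≥0) : ℝ≥0∞) * ENNReal.ofReal ((b n + ω n) ^ (1 / q)) := by
    intro q hq n
    rw [ENNReal.coe_mul]
    change _ ≤ (K : ℝ≥0∞) * ENNReal.ofReal M * _
    rw [hKM, ← ENNReal.ofReal_mul hKM0]
    refine ENNReal.ofReal_le_ofReal (mul_le_mul_of_nonneg_left ?_ hKM0)
    exact Real.rpow_le_rpow (hb0 n) (by linarith [hω0 n]) (by positivity)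
  obtain ⟨hF, hderiv⟩ := memF_vecNorm he hj₀ hj₁ hp₀' hp₁' hpos hsum hmem
    (fun n t => (hbd₀ n t).trans (haux p₀ hp₀' n)) (fun n t => (hbd₁ n t).trans (haux p₁ hp₁' n))
  refine ⟨hF, ?_, fun d hd => hderiv θ hθ _ fun n => ?_⟩
  · rw [hKM]
    exact normF_le (fun t => vecNorm_le_ofReal he hp₀' hb0 hbs hb1 hKM0 fun n => hbd₀ n t)
      (fun t => vecNorm_le_ofReal he hp₁' hb0 hbs hb1 hKM0 fun n => hbd₁ n t)
  · have := HasSumDerivAt.smul hr hr₀ hr₁ (hH n) hθ (hd n)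
      (hasDerivAt_interpFactor (p₀ := p₀) (p₁ := p₁) (p := p) (c n / M) θ)
    rw [interpFactor_self hp hpp, one_mul, one_smul] at this
    convert! this using 3
    push_cast; ring

theorem interpNorm_le_vecNorm (he : IsOneUnconditional e)
    (hj₀ : Function.Injective j₀) (hj₁ : Function.Injective j₁) (h0 : 0 < θ) (h1 : θ < 1)
    (hp₀ : 1 ≤ p₀) (hp₁ : 1 ≤ p₁) (hp : 0 < p) (hpp : 1 / p = (1 - θ) / p₀ + θ / p₁)
    (a : ℕ → W) : interpNorm (vecNorm e p₀ (embNorm j₀)) (vecNorm e p₁ (embNorm j₁)) θ a ≤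
      vecNorm e p (interpNorm (embNorm j₀) (embNorm j₁) θ) a := by
  by_cases ha : vecNorm e p (interpNorm (embNorm j₀) (embNorm j₁) θ) a = ⊤
  · simp [ha]
  have hfin := vecNorm_ne_top ha
  rw [vecNorm_eq hfin] at ha ⊢
  have hs := (convexNorm_ne_top_iff hp).1 ha
  rw [convexNorm_of_summable hs]
  simp only [abs_of_nonneg ENNReal.toReal_nonneg] at hs ⊢
  set t : ℕ → ℝ := fun n => (interpNorm (embNorm j₀) (embNorm j₁) θ (a n)).toReal with ht
  have ht0 : ∀ n, 0 ≤ t n := fun n => ENNReal.toReal_nonneg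
  obtain ⟨ω, hω0, hωs, hω1⟩ := exists_pos_summable_smul e
  set S : ℝ := ‖∑' n, ((t n ^ p : ℝ) : 𝕜) • e n‖ with hS
  have main : ∀ ε : ℝ, 0 < ε →
      interpNorm (vecNorm e p₀ (embNorm j₀)) (vecNorm e p₁ (embNorm j₁)) θ a ≤
        ENNReal.ofReal ((S + ε) ^ (1 / p)) := by
    intro ε hε
    have hpos : ∀ n, 0 < t n ^ p + ε * ω n := fun n =>
      add_pos_of_nonneg_of_pos (Real.rpow_nonneg (ht0 n) _) (mul_pos hε (hω0 n))
    -- Each `c n` strictly exceeds `t n`, which allows a near-optimal choice in every coordinate,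
    -- while the total error in `E` is at most `ε`.
    set c : ℕ → ℝ := fun n => (t n ^ p + ε * ω n) ^ (1 / p) with hc
    have hc0 : ∀ n, 0 < c n := fun n => Real.rpow_pos_of_pos (hpos n) _
    have hcp : ∀ n, c n ^ p = t n ^ p + ε * ω n := fun n => by
      rw [hc, ← Real.rpow_mul (hpos n).le, one_div_mul_cancel hp.ne', Real.rpow_one]
    have htc : ∀ n, t n < c n := by
      intro n
      rw [← Real.rpow_lt_rpow_iff (ht0 n) (hc0 n).le hp, hcp]
      linarith [mul_pos hε (hω0 n)]
    have heq : (fun n => ((c n ^ p : ℝ) : 𝕜) • e n) = fun n =>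
        ((t n ^ p : ℝ) : 𝕜) • e n + (ε : 𝕜) • ((ω n : 𝕜) • e n) := by
      funext n
      rw [hcp, smul_smul, ← RCLike.ofReal_mul, ← add_smul, ← RCLike.ofReal_add]
    have hcs : Summable fun n => ((c n ^ p : ℝ) : 𝕜) • e n := by
      rw [heq]; exact hs.add (hωs.const_smul _)
    have hcn : ‖∑' n, ((c n ^ p : ℝ) : 𝕜) • e n‖ ≤ S + ε := by
      rw [heq, hs.tsum_add (hωs.const_smul _), tsum_const_smul'']
      refine (norm_add_le _ _).trans (add_le_add_right ?_ _)
      rw [norm_smul, RCLike.norm_ofReal, abs_of_pos hε]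
      exact mul_le_of_le_one_right hε.le hω1
    have hex : ∀ n, ∃ g, g θ = a n ∧ MemF (embNorm j₀) (embNorm j₁) g ∧
        normF (embNorm j₀) (embNorm j₁) g < ENNReal.ofReal (c n) := fun n =>
      exists_of_interpNorm_lt (by
        rw [← ENNReal.ofReal_toReal (hfin n)]
        exact (ENNReal.ofReal_lt_ofReal_iff (hc0 n)).2 (htc n))
    choose H hHθ hH hHc using hex
    set M : ℝ := ‖∑' n, ((c n ^ p : ℝ) : 𝕜) • e n‖ ^ (1 / p) with hMdef
    have hM0 : 0 ≤ M := Real.rpow_nonneg (norm_nonneg _) _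
    have hM : M ^ p = ‖∑' n, ((c n ^ p : ℝ) : 𝕜) • e n‖ := by
      rw [hMdef, ← Real.rpow_mul (norm_nonneg _), one_div_mul_cancel hp.ne', Real.rpow_one]
    obtain ⟨hF, hFn, -⟩ := memF_interpFactor he hj₀ hj₁ h0 h1 hp₀ hp₁ hp hpp (fun n => (hc0 n).le)
      hcs hM0 hM hH (K := 1) (fun n => by simpa using (hHc n).le)
    have hi := interpNorm_le_normF (θ := θ) hF
    simp only [interpFactor_self hp hpp, one_smul, hHθ] at hi
    refine hi.trans (hFn.trans ?_)
    rw [ENNReal.coe_one, one_mul]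
    exact ENNReal.ofReal_le_ofReal (Real.rpow_le_rpow (norm_nonneg _) hcn (by positivity))
  have hlim : Tendsto (fun ε : ℝ => ENNReal.ofReal ((S + ε) ^ (1 / p))) (𝓝[>] 0)
      (𝓝 (ENNReal.ofReal (S ^ (1 / p)))) := by
    have hcont : Continuous fun ε : ℝ => ENNReal.ofReal ((S + ε) ^ (1 / p)) :=
      ENNReal.continuous_ofReal.comp ((continuous_const.add continuous_id).rpow_const
        fun _ => Or.inr (by positivity))
    have := (hcont.tendsto 0).mono_left (nhdsWithin_le_nhds (s := Ioi 0))
    simpa using this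
  have := ge_of_tendsto hlim (by filter_upwards [self_mem_nhdsWithin] with ε hε using main ε hε)
  rwa [← ENNReal.ofReal_rpow_of_nonneg (norm_nonneg _) (by positivity), ofReal_norm] at this

theorem interpNorm_vecNorm (he : IsOneUnconditional e)
    (hj₀ : Function.Injective j₀) (hj₁ : Function.Injective j₁) (h0 : 0 < θ) (h1 : θ < 1)
    (hp₀ : 1 ≤ p₀) (hp₁ : 1 ≤ p₁) (hp : 0 < p) (hpp : 1 / p = (1 - θ) / p₀ + θ / p₁) :
    interpNorm (vecNorm e p₀ (embNorm j₀)) (vecNorm e p₁ (embNorm j₁)) θ =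
      vecNorm e p (interpNorm (embNorm j₀) (embNorm j₁) θ) :=
  funext fun a => le_antisymm (interpNorm_le_vecNorm he hj₀ hj₁ h0 h1 hp₀ hp₁ hp hpp a)
    (vecNorm_interpNorm_le he hj₀ hj₁ h0 h1 hp₀ hp₁ hp hpp a)

theorem vecNorm_interpNorm_smul (hj₀ : Function.Injective j₀) (hj₁ : Function.Injective j₁)
    (hp : 0 < p) {a : ℕ → W} (ha : vecNorm e p (interpNorm (embNorm j₀) (embNorm j₁) θ) a ≠ ⊤)
    {c : ℂ} (hc : c ≠ 0) : vecNorm e p (interpNorm (embNorm j₀) (embNorm j₁) θ) (c • a) =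
      ‖c‖ₑ * vecNorm e p (interpNorm (embNorm j₀) (embNorm j₁) θ) a := by
  have hr₀ := represents_embNorm j₀ hj₀
  have hr₁ := represents_embNorm j₁ hj₁
  have hfin := vecNorm_ne_top ha
  have hsm : ∀ n, interpNorm (embNorm j₀) (embNorm j₁) θ ((c • a) n) =
      ‖c‖ₑ * interpNorm (embNorm j₀) (embNorm j₁) θ (a n) := fun n =>
    interpNorm_smul hr₀ hr₁ hc (a n)
  rw [vecNorm_eq hfin, vecNorm_eq fun n => by
    rw [hsm]; exact ENNReal.mul_ne_top enorm_ne_top (hfin n)]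
  simp only [hsm, ENNReal.toReal_mul, toReal_enorm]
  rw [convexNorm_const_mul hp (norm_pos_iff.2 hc), ofReal_norm]

/-- The selection multiplies `B (a n)` by the factor for the ratio `‖a n‖ / ‖a‖`. This ratio is
unchanged when `a` is multiplied by a nonzero scalar, so homogeneity is inherited from `B`. -/
theorem isDerivation_vecNorm (he : IsOneUnconditional e)
    (hj₀ : Function.Injective j₀) (hj₁ : Function.Injective j₁) (h0 : 0 < θ) (h1 : θ < 1)
    (hp₀ : 1 ≤ p₀) (hp₁ : 1 ≤ p₁) (hp : 0 < p) (hpp : 1 / p = (1 - θ) / p₀ + θ / p₁)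
    {Ω : W → W} (hΩ : IsDerivation (embNorm j₀) (embNorm j₁) θ Ω) :
    IsDerivation (vecNorm e p₀ (embNorm j₀)) (vecNorm e p₁ (embNorm j₁)) θ fun a n =>
      (((p / p₁ - p / p₀) * Real.log ((interpNorm (embNorm j₀) (embNorm j₁) θ (a n)).toReal /
        (vecNorm e p (interpNorm (embNorm j₀) (embNorm j₁) θ) a).toReal) : ℝ) : ℂ) • a n +
      Ω (a n) := by
  obtain ⟨B, hB, hBΩ⟩ := hΩ
  obtain ⟨C, hC⟩ := hB.bounded
  have hr₀ := represents_embNorm j₀ hj₀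
  have hr₁ := represents_embNorm j₁ hj₁
  set Nθ := interpNorm (embNorm j₀) (embNorm j₁) θ with hNθ
  have heq := interpNorm_vecNorm he hj₀ hj₁ h0 h1 hp₀ hp₁ hp hpp
  have key : ∀ a, vecNorm e p Nθ a ≠ ⊤ → _ := fun a ha =>
    have hfin := vecNorm_ne_top ha
    have hs : Summable fun n => (((Nθ (a n)).toReal ^ p : ℝ) : 𝕜) • e n := by
      rw [vecNorm_eq hfin, convexNorm_ne_top_iff hp] at ha
      simpa only [abs_of_nonneg ENNReal.toReal_nonneg] using ha
    have hM : (vecNorm e p Nθ a).toReal ^ p =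
        ‖∑' n, (((Nθ (a n)).toReal ^ p : ℝ) : 𝕜) • e n‖ := by
      rw [vecNorm_eq hfin, convexNorm_of_summable
        (by simpa only [abs_of_nonneg ENNReal.toReal_nonneg] using hs)]
      simp only [abs_of_nonneg ENNReal.toReal_nonneg]
      rw [← ENNReal.toReal_rpow, toReal_enorm, ← Real.rpow_mul (norm_nonneg _),
        one_div_mul_cancel hp.ne', Real.rpow_one]
    memF_interpFactor he hj₀ hj₁ h0 h1 hp₀ hp₁ hp hpp (c := fun n => (Nθ (a n)).toReal)
      (fun n => ENNReal.toReal_nonneg) hs ENNReal.toReal_nonneg hM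
      (fun n => hB.mem (a n) (hfin n)) (K := C)
      (fun n => by rw [ENNReal.ofReal_toReal (hfin n)]; exact hC (a n) (hfin n))
  refine ⟨fun a z n => interpFactor p₀ p₁ p ((Nθ (a n)).toReal / (vecNorm e p Nθ a).toReal) z •
    B (a n) z, ⟨?_, ?_, ?_, ?_⟩, ?_⟩
  · intro a ha
    rw [heq] at ha
    exact (key a ha).1
  · intro a ha
    rw [heq] at ha
    funext n
    rw [interpFactor_self hp hpp, one_smul, hB.eval _ (vecNorm_ne_top ha n)]
  · intro c a ha z hz
    rw [heq] at ha
    have hfin := vecNorm_ne_top ha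
    funext n
    rw [Pi.smul_apply, Pi.smul_apply, hB.homogeneous c (a n) (hfin n) z hz]
    by_cases hc : c = 0
    · simp [hc]
    rw [vecNorm_interpNorm_smul hj₀ hj₁ hp ha hc, hNθ, interpNorm_smul hr₀ hr₁ hc,
      ENNReal.toReal_mul, ENNReal.toReal_mul, mul_div_mul_left, smul_comm]
    simpa using hc
  · refine ⟨C, fun a ha => ?_⟩
    rw [heq] at ha ⊢
    have := (key a ha).2.1
    rwa [ENNReal.ofReal_toReal ha] at this
  · intro a ha
    rw [heq] at ha
    have hfin := vecNorm_ne_top ha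
    have := (key a ha).2.2 (fun n => Ω (a n)) fun n => hBΩ (a n) (hfin n)
    simp only [fun n => hB.eval (a n) (hfin n)] at this
    exact this

end VectorValued

end VectorInterp

open VectorInterp in
theorem theorem3p4
    {𝕜 E : Type*} [RCLike 𝕜] [NormedAddCommGroup E] [NormedSpace 𝕜 E] [CompleteSpace E]
    (e : UnconditionalSchauderBasis ℕ 𝕜 E) (he : IsOneUnconditional e)
    {W : Type*} [AddCommGroup W] [Module ℂ W] [TopologicalSpace W] [IsTopologicalAddGroup W]
    [ContinuousSMul ℂ W] [T2Space W]
    {X₀ X₁ : Type*} [NormedAddCommGroup X₀] [NormedSpace ℂ X₀] [CompleteSpace X₀]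
    [NormedAddCommGroup X₁] [NormedSpace ℂ X₁] [CompleteSpace X₁]
    (j₀ : X₀ →L[ℂ] W) (j₁ : X₁ →L[ℂ] W)
    (hj₀ : Function.Injective j₀) (hj₁ : Function.Injective j₁)
    (θ p₀ p₁ p : ℝ) (hθ₀ : 0 < θ) (hθ₁ : θ < 1) (hp₀ : 1 ≤ p₀) (hp₁ : 1 ≤ p₁)
    (hp : 1 / p = (1 - θ) / p₀ + θ / p₁) :
    interpNorm (vecNorm e p₀ (embNorm j₀)) (vecNorm e p₁ (embNorm j₁)) θ
        = vecNorm e p (interpNorm (embNorm j₀) (embNorm j₁) θ) ∧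
    ∀ Ω : W → W, IsDerivation (embNorm j₀) (embNorm j₁) θ Ω →
      ∃ Φ : (ℕ → W) → (ℕ → W),
        IsDerivation (vecNorm e p₀ (embNorm j₀)) (vecNorm e p₁ (embNorm j₁)) θ Φ ∧
        ∀ a : ℕ → W, vecNorm e p (interpNorm (embNorm j₀) (embNorm j₁) θ) a ≠ ⊤ →
          (Function.support a).Finite →
          ∀ n : ℕ, Φ a n =
            (((p / p₁ - p / p₀) *
              Real.log ((interpNorm (embNorm j₀) (embNorm j₁) θ (a n)).toReal /
                (vecNorm e p (interpNorm (embNorm j₀) (embNorm j₁) θ) a).toReal) : ℝ) : ℂ) • a n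
            + Ω (a n) := by
  have hp_pos : 0 < p := by
    rw [← one_div_pos, hp]
    have : 0 < 1 - θ := by linarith
    positivity
  exact ⟨interpNorm_vecNorm he hj₀ hj₁ hθ₀ hθ₁ hp₀ hp₁ hp_pos hp, fun Ω hΩ =>
    ⟨_, isDerivation_vecNorm he hj₀ hj₁ hθ₀ hθ₁ hp₀ hp₁ hp_pos hp hΩ, fun _ _ _ _ => rfl⟩⟩
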